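/- Let $X\subset\mathbb{A}^{18}$ be the $\mathsf{G}_2$ cluster variety, with coordinates $\theta_i,\theta_{ij},A_i,A_{ij}$ ($i\in\{1,2,3,4\}$, $\{i,j\}\in\{12,23,34,41\}$, unordered indices) and $\lambda_{13},\lambda_{24}$, defined by the relations $$\begin{aligned} \theta_i\theta_j &= A_{ij}\theta_{ij}+A_{jk}A_kA_{kl}^2A_lA_{li},\\ \theta_{ij}\theta_{jk} &= A_j\theta_j^3+\lambda_{jl}A_{kl}A_{li}\theta_j^2+\lambda_{ik}A_{kl}^2A_lA_{li}^2\theta_j+A_kA_{kl}^3A_l^2A_{li}^3A_i,\\ \theta_i\theta_{jk} &= A_{ij}A_j\theta_j^2+\lambda_{jl}A_{kl}A_{li}A_{ij}\theta_j+\lambda_{ik}A_{kl}^2A_lA_{li}^2A_{ij}+A_kA_{kl}^2A_lA_{li}\theta_k,\\ \theta_i\theta_k &= A_{ij}A_jA_{jk}\theta_j+\lambda_{jl}A_{ij}A_{jk}A_{kl}A_{li}+A_{kl}A_lA_{li}\theta_l,\\ \theta_{ij}\theta_{kl} &= A_jA_{jk}^2A_k\theta_j\theta_k+A_{li}A_{jk}(\lambda_{ik}\theta_i\theta_k+\lambda_{jl}\theta_j\theta_l)+A_lA_{li}^2A_i\theta_l\theta_i+A_{ij}A_{jk}^2A_{kl}A_{li}^2(A_iA_jA_kA_l-\lambda_{ik}\lambda_{jl}),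 \end{aligned}$$ where $(i,j,k,l)$ runs over the eight dihedral permutations of $(1,2,3,4)$. Integers $\rho_1,\rho_{12},\rho_2,\dots,\rho_4,\rho_{41}$ determine a $\mathbb{Z}$-grading with $d(\theta_i)=\rho_i$, $d(\theta_{ij})=\rho_{ij}$, $d(A_i)=\rho_{li}-3\rho_i+\rho_{ij}$, $d(A_{ij})=\rho_i-\rho_{ij}+\rho_j$ and $d(\lambda_{ik})=-2\rho_i+\rho_{ij}-\rho_j+\rho_{jk}-2\rho_k+\rho_{kl}-\rho_l+\rho_{li}$. Let $\mathbb{A}^{10}$ be graded with positive integer weights, let $\phi\colon\mathbb{A}^{10}\to\mathbb{A}^{18}$ be a morphism over $\mathbb{C}$ that is homogeneous of degree $0$ and such that $\phi^*(v)$ is a nonzero constant for every coordinate $v$ with $d(v)=0$ (so $\phi^*(v)=0$ if $d(v)<0$). Suppose that $\widehat Y=\phi^{-1}(X)$ has codimension $6$, is nonsingular away from the origin, and is not a complete intersection. Suppose that $\widehat Y$ is in $\mathsf{G}_2^{(4)}$ format, that is, $d(A_{12})=d(A_{34})=0$ and $d(A_{23}),d(A_{41})>0$. Write $T$ for the pullbacks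 of the two relations for $\theta_1\theta_2$ and $\theta_3\theta_4$ (which make $\theta_{12}$, $\theta_{34}$ redundant). A homogeneous coordinate change means a graded automorphism of the coordinate ring of $\mathbb{A}^{18}$; primes denote the new coordinates, pulled back by $\phi$. Then $d(\lambda_{13}),d(\lambda_{24})\ge 0$, and: 1. If $d(\lambda_{13}),d(\lambda_{24})>0$, then $d(A_i)\ge0$ for all $i$ and $\widehat Y$ is in strict $\mathsf{G}_2^{(4)}$ format: its ideal is generated by $T$ and the pullbacks of the nine relations above that do not involve $\theta_{12},\theta_{34}$. 2. If $d(\lambda_{24})=0$ and $d(\lambda_{13})>0$, then $\widehat Y$ is in rolling factors format: after a homogeneous coordinate change its ideal is generated by $T$ and $$\bigwedge^2\begin{pmatrix}\theta_{23}'&\theta_3'&\theta_4'&A_{41}'\\ \theta_2'&A_{23}'&\theta_{41}'&\theta_1'\end{pmatrix},\qquad\begin{aligned}\theta_{23}'\theta_4'&=A_3'\theta_3'^2+\lambda_{13}'A_{41}'\theta_3'+A_1'A_{41}'^2,\\ \theta_{23}'\theta_{41}'&=A_3'\theta_3'A_{23}'+\lambda_{13}'A_{41}'A_{23}'+A_1'A_{41}'\theta_1',\\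 \theta_2'\theta_{41}'&=A_3'A_{23}'^2+\lambda_{13}'\theta_1'A_{23}'+A_1'\theta_1'^2.\end{aligned}$$ Moreover, if $d(A_2)<0$ and $\phi^*(A_{12})=\phi^*(A_{34})=\phi^*(\lambda_{24})=1$, one may take $\theta_2'=\theta_2+\lambda_{13}A_4A_{41}+A_3A_4\theta_3$, $A_{23}'=A_4\theta_4+A_{23}$, the other coordinates being unchanged. If $d(\lambda_{13})=0$ and $d(\lambda_{24})>0$, the format assertion (the existence of such a coordinate change) holds with the indices permuted by $1\leftrightarrow2$, $3\leftrightarrow4$. 3. If $d(\lambda_{13})=d(\lambda_{24})=0$, then $\widehat Y$ is in $\mathbb{P}^1\times\mathbb{P}^1\times\mathbb{P}^1$ format: after a homogeneous coordinate change its ideal is generated by $T$ and the $2\times2$ minors of (the three $2\times4$ flattenings of) the $2\times2\times2$ cube $$c_{000}=\theta_2',\ c_{100}=\theta_{23}',\ c_{010}=A_{23}',\ c_{110}=\theta_3',\ c_{001}=\theta_1',\ c_{101}=A_{41}',\ c_{011}=\theta_{41}',\ c_{111}=\theta_4'.$$ Moreover, assume $\phi^*(A_{12})=\phi^*(A_{34})=\phi^*(\lambda_{13})=\phi^*(\lambda_{24})=1$.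 If $d(A_2),d(A_3)<0$, one may take $\theta_2'=\theta_2+A_4A_{41}$, $\theta_3'=\theta_3+A_{41}A_1$, $A_{23}'=A_{23}+A_4\theta_4+A_1\theta_1$, the other coordinates being unchanged. If $\phi^*(A_i)=1$ for all $i$, one may take, for any primitive $8$th root of unity $\epsilon$ and $\sqrt2:=\epsilon+\epsilon^{-1}$, $$\begin{gathered}\theta_2'=\theta_2+\theta_3,\quad \theta_4'=\theta_4+\theta_1,\quad \theta_{23}'=\theta_{23},\quad \theta_{41}'=\theta_{41},\\ \theta_1'=\epsilon\theta_1+\epsilon^3\theta_4+\sqrt2\epsilon^2A_{23},\quad -A_{23}'=\epsilon^3\theta_1+\epsilon\theta_4+\sqrt2\epsilon^2A_{23},\\ -\theta_3'=\epsilon\theta_3+\epsilon^3\theta_2+\sqrt2\epsilon^2A_{41},\quad A_{41}'=\epsilon^3\theta_3+\epsilon\theta_2+\sqrt2\epsilon^2A_{41}.\end{gathered}$$ -/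

import Mathlib

open MvPolynomial

/-- The 18 coordinates on the ambient affine space of the `G₂` cluster variety. The vertices
`1, 2, 3, 4` of the square are the elements of `ZMod 4` (so `4 = 0`), and the edge joining `i` and
`i + 1` is indexed by `i`: `thetaE i`, `coeffE i` are `θ_{i,i+1}`, `A_{i,i+1}`. -/
inductive G2Var : Type
  | theta (i : ZMod 4)
  | thetaE (i : ZMod 4)
  | coeff (i : ZMod 4)
  | coeffE (i : ZMod 4)
  | lam13
  | lam24

namespace G2Var

/-- The cluster variable `θ_{ij} = θ_{ji}` for adjacent vertices `i, j`. -/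
def th (i j : ZMod 4) : G2Var := if j = i + 1 then thetaE i else thetaE j

/-- The coefficient `A_{ij} = A_{ji}` for adjacent vertices `i, j`. -/
def co (i j : ZMod 4) : G2Var := if j = i + 1 then coeffE i else coeffE j

/-- The parameter `λ_{ik} = λ_{ki}` for opposite vertices `i, k`. -/
def lam (i _k : ZMod 4) : G2Var := if i = 1 ∨ i = 3 then lam13 else lam24

end G2Var

/-- `(i, j, k, l)` is a dihedral permutation of `(1, 2, 3, 4)`. -/
def IsDihedralPerm (i j k l : ZMod 4) : Prop :=
  ∃ e : ZMod 4, (e = 1 ∨ e = -1) ∧ j = i + e ∧ k = i + 2 * e ∧ l = i + 3 * e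

section Relations

variable {R : Type*} [CommRing R]

/-! The relations of the `G₂` cluster variety, evaluated at a family `x` of elements of a ring. -/

def tagRel (x : G2Var → R) (i j k l : ZMod 4) : R :=
  x (.theta i) * x (.theta j) -
    (x (.co i j) * x (.th i j) +
      x (.co j k) * x (.coeff k) * x (.co k l) ^ 2 * x (.coeff l) * x (.co l i))

def cubicRel (x : G2Var → R) (i j k l : ZMod 4) : R :=
  x (.th i j) * x (.th j k) -
    (x (.coeff j) * x (.theta j) ^ 3 +
      x (.lam j l) * x (.co k l) * x (.co l i) * x (.theta j) ^ 2 +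
      x (.lam i k) * x (.co k l) ^ 2 * x (.coeff l) * x (.co l i) ^ 2 * x (.theta j) +
      x (.coeff k) * x (.co k l) ^ 3 * x (.coeff l) ^ 2 * x (.co l i) ^ 3 * x (.coeff i))

def mixedRel (x : G2Var → R) (i j k l : ZMod 4) : R :=
  x (.theta i) * x (.th j k) -
    (x (.co i j) * x (.coeff j) * x (.theta j) ^ 2 +
      x (.lam j l) * x (.co k l) * x (.co l i) * x (.co i j) * x (.theta j) +
      x (.lam i k) * x (.co k l) ^ 2 * x (.coeff l) * x (.co l i) ^ 2 * x (.co i j) +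
      x (.coeff k) * x (.co k l) ^ 2 * x (.coeff l) * x (.co l i) * x (.theta k))

def oppositeRel (x : G2Var → R) (i j k l : ZMod 4) : R :=
  x (.theta i) * x (.theta k) -
    (x (.co i j) * x (.coeff j) * x (.co j k) * x (.theta j) +
      x (.lam j l) * x (.co i j) * x (.co j k) * x (.co k l) * x (.co l i) +
      x (.co k l) * x (.coeff l) * x (.co l i) * x (.theta l))

def longRel (x : G2Var → R) (i j k l : ZMod 4) : R :=
  x (.th i j) * x (.th k l) -
    (x (.coeff j) * x (.co j k) ^ 2 * x (.coeff k) * x (.theta j) * x (.theta k) +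
      x (.co l i) * x (.co j k) *
        (x (.lam i k) * x (.theta i) * x (.theta k) + x (.lam j l) * x (.theta j) * x (.theta l)) +
      x (.coeff l) * x (.co l i) ^ 2 * x (.coeff i) * x (.theta l) * x (.theta i) +
      x (.co i j) * x (.co j k) ^ 2 * x (.co k l) * x (.co l i) ^ 2 *
        (x (.coeff i) * x (.coeff j) * x (.coeff k) * x (.coeff l) - x (.lam i k) * x (.lam j l)))

/-- The relations of the `G₂` cluster variety (20 different ones). -/
def g2Relations (x : G2Var → R) : Set R :=
  {f | ∃ i j k l, IsDihedralPerm i j k l ∧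
    (f = tagRel x i j k l ∨ f = cubicRel x i j k l ∨ f = mixedRel x i j k l ∨
      f = oppositeRel x i j k l ∨ f = longRel x i j k l)}

/-- The nine relations of `G₂⁽⁴⁾` format: the relations of the cluster variety that do not involve
`θ₁₂` and `θ₃₄`. -/
def g24Relations (x : G2Var → R) : Set R :=
  {tagRel x 2 3 4 1, tagRel x 4 1 2 3, oppositeRel x 1 2 3 4, oppositeRel x 2 3 4 1,
    mixedRel x 1 2 3 4, mixedRel x 4 3 2 1, mixedRel x 2 1 4 3, mixedRel x 3 4 1 2,
    longRel x 2 3 4 1}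

/-- The complete intersection part of codimension 2: the tag relations
`θ₁θ₂ = A₁₂θ₁₂ + A₂₃A₃A₃₄²A₄A₄₁` and `θ₃θ₄ = A₃₄θ₃₄ + A₄₁A₁A₁₂²A₂A₂₃`, which make `θ₁₂` and `θ₃₄`
redundant when `A₁₂` and `A₃₄` are nonzero constants. -/
def redundantRelations (x : G2Var → R) : Set R :=
  {tagRel x 1 2 3 4, tagRel x 3 4 1 2}

/-- The nine relations of rolling factors format: the `2 × 2` minors of a `2 × 4` matrix, together
with the quadratic relation `m₁m₃ = a m₂² + l m₂m₄ + b m₄²` on its first row and the two relations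
obtained by successively replacing ("rolling") in each monomial an entry of the first row by the
entry of the second row in the same column. -/
def rollingFactorsRelations (M : Matrix (Fin 2) (Fin 4) R) (a l b : R) : Set R :=
  {f | ∃ s t, f = M 0 s * M 1 t - M 0 t * M 1 s} ∪
  {M 0 0 * M 0 2 - (a * M 0 1 ^ 2 + l * M 0 3 * M 0 1 + b * M 0 3 ^ 2),
   M 0 0 * M 1 2 - (a * M 0 1 * M 1 1 + l * M 0 3 * M 1 1 + b * M 0 3 * M 1 3),
   M 1 0 * M 1 2 - (a * M 1 1 ^ 2 + l * M 1 3 * M 1 1 + b * M 1 3 ^ 2)}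

/-- The relations of `ℙ¹ × ℙ¹ × ℙ¹` format: the `2 × 2` minors of a `2 × 2 × 2` cube, i.e. of its
three flattenings to `2 × 4` matrices (the equations of the Segre embedding in `ℙ⁷`). -/
def cubeMinors (c : Fin 2 → Fin 2 → Fin 2 → R) : Set R :=
  {f | ∃ p q r p' q' r',
    f = c p q r * c p' q' r' - c p' q r * c p q' r' ∨
    f = c p q r * c p' q' r' - c p q' r * c p' q r' ∨
    f = c p q r * c p' q' r' - c p q r' * c p' q' r}

/-- The matrix
`(θ_{jk}, θ_k, θ_l, A_{li} ; θ_j, A_{jk}, θ_{li}, θ_i)`. -/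
def g2Matrix (x : G2Var → R) (i j k l : ZMod 4) : Matrix (Fin 2) (Fin 4) R :=
  !![x (.th j k), x (.theta k), x (.theta l), x (.co l i);
     x (.theta j), x (.co j k), x (.th l i), x (.theta i)]

/-- The cube with front face `θ₂, θ₂₃, A₂₃, θ₃` and back face `θ₁, A₄₁, θ₄₁, θ₄`. -/
def g2Cube (x : G2Var → R) : Fin 2 → Fin 2 → Fin 2 → R :=
  ![![![x (.theta 2), x (.theta 1)], ![x (.co 2 3), x (.th 4 1)]],
    ![![x (.th 2 3), x (.co 4 1)], ![x (.theta 3), x (.theta 4)]]]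

end Relations

/-- A one-parameter subgroup `ρ = (ρ₁, ρ₁₂, …, ρ₄, ρ₄₁)` of the torus acting on the `G₂` cluster
variety; `vertex i` is `ρ_i` and `edge i` is `ρ_{i,i+1}`. -/
structure G2Weight where
  vertex : ZMod 4 → ℤ
  edge : ZMod 4 → ℤ

/-- The degree of each coordinate in the `ℤ`-grading determined by `ρ`. -/
def G2Weight.d (ρ : G2Weight) : G2Var → ℤ
  | .theta i => ρ.vertex i
  | .thetaE i => ρ.edge i
  | .coeff i => ρ.edge (i - 1) - 3 * ρ.vertex i + ρ.edge i
  | .coeffE i => ρ.vertex i - ρ.edge i + ρ.vertex (i + 1)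
  | .lam13 => -2 * ρ.vertex 1 + ρ.edge 1 - ρ.vertex 2 + ρ.edge 2
      - 2 * ρ.vertex 3 + ρ.edge 3 - ρ.vertex 4 + ρ.edge 4
  | .lam24 => -2 * ρ.vertex 2 + ρ.edge 2 - ρ.vertex 3 + ρ.edge 3
      - 2 * ρ.vertex 4 + ρ.edge 4 - ρ.vertex 1 + ρ.edge 1

/-- The ideal of the `G₂` cluster variety in its ambient affine space. -/
noncomputable def g2Ideal : Ideal (MvPolynomial G2Var ℂ) :=
  Ideal.span (g2Relations X)

/-- The ideal of the pullback of the `G₂` cluster variety along the morphism of affine spaces with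
components `φ`. -/
noncomputable def pullbackIdeal {n : ℕ} (φ : G2Var → MvPolynomial (Fin n) ℂ) :
    Ideal (MvPolynomial (Fin n) ℂ) :=
  Ideal.map (aeval φ) g2Ideal

/-- `φ` is a morphism from `𝔸ⁿ` (with positive weights `w`), homogeneous of degree zero for the
grading given by `ρ`, the coordinates of degree zero being pulled back to nonzero constants, and the
pullback has the expected codimension 6, i.e. dimension `n - 6`. -/
structure IsRegularPullback {n : ℕ} (ρ : G2Weight) (w : Fin n → ℕ)
    (φ : G2Var → MvPolynomial (Fin n) ℂ) : Prop where
  weight_pos : ∀ s, 0 < w s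
  homogeneous : ∀ v, IsWeightedHomogeneous (fun s => (w s : ℤ)) (φ v) (ρ.d v)
  ne_zero : ∀ v, ρ.d v = 0 → φ v ≠ 0
  codim : ringKrullDim (MvPolynomial (Fin n) ℂ ⧸ pullbackIdeal φ) + 6 = n

/-- The affine cone of codimension `c` defined by `I` has at worst an isolated singularity at the
vertex: its Jacobian matrix has rank `c` at all its points other than the origin. -/
def IsQuasismoothCone {n : ℕ} (c : ℕ) (I : Ideal (MvPolynomial (Fin n) ℂ)) : Prop :=
  ∀ p : Fin n → ℂ, p ≠ 0 → (∀ f ∈ I, eval p f = 0) →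
    Module.finrank ℂ (Submodule.span ℂ
      {g : Fin n → ℂ | ∃ f ∈ I, g = fun s => eval p (pderiv s f)}) = c

/-- `I`, of codimension `c`, is a complete intersection: it is generated by `c` elements. -/
def IsCompleteIntersection {n : ℕ} (c : ℕ) (I : Ideal (MvPolynomial (Fin n) ℂ)) : Prop :=
  ∃ f : Fin c → MvPolynomial (Fin n) ℂ, I = Ideal.span (Set.range f)

/-- A homogeneous change of coordinates on the ambient space of the `G₂` cluster variety. -/
def IsHomogeneousCoordinateChange (ρ : G2Weight)
    (α : MvPolynomial G2Var ℂ ≃ₐ[ℂ] MvPolynomial G2Var ℂ) : Prop :=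
  ∀ v, IsWeightedHomogeneous ρ.d (α (X v)) (ρ.d v)

/-- Numerical conditions `d(A₁₂) = d(A₃₄) = 0` and `d(A₂₃), d(A₄₁) > 0` of `G₂⁽⁴⁾` format. -/
structure G2Weight.IsG24 (ρ : G2Weight) : Prop where
  d_12 : ρ.d (.co 1 2) = 0
  d_34 : ρ.d (.co 3 4) = 0
  d_23 : 0 < ρ.d (.co 2 3)
  d_41 : 0 < ρ.d (.co 4 1)

/-- Strict `G₂⁽⁴⁾` format: both parameters have positive degree, all `A_i` have nonnegative degree
and the pullback is defined by the nine relations of `G₂⁽⁴⁾` format together with the complete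
intersection relations for the redundant variables `θ₁₂, θ₃₄`. -/
structure InStrictG24Format {n : ℕ} (ρ : G2Weight) (φ : G2Var → MvPolynomial (Fin n) ℂ) :
    Prop where
  isG24 : ρ.IsG24
  d_lam13 : 0 < ρ.d .lam13
  d_lam24 : 0 < ρ.d .lam24
  d_coeff : ∀ i, 0 ≤ ρ.d (.coeff i)
  ideal_eq : pullbackIdeal φ = Ideal.span (g24Relations φ ∪ redundantRelations φ)

/-- Rolling factors format: after a homogeneous change of coordinates on the ambient space of the
cluster variety, the pullback is defined by the nine relations of rolling factors format together
with the complete intersection relations for the redundant variables. -/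
def InRollingFactorsFormat {n : ℕ} (ρ : G2Weight) (φ : G2Var → MvPolynomial (Fin n) ℂ)
    (i j k l : ZMod 4) : Prop :=
  ∃ α : MvPolynomial G2Var ℂ ≃ₐ[ℂ] MvPolynomial G2Var ℂ, IsHomogeneousCoordinateChange ρ α ∧
    ∀ x : G2Var → MvPolynomial (Fin n) ℂ, (∀ v, x v = aeval φ (α (X v))) →
      pullbackIdeal φ = Ideal.span
        (rollingFactorsRelations (g2Matrix x i j k l)
          (x (.coeff k)) (x (.lam i k)) (x (.coeff i)) ∪ redundantRelations φ)

/-- `ℙ¹ × ℙ¹ × ℙ¹` format: after a homogeneous change of coordinates on the ambient space of the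
cluster variety, the pullback is defined by the `2 × 2` minors of a cube of coordinates together
with the complete intersection relations for the redundant variables. -/
def InP1CubedFormat {n : ℕ} (ρ : G2Weight) (φ : G2Var → MvPolynomial (Fin n) ℂ) : Prop :=
  ∃ α : MvPolynomial G2Var ℂ ≃ₐ[ℂ] MvPolynomial G2Var ℂ, IsHomogeneousCoordinateChange ρ α ∧
    ∀ x : G2Var → MvPolynomial (Fin n) ℂ, (∀ v, x v = aeval φ (α (X v))) →
      pullbackIdeal φ = Ideal.span (cubeMinors (g2Cube x) ∪ redundantRelations φ)

/-! Inclusions of ideals are turned into implications between equations. Modulo the ideal spanned by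
`H`, the claim `span G ≤ span H` says that the equations `H` imply the equations `G` in a
commutative ring (`span_le_span_of_image_eq_zero`), and each implication is certified by an explicit
linear combination, after multiplication by a unit where needed. In particular, since `A₁₂` and
`A₃₄` are nonzero constants, `T` and the nine relations generate everything (`span_g2Relations_eq`).

The geometry enters through singular points. Fewer than ten polynomials vanishing at the origin of
`𝔸¹⁰` have a common zero elsewhere (Nullstellensatz and Krull's height theorem), so a locus of at
most nine such equations, along which the gradients of the generators span at most five dimensions,
contradicts quasismoothness (`IsQuasismoothCone.false_of_singularLocus`). To know that the variables
vanish at the origin, degree zero must be excluded for all `θ`: if `θ₁` or `θ₂₃` is a unit, four of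
the nine relations imply the rest and the pullback is a complete intersection. The symmetries give
the other vertices and `θ₄₁`, and the tag relations handle `θ₁₂` and `θ₃₄`.

If `A₁ = 0` and `d(λ₁₃) ≠ 0`, such a singular locus exists. With the symmetries of the square, the
vanishing of some `A_i` forces the `λ` of its diagonal to have degree zero. The identities `d(A₁) +
d(A₃) = 2d(λ₁₃) - d(λ₂₄)` and `d(A₂) + d(A₄) = 2d(λ₂₄) - d(λ₁₃)` then give `d(λ) ≥ 0` and the strict
case.

If only `λ₂₄` is constant, the second sum is negative, so up to rotation `A₂ = 0`. The torus
normalises `A₁₂`, `A₃₄`, `λ₂₄` to one, and an explicit triangular substitution gives rolling factors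
(`g24Eqs_iff_rollingEqs`).

If both `λ` are constant, both sums vanish. Either some `A_i` has negative degree, so that up to
symmetry `A₂ = 0` and rolling factors apply, or all `A_i` are constant. In the latter case a root
`t` of `A₂A₄z³ + z² + λ₁₃z + A₁A₃` gives rolling factors, provided that the root is simple; a
multiple root produces a singular point. Rolling factors become a `2 × 2 × 2` cube once their
quadratic form splits into independent linear factors (`rollingEqs_iff_cubeEqs`), and a constant
form that is a multiple of a square is again singular. For constant `A_i` the discriminant of the
form is that of the residual quadratic of the cubic, so quasismoothness forces three distinct roots.
-/

theorem ZMod.eq_one_or_two_or_three_or_four (i : ZMod 4) : i = 1 ∨ i = 2 ∨ i = 3 ∨ i = 4 := by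
  revert i
  decide

/-! ### The relations of the three formats as systems of equations -/

section Equations

variable {R S : Type*} [CommRing R] [CommRing S]

namespace G2Var

theorem th_12 : th 1 2 = thetaE 1 := rfl
theorem th_21 : th 2 1 = thetaE 1 := rfl
theorem th_23 : th 2 3 = thetaE 2 := rfl
theorem th_32 : th 3 2 = thetaE 2 := rfl
theorem th_34 : th 3 4 = thetaE 3 := rfl
theorem th_43 : th 4 3 = thetaE 3 := rfl
theorem th_41 : th 4 1 = thetaE 4 := rfl
theorem th_14 : th 1 4 = thetaE 4 := rfl
theorem co_12 : co 1 2 = coeffE 1 := rfl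
theorem co_21 : co 2 1 = coeffE 1 := rfl
theorem co_23 : co 2 3 = coeffE 2 := rfl
theorem co_32 : co 3 2 = coeffE 2 := rfl
theorem co_34 : co 3 4 = coeffE 3 := rfl
theorem co_43 : co 4 3 = coeffE 3 := rfl
theorem co_41 : co 4 1 = coeffE 4 := rfl
theorem co_14 : co 1 4 = coeffE 4 := rfl
theorem lam_13 : lam 1 3 = lam13 := rfl
theorem lam_31 : lam 3 1 = lam13 := rfl
theorem lam_24 : lam 2 4 = lam24 := rfl
theorem lam_42 : lam 4 2 = lam24 := rfl

end G2Var

open G2Var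

/-- The nine equations of `G₂⁽⁴⁾` format. -/
structure G24Eqs (t1 t2 t3 t4 t23 t41 A1 A2 A3 A4 a A23 b A41 l13 l24 : S) : Prop where
  tag23 : t2 * t3 = A23 * t23 + b * A4 * A41 ^ 2 * A1 * a
  tag41 : t4 * t1 = A41 * t41 + a * A2 * A23 ^ 2 * A3 * b
  opp13 : t1 * t3 = a * A2 * A23 * t2 + l24 * a * A23 * b * A41 + b * A4 * A41 * t4
  opp24 : t2 * t4 = A23 * A3 * b * t3 + l13 * A23 * b * A41 * a + A41 * A1 * a * t1
  mix1 : t1 * t23 = a * A2 * t2 ^ 2 + l24 * b * A41 * a * t2 + l13 * b ^ 2 * A4 * A41 ^ 2 * a +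
    A3 * b ^ 2 * A4 * A41 * t3
  mix4 : t4 * t23 = b * A3 * t3 ^ 2 + l13 * a * A41 * b * t3 + l24 * a ^ 2 * A1 * A41 ^ 2 * b +
    A2 * a ^ 2 * A1 * A41 * t2
  mix2 : t2 * t41 = a * A1 * t1 ^ 2 + l13 * b * A23 * a * t1 + l24 * b ^ 2 * A3 * A23 ^ 2 * a +
    A4 * b ^ 2 * A3 * A23 * t4
  mix3 : t3 * t41 = b * A4 * t4 ^ 2 + l24 * a * A23 * b * t4 + l13 * a ^ 2 * A2 * A23 ^ 2 * b +
    A1 * a ^ 2 * A2 * A23 * t1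
  long : t23 * t41 = A3 * b ^ 2 * A4 * t3 * t4 + a * b * (l24 * t2 * t4 + l13 * t3 * t1) +
    A1 * a ^ 2 * A2 * t1 * t2 + A23 * b ^ 2 * A41 * a ^ 2 * (A1 * A2 * A3 * A4 - l24 * l13)

/-- The equations of rolling factors format. -/
structure RollingEqs (m₁ m₂ m₃ m₄ n₁ n₂ n₃ n₄ a l b : S) : Prop where
  minor12 : m₁ * n₂ = m₂ * n₁
  minor13 : m₁ * n₃ = m₃ * n₁
  minor14 : m₁ * n₄ = m₄ * n₁
  minor23 : m₂ * n₃ = m₃ * n₂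
  minor24 : m₂ * n₄ = m₄ * n₂
  minor34 : m₃ * n₄ = m₄ * n₃
  quad : m₁ * m₃ = a * m₂ ^ 2 + l * m₄ * m₂ + b * m₄ ^ 2
  rolled : m₁ * n₃ = a * m₂ * n₂ + l * m₄ * n₂ + b * m₄ * n₄
  rolled' : n₁ * n₃ = a * n₂ ^ 2 + l * n₄ * n₂ + b * n₄ ^ 2

theorem forall_g24Relations_eq_zero (y : G2Var → S) :
    (∀ f ∈ g24Relations y, f = 0) ↔
      G24Eqs (y (.theta 1)) (y (.theta 2)) (y (.theta 3)) (y (.theta 4)) (y (.thetaE 2))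
        (y (.thetaE 4)) (y (.coeff 1)) (y (.coeff 2)) (y (.coeff 3)) (y (.coeff 4))
        (y (.coeffE 1)) (y (.coeffE 2)) (y (.coeffE 3)) (y (.coeffE 4)) (y .lam13) (y .lam24) := by
  simp only [g24Relations, Set.mem_insert_iff, Set.mem_singleton_iff, forall_eq_or_imp, forall_eq,
    tagRel, oppositeRel, mixedRel, longRel, sub_eq_zero, th_23, th_32, th_41, th_14, co_12, co_21,
    co_23, co_32, co_34, co_43, co_41, co_14, lam_13, lam_31, lam_24, lam_42]
  constructor
  · rintro ⟨h1, h2, h3, h4, h5, h6, h7, h8, h9⟩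
    constructor <;> grind
  · rintro ⟨h1, h2, h3, h4, h5, h6, h7, h8, h9⟩
    refine ⟨?_, ?_, ?_, ?_, ?_, ?_, ?_, ?_, ?_⟩ <;> grind

theorem forall_redundantRelations_eq_zero (y : G2Var → S) :
    (∀ f ∈ redundantRelations y, f = 0) ↔
      y (.theta 1) * y (.theta 2) = y (.coeffE 1) * y (.thetaE 1) +
        y (.coeffE 2) * y (.coeff 3) * y (.coeffE 3) ^ 2 * y (.coeff 4) * y (.coeffE 4) ∧
      y (.theta 3) * y (.theta 4) = y (.coeffE 3) * y (.thetaE 3) +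
        y (.coeffE 4) * y (.coeff 1) * y (.coeffE 1) ^ 2 * y (.coeff 2) * y (.coeffE 2) := by
  simp only [redundantRelations, Set.mem_insert_iff, Set.mem_singleton_iff, forall_eq_or_imp,
    forall_eq, tagRel, sub_eq_zero, th_12, th_34, co_12, co_23, co_34, co_41]

theorem forall_rollingFactorsRelations_eq_zero (m₁ m₂ m₃ m₄ n₁ n₂ n₃ n₄ a l b : S) :
    (∀ f ∈ rollingFactorsRelations !![m₁, m₂, m₃, m₄; n₁, n₂, n₃, n₄] a l b, f = 0) ↔
      RollingEqs m₁ m₂ m₃ m₄ n₁ n₂ n₃ n₄ a l b := by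
  simp only [rollingFactorsRelations, Set.mem_union, Set.mem_ofPred, Set.mem_insert_iff,
    Set.mem_singleton_iff, or_imp, forall_and, forall_eq, forall_exists_index]
  constructor
  · rintro ⟨h, h1, h2, h3⟩
    have h12 := h _ 0 1 rfl
    have h13 := h _ 0 2 rfl
    have h14 := h _ 0 3 rfl
    have h23 := h _ 1 2 rfl
    have h24 := h _ 1 3 rfl
    have h34 := h _ 2 3 rfl
    simp at h12 h13 h14 h23 h24 h34 h1 h2 h3
    constructor <;> grind
  · rintro ⟨h12, h13, h14, h23, h24, h34, h1, h2, h3⟩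
    refine ⟨?_, ?_, ?_, ?_⟩
    · rintro _ s t rfl
      fin_cases s <;> fin_cases t <;> simp <;> grind
    all_goals simp; grind

/-- The quadrics defining the Segre embedding of `ℙ¹ × ℙ¹ × ℙ¹`. -/
structure CubeEqs (m₁ m₂ m₃ m₄ n₁ n₂ n₃ n₄ : S) : Prop where
  minor12 : m₁ * n₂ = m₂ * n₁
  minor13 : m₁ * n₃ = m₃ * n₁
  minor14 : m₁ * n₄ = m₄ * n₁
  minor23 : m₂ * n₃ = m₃ * n₂
  minor24 : m₂ * n₄ = m₄ * n₂
  minor34 : m₃ * n₄ = m₄ * n₃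
  quad : m₁ * m₃ = m₂ * m₄
  rolled : m₁ * n₃ = m₄ * n₂
  rolled' : n₁ * n₃ = n₂ * n₄

theorem forall_cubeMinors_eq_zero (m₁ m₂ m₃ m₄ n₁ n₂ n₃ n₄ : S) :
    (∀ f ∈ cubeMinors ![![![n₁, n₄], ![n₂, n₃]], ![![m₁, m₄], ![m₂, m₃]]], f = 0) ↔
      CubeEqs m₁ m₂ m₃ m₄ n₁ n₂ n₃ n₄ := by
  simp only [cubeMinors, Set.mem_ofPred, or_imp, forall_and, forall_exists_index]
  constructor
  · rintro ⟨h, h₁, h₂⟩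
    have h' := fun p q r p' q' r' => And.intro (h _ p q r p' q' r' rfl)
      (And.intro (h₁ _ p q r p' q' r' rfl) (h₂ _ p q r p' q' r' rfl))
    have h12 := h' 1 0 0 0 1 0
    have h13 := h' 1 0 0 0 1 1
    have h14 := h' 1 0 0 0 0 1
    have h23 := h' 1 1 0 0 1 1
    have h24 := h' 1 1 0 0 0 1
    have h34 := h' 1 1 1 0 0 1
    have q1 := h' 1 0 0 1 1 1
    have q2 := h' 0 0 0 0 1 1
    simp at h12 h13 h14 h23 h24 h34 q1 q2
    constructor <;> grind
  · rintro ⟨h12, h13, h14, h23, h24, h34, h1, h2, h3⟩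
    refine ⟨?_, ?_, ?_⟩ <;> rintro _ p q r p' q' r' rfl <;>
    fin_cases p <;> fin_cases q <;> fin_cases r <;> fin_cases p' <;> fin_cases q' <;>
      fin_cases r' <;> simp <;> grind

end Equations

/-! ### From ideals to equations, and redundancy of the relations in `θ₁₂`, `θ₃₄` -/

section Spans

variable {R S : Type*} [CommRing R] [CommRing S]

open G2Var

theorem map_tagRel (ψ : R →+* S) (x : G2Var → R) (i j k l : ZMod 4) :
    ψ (tagRel x i j k l) = tagRel (fun v => ψ (x v)) i j k l := by simp [tagRel]

theorem map_cubicRel (ψ : R →+* S) (x : G2Var → R) (i j k l : ZMod 4) :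
    ψ (cubicRel x i j k l) = cubicRel (fun v => ψ (x v)) i j k l := by simp [cubicRel]

theorem map_mixedRel (ψ : R →+* S) (x : G2Var → R) (i j k l : ZMod 4) :
    ψ (mixedRel x i j k l) = mixedRel (fun v => ψ (x v)) i j k l := by simp [mixedRel]

theorem map_oppositeRel (ψ : R →+* S) (x : G2Var → R) (i j k l : ZMod 4) :
    ψ (oppositeRel x i j k l) = oppositeRel (fun v => ψ (x v)) i j k l := by simp [oppositeRel]

theorem map_longRel (ψ : R →+* S) (x : G2Var → R) (i j k l : ZMod 4) :
    ψ (longRel x i j k l) = longRel (fun v => ψ (x v)) i j k l := by simp [longRel]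

theorem image_g2Relations (ψ : R →+* S) (x : G2Var → R) :
    ψ '' g2Relations x = g2Relations (fun v => ψ (x v)) := by
  ext f
  simp only [g2Relations, Set.mem_image, Set.mem_ofPred, ← map_tagRel, ← map_cubicRel,
    ← map_mixedRel, ← map_oppositeRel, ← map_longRel]
  constructor
  · rintro ⟨_, ⟨i, j, k, l, h, rfl | rfl | rfl | rfl | rfl⟩, rfl⟩ <;>
      exact ⟨i, j, k, l, h, by simp⟩
  · rintro ⟨i, j, k, l, h, rfl | rfl | rfl | rfl | rfl⟩ <;>
      exact ⟨_, ⟨i, j, k, l, h, by tauto⟩, rfl⟩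

theorem image_g24Relations (ψ : R →+* S) (x : G2Var → R) :
    ψ '' g24Relations x = g24Relations (fun v => ψ (x v)) := by
  simp only [g24Relations, Set.image_insert_eq, Set.image_singleton, map_tagRel, map_mixedRel,
    map_oppositeRel, map_longRel]

theorem image_redundantRelations (ψ : R →+* S) (x : G2Var → R) :
    ψ '' redundantRelations x = redundantRelations (fun v => ψ (x v)) := by
  simp only [redundantRelations, Set.image_insert_eq, Set.image_singleton, map_tagRel]

theorem image_rollingFactorsRelations (ψ : R →+* S) (M : Matrix (Fin 2) (Fin 4) R) (a l b : R) :
    ψ '' rollingFactorsRelations M a l b =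
      rollingFactorsRelations (M.map ψ) (ψ a) (ψ l) (ψ b) := by
  rw [rollingFactorsRelations, rollingFactorsRelations, Set.image_union, Set.image_insert_eq,
    Set.image_pair]
  congr 1
  · ext f
    simp only [Set.mem_image, Set.mem_ofPred, Matrix.map_apply]
    constructor
    · rintro ⟨_, ⟨s, t, rfl⟩, rfl⟩
      exact ⟨s, t, by simp⟩
    · rintro ⟨s, t, rfl⟩
      exact ⟨_, ⟨s, t, rfl⟩, by simp⟩
  · simp

theorem image_cubeMinors (ψ : R →+* S) (c : Fin 2 → Fin 2 → Fin 2 → R) :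
    ψ '' cubeMinors c = cubeMinors (fun p q r => ψ (c p q r)) := by
  ext f
  simp only [cubeMinors, Set.mem_image, Set.mem_ofPred]
  constructor
  · rintro ⟨_, ⟨p, q, r, p', q', r', rfl | rfl | rfl⟩, rfl⟩ <;>
      exact ⟨p, q, r, p', q', r', by simp⟩
  · rintro ⟨p, q, r, p', q', r', rfl | rfl | rfl⟩
    · exact ⟨_, ⟨p, q, r, p', q', r', Or.inl rfl⟩, by simp⟩
    · exact ⟨_, ⟨p, q, r, p', q', r', Or.inr (Or.inl rfl)⟩, by simp⟩
    · exact ⟨_, ⟨p, q, r, p', q', r', Or.inr (Or.inr rfl)⟩, by simp⟩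

/-- In the quotient by the span of `H` the elements of `H` vanish, so it suffices to derive the
equations `G` from the equations `H` there. -/
theorem span_le_span_of_image_eq_zero {G H : Set R}
    (h : (∀ f ∈ Ideal.Quotient.mk (Ideal.span H) '' H, f = 0) →
      ∀ f ∈ Ideal.Quotient.mk (Ideal.span H) '' G, f = 0) :
    Ideal.span G ≤ Ideal.span H := by
  rw [Ideal.span_le]
  intro f hf
  refine Ideal.Quotient.eq_zero_iff_mem.1 (h ?_ _ ⟨f, hf, rfl⟩)
  rintro _ ⟨g, hg, rfl⟩
  exact Ideal.Quotient.eq_zero_iff_mem.2 (Ideal.subset_span hg)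

theorem isDihedralPerm_cases {i j k l : ZMod 4} (h : IsDihedralPerm i j k l) :
    (i = 1 ∧ j = 2 ∧ k = 3 ∧ l = 4) ∨ (i = 2 ∧ j = 3 ∧ k = 4 ∧ l = 1) ∨
    (i = 3 ∧ j = 4 ∧ k = 1 ∧ l = 2) ∨ (i = 4 ∧ j = 1 ∧ k = 2 ∧ l = 3) ∨
    (i = 4 ∧ j = 3 ∧ k = 2 ∧ l = 1) ∨ (i = 3 ∧ j = 2 ∧ k = 1 ∧ l = 4) ∨
    (i = 2 ∧ j = 1 ∧ k = 4 ∧ l = 3) ∨ (i = 1 ∧ j = 4 ∧ k = 3 ∧ l = 2) := by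
  obtain ⟨e, he, rfl, rfl, rfl⟩ := h
  revert i e
  decide

namespace G24Eqs

variable {t1 t2 t3 t4 t12 t34 t23 t41 A1 A2 A3 A4 a A23 b A41 l13 l24 : S}

/-- Multiply the relation by the unit `A₁₂` and eliminate `A₁₂θ₁₂` with the tag relation; the result
lies in the ideal of the nine relations. The next eight lemmas follow the same pattern with `A₁₂`,
`A₃₄` or their product, and together they give all relations involving `θ₁₂` or `θ₃₄` other than
`T`. -/
theorem mixed_4_12 (h : G24Eqs t1 t2 t3 t4 t23 t41 A1 A2 A3 A4 a A23 b A41 l13 l24) (ha : IsUnit a)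
    (r1 : t1 * t2 = a * t12 + A23 * A3 * b ^ 2 * A4 * A41) :
    t4 * t12 - t1 ^ 2 * A1 * A41 - t1 * A23 * b * A41 * l13 - A3 * A23 ^ 2 * b ^ 2 * A41 * l24 -
      t2 * A2 * A3 * A23 ^ 2 * b = 0 := by
  refine ha.mul_right_eq_zero.1 ?_
  linear_combination -t4 * r1 + t2 * h.tag41 + A41 * h.mix2

theorem mixed_3_12 (h : G24Eqs t1 t2 t3 t4 t23 t41 A1 A2 A3 A4 a A23 b A41 l13 l24) (ha : IsUnit a)
    (r1 : t1 * t2 = a * t12 + A23 * A3 * b ^ 2 * A4 * A41) :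
    t3 * t12 - t2 ^ 2 * A2 * A23 - t2 * A23 * b * A41 * l24 - A4 * A23 * b ^ 2 * A41 ^ 2 * l13 -
      t1 * A1 * A4 * b * A41 ^ 2 = 0 := by
  refine ha.mul_right_eq_zero.1 ?_
  linear_combination -t3 * r1 + t1 * h.tag23 + A23 * h.mix1

theorem mixed_2_34 (h : G24Eqs t1 t2 t3 t4 t23 t41 A1 A2 A3 A4 a A23 b A41 l13 l24) (hb : IsUnit b)
    (r2 : t3 * t4 = b * t34 + A41 * A1 * a ^ 2 * A2 * A23) :
    t2 * t34 - t3 ^ 2 * A3 * A23 - t3 * a * A23 * A41 * l13 - A1 * a ^ 2 * A23 * A41 ^ 2 * l24 -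
      t4 * A1 * A4 * a * A41 ^ 2 = 0 := by
  refine hb.mul_right_eq_zero.1 ?_
  linear_combination -t2 * r2 + t4 * h.tag23 + A23 * h.mix4

theorem mixed_1_34 (h : G24Eqs t1 t2 t3 t4 t23 t41 A1 A2 A3 A4 a A23 b A41 l13 l24) (hb : IsUnit b)
    (r2 : t3 * t4 = b * t34 + A41 * A1 * a ^ 2 * A2 * A23) :
    t1 * t34 - t4 ^ 2 * A4 * A41 - t4 * a * A23 * A41 * l24 - A2 * a ^ 2 * A23 ^ 2 * A41 * l13 -
      t3 * A2 * A3 * a * A23 ^ 2 = 0 := by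
  refine hb.mul_right_eq_zero.1 ?_
  linear_combination -t1 * r2 + t3 * h.tag41 + A41 * h.mix3

theorem cubic_2 (h : G24Eqs t1 t2 t3 t4 t23 t41 A1 A2 A3 A4 a A23 b A41 l13 l24) (ha : IsUnit a)
    (r1 : t1 * t2 = a * t12 + A23 * A3 * b ^ 2 * A4 * A41) :
    t12 * t23 - t2 ^ 3 * A2 - t2 ^ 2 * b * A41 * l24 - t2 * A4 * b ^ 2 * A41 ^ 2 * l13 - A1 * A3
      * A4 ^ 2 * b ^ 3 * A41 ^ 3 = 0 := by
  refine ha.mul_right_eq_zero.1 ?_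
  linear_combination -t23 * r1 + A3 * A4 * b ^ 2 * A41 * h.tag23 + t2 * h.mix1

theorem cubic_1 (h : G24Eqs t1 t2 t3 t4 t23 t41 A1 A2 A3 A4 a A23 b A41 l13 l24) (ha : IsUnit a)
    (r1 : t1 * t2 = a * t12 + A23 * A3 * b ^ 2 * A4 * A41) :
    t12 * t41 - t1 ^ 3 * A1 - t1 ^ 2 * A23 * b * l13 - t1 * A3 * A23 ^ 2 * b ^ 2 * l24 - A2 * A3
      ^ 2 * A4 * A23 ^ 3 * b ^ 3 = 0 := by
  refine ha.mul_right_eq_zero.1 ?_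
  linear_combination -t41 * r1 + A3 * A4 * A23 * b ^ 2 * h.tag41 + t1 * h.mix2

theorem cubic_3 (h : G24Eqs t1 t2 t3 t4 t23 t41 A1 A2 A3 A4 a A23 b A41 l13 l24) (hb : IsUnit b)
    (r2 : t3 * t4 = b * t34 + A41 * A1 * a ^ 2 * A2 * A23) :
    t23 * t34 - t3 ^ 3 * A3 - t3 ^ 2 * a * A41 * l13 - t3 * A1 * a ^ 2 * A41 ^ 2 * l24 - A1 ^ 2
      * A2 * A4 * a ^ 3 * A41 ^ 3 = 0 := by
  refine hb.mul_right_eq_zero.1 ?_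
  linear_combination -t23 * r2 + A1 * A2 * a ^ 2 * A41 * h.tag23 + t3 * h.mix4

theorem cubic_4 (h : G24Eqs t1 t2 t3 t4 t23 t41 A1 A2 A3 A4 a A23 b A41 l13 l24) (hb : IsUnit b)
    (r2 : t3 * t4 = b * t34 + A41 * A1 * a ^ 2 * A2 * A23) :
    t34 * t41 - t4 ^ 3 * A4 - t4 ^ 2 * a * A23 * l24 - t4 * A2 * a ^ 2 * A23 ^ 2 * l13 - A1 * A2
      ^ 2 * A3 * a ^ 3 * A23 ^ 3 = 0 := by
  refine hb.mul_right_eq_zero.1 ?_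
  linear_combination -t41 * r2 + A1 * A2 * a ^ 2 * A23 * h.tag41 + t4 * h.mix3

theorem long_12_34 (h : G24Eqs t1 t2 t3 t4 t23 t41 A1 A2 A3 A4 a A23 b A41 l13 l24) (ha : IsUnit a)
    (hb : IsUnit b)
    (r1 : t1 * t2 = a * t12 + A23 * A3 * b ^ 2 * A4 * A41)
    (r2 : t3 * t4 = b * t34 + A41 * A1 * a ^ 2 * A2 * A23) :
    t12 * t34 - t2 * t3 * A2 * A3 * A23 ^ 2 - t1 * t3 * A23 * A41 * l13 - t2 * t4 * A23 * A41 *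
      l24 - t1 * t4 * A1 * A4 * A41 ^ 2 - A1 * A2 * A3 * A4 * a * A23 ^ 2 * b * A41 ^ 2 + a *
      A23 ^ 2 * b * A41 ^ 2 * l13 * l24 = 0 := by
  refine (ha.mul hb).mul_right_eq_zero.1 ?_
  linear_combination -(t34 * b) * r1 + -(t1 * t2 - A3 * A4 * A23 * b ^ 2 * A41) * r2 + (-A2 * A3
    * a * A23 ^ 2 * b + t1 * t4) * h.tag23 + t23 * A23 * h.tag41 + A23 * A41 * h.long

end G24Eqs

theorem forall_g2Relations_eq_zero {y : G2Var → S} (ha : IsUnit (y (.coeffE 1)))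
    (hb : IsUnit (y (.coeffE 3))) (h : ∀ f ∈ g24Relations y, f = 0)
    (h' : ∀ f ∈ redundantRelations y, f = 0) : ∀ f ∈ g2Relations y, f = 0 := by
  rw [forall_g24Relations_eq_zero] at h
  rw [forall_redundantRelations_eq_zero] at h'
  obtain ⟨r1, r2⟩ := h'
  have m4 := h.mixed_4_12 ha r1
  have m3 := h.mixed_3_12 ha r1
  have m2 := h.mixed_2_34 hb r2
  have m1 := h.mixed_1_34 hb r2
  have c1 := h.cubic_1 ha r1
  have c2 := h.cubic_2 ha r1
  have c3 := h.cubic_3 hb r2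
  have c4 := h.cubic_4 hb r2
  have hl := h.long_12_34 ha hb r1 r2
  rintro f ⟨i, j, k, l, hd, hf⟩
  rcases isDihedralPerm_cases hd with e | e | e | e | e | e | e | e <;>
  obtain ⟨rfl, rfl, rfl, rfl⟩ := e <;>
  simp only [tagRel, cubicRel, oppositeRel, mixedRel, longRel, th_12, th_21, th_23, th_32, th_34,
    th_43, th_41, th_14, co_12, co_21, co_23, co_32, co_34, co_43, co_41, co_14, lam_13, lam_31,
    lam_24, lam_42] at hf
  · rcases hf with rfl | rfl | rfl | rfl | rfl
    · linear_combination r1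
    · linear_combination c2
    · linear_combination h.mix1
    · linear_combination h.opp13
    · linear_combination hl
  · rcases hf with rfl | rfl | rfl | rfl | rfl
    · linear_combination h.tag23
    · linear_combination c3
    · linear_combination m2
    · linear_combination h.opp24
    · linear_combination h.long
  · rcases hf with rfl | rfl | rfl | rfl | rfl
    · linear_combination r2
    · linear_combination c4
    · linear_combination h.mix3
    · linear_combination h.opp13
    · linear_combination hl
  · rcases hf with rfl | rfl | rfl | rfl | rfl
    · linear_combination h.tag41
    · linear_combination c1
    · linear_combination m4
    · linear_combination h.opp24
    · linear_combination h.long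
  · rcases hf with rfl | rfl | rfl | rfl | rfl
    · linear_combination r2
    · linear_combination c3
    · linear_combination h.mix4
    · linear_combination h.opp24
    · linear_combination hl
  · rcases hf with rfl | rfl | rfl | rfl | rfl
    · linear_combination h.tag23
    · linear_combination c2
    · linear_combination m3
    · linear_combination h.opp13
    · linear_combination h.long
  · rcases hf with rfl | rfl | rfl | rfl | rfl
    · linear_combination r1
    · linear_combination c1
    · linear_combination h.mix2
    · linear_combination h.opp24
    · linear_combination hl
  · rcases hf with rfl | rfl | rfl | rfl | rfl
    · linear_combination h.tag41
    · linear_combination c4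
    · linear_combination m1
    · linear_combination h.opp13
    · linear_combination h.long

end Spans

/-! ### Polynomial identities between the formats -/

section EquationChanges

variable {S : Type*} [CommRing S]

/-- Rolling factors format when `A₂ = 0` and `A₁₂ = A₃₄ = λ₂₄ = 1`. -/
theorem g24Eqs_iff_rollingEqs {t1 t2 t3 t4 t23 t41 A1 A3 A4 A23 A41 l13 : S} :
    G24Eqs t1 t2 t3 t4 t23 t41 A1 0 A3 A4 1 A23 1 A41 l13 1 ↔
      RollingEqs t23 t3 t4 A41 (t2 + l13 * A4 * A41 + A3 * A4 * t3) (A4 * t4 + A23) t41 t1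
        A3 l13 A1 := by
  constructor
  · rintro ⟨tag23, tag41, opp13, opp24, mix1, mix4, mix2, mix3, long⟩
    constructor
    · linear_combination -tag23 + A4 * mix4
    · linear_combination l13 * opp13 + long
    · linear_combination mix1
    · linear_combination mix3
    · linear_combination opp13
    · linear_combination tag41
    · linear_combination mix4
    · linear_combination l13 * opp13 + opp24 + long
    · linear_combination -A4 * l13 * tag41 + mix2 + A3 * A4 * mix3
  · rintro ⟨m12, m13, m14, m23, m24, m34, q1, q2, q3⟩
    constructor
    · linear_combination -m12 + A4 * q1
    · linear_combination m34
    · linear_combination m24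
    · linear_combination -m13 + q2
    · linear_combination m14
    · linear_combination q1
    · linear_combination -A3 * A4 * m23 + A4 * l13 * m34 + q3
    · linear_combination m23
    · linear_combination m13 - l13 * m24

/-- Splitting the quadric of rolling factors format into linear factors. -/
theorem rollingEqs_iff_cubeEqs {m₁ m₂ m₃ m₄ n₁ n₂ n₃ n₄ a l b p q r s : S} (ha : a = p * r)
    (hl : l = p * s + q * r) (hb : b = q * s) (hd : IsUnit (p * s - q * r)) :
    RollingEqs m₁ m₂ m₃ m₄ n₁ n₂ n₃ n₄ a l b ↔
      CubeEqs m₁ (p * m₂ + q * m₄) m₃ (r * m₂ + s * m₄) n₁ (p * n₂ + q * n₄) n₃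
        (r * n₂ + s * n₄) := by
  subst ha hl hb
  constructor
  · rintro ⟨m12, m13, m14, m23, m24, m34, q1, q2, q3⟩
    constructor
    · linear_combination p * m12 + q * m14
    · linear_combination m13
    · linear_combination r * m12 + s * m14
    · linear_combination p * m23 - q * m34
    · linear_combination (p * s - q * r) * m24
    · linear_combination -r * m23 + s * m34
    · linear_combination q1
    · linear_combination q2 - q * r * m24
    · linear_combination q3
  · rintro ⟨m12, m13, m14, m23, m24, m34, q1, q2, q3⟩
    -- The second and fourth columns have undergone a linear change of determinant `ps - qr`, and
    -- undoing it requires division by that determinant.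
    have key : ∀ {x y : S}, (p * s - q * r) * (x - y) = 0 → x = y := fun hxy =>
      sub_eq_zero.1 (hd.mul_right_eq_zero.1 hxy)
    have m24' : m₂ * n₄ = m₄ * n₂ := key (by linear_combination m24)
    refine ⟨key ?_, m13, key ?_, key ?_, m24', key ?_, ?_, ?_, ?_⟩
    · linear_combination s * m12 - q * m14
    · linear_combination -r * m12 + p * m14
    · linear_combination s * m23 + q * m34
    · linear_combination r * m23 + p * m34
    · linear_combination q1
    · linear_combination q2 + q * r * m24'
    · linear_combination q3

/-- Rolling factors format attached to a root `t` of the cubic `A₂A₄z³ + z² + λ₁₃z + A₁A₃`,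
where `A₁ = tu`. -/
theorem g24Eqs_iff_rollingEqs_of_root {t1 t2 t3 t4 t23 t41 A2 A3 A4 A23 A41 t u : S}
    (hD : IsUnit (2 * A2 * A4 * t ^ 2 + t - u * A3)) :
    G24Eqs t1 t2 t3 t4 t23 t41 (t * u) A2 A3 A4 1 A23 1 A41 (-(A2 * A4 * t ^ 2 + t + u * A3)) 1 ↔
      RollingEqs t23 (t3 - u * A41) (-u * t1 + A4 * t4 + (1 + A2 * A4 * t) * A23)
        (t2 - A4 * t * A41) (A3 * t3 - A2 * t * t2 - (t + A2 * A4 * t ^ 2) * A41)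
        (t4 - A2 * t * A23) t41 (A3 * A23 - t * t1) (A3 * A4) (1 + A2 * A4 * t) (-A2 * u) := by
  constructor
  · rintro ⟨tag23, tag41, opp13, opp24, mix1, mix4, mix2, mix3, long⟩
    constructor
    · linear_combination t * A2 * tag23 + mix4
    · linear_combination (-t ^ 2 * A2 * A4 - t) * opp13 + (t * A2 * A4 + 1) * opp24 + long
    · linear_combination -A3 * tag23 - t * mix1
    · linear_combination u * tag41 + mix3
    · linear_combination -t * opp13 - opp24
    · linear_combination -t * A4 * tag41 - mix2
    · linear_combination (-t * A2 * A4 - 1) * tag23 - u * mix1 + A4 * mix4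
    · linear_combination (-t ^ 2 * A2 * A4 - t - u * A3) * opp13 - t * A2 * A4 * opp24 + long
    · linear_combination (t ^ 2 * A2 * A4 + t) * tag41 - t * A2 * mix2 + A3 * mix3
  · rintro ⟨m12, m13, m14, m23, m24, m34, q1, q2, q3⟩
    -- The unit is the derivative of the cubic at its root `t`, with `λ₁₃` eliminated by means of
    -- the root equation: the way back needs a simple root.
    have key : ∀ {x y : S}, (2 * A2 * A4 * t ^ 2 + t - u * A3) * (x - y) = 0 → x = y :=
      fun hxy => sub_eq_zero.1 (hD.mul_right_eq_zero.1 hxy)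
    refine ⟨key ?_, key ?_, key ?_, key ?_, key ?_, key ?_, key ?_, key ?_, key ?_⟩
    · linear_combination t * A4 * m12 + u * m14 - t * q1
    · linear_combination -A3 * m23 - t * A2 * m34 + q3
    · linear_combination -m13 - (2 * t * A2 * A4 + 1) * m24 + q2
    · linear_combination t * m13 + u * A3 * m24 - t * q2
    · linear_combination -A3 * A4 * m12 - (2 * t * A2 * A4 + 1) * m14 + A3 * q1
    · linear_combination (t ^ 2 * A2 * A4 + t - u * A3) * m12 - t * u * A2 * m14 + t ^ 2 * A2 * q1
    · linear_combination t * A3 * A4 * m23 - (t ^ 2 * A2 * A4 + t - u * A3) * m34 - t * A4 * q3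
    · linear_combination (2 * t ^ 2 * A2 * A4 + t) * m23 + t * u * A2 * m34 - u * q3
    · linear_combination -(t + u * A3) * m13 -
        (2 * t ^ 3 * A2 ^ 2 * A4 ^ 2 + 3 * t ^ 2 * A2 * A4 + t + u * A3 * (t * A2 * A4 + 1)) * m24 +
        (2 * t ^ 2 * A2 * A4 + 2 * t) * q2

/-- The explicit cube when all parameters are equal to one. -/
theorem G24Eqs.cubeEqs_of_eighthRoot {t1 t2 t3 t4 t23 t41 A23 A41 ε : S} (hε : ε ^ 4 = -1)
    (h : G24Eqs t1 t2 t3 t4 t23 t41 1 1 1 1 1 A23 1 A41 1 1) :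
    CubeEqs t23 (-(ε * t3 + ε ^ 3 * t2 + (ε + ε ^ 3) * A41)) (t4 + t1)
      (ε ^ 3 * t3 + ε * t2 + (ε + ε ^ 3) * A41)
      (t2 + t3) (-(ε ^ 3 * t1 + ε * t4 + (ε + ε ^ 3) * A23)) t41
      (ε * t1 + ε ^ 3 * t4 + (ε + ε ^ 3) * A23) where
  minor12 := by linear_combination (ε + ε ^ 3) * h.tag23 - ε ^ 3 * h.mix1 - ε * h.mix4
  minor13 := by linear_combination h.long
  minor14 := by linear_combination (-ε ^ 3 - ε) * h.tag23 + ε * h.mix1 + ε ^ 3 * h.mix4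
  minor23 := by linear_combination (ε ^ 3 + ε) * h.tag41 - ε ^ 3 * h.mix2 - ε * h.mix3
  minor24 := by linear_combination -2 * ε ^ 2 * h.opp13 + 2 * ε ^ 2 * h.opp24 + (-t2 * t4 * ε ^ 2
    - t2 * ε ^ 2 * A23 - t4 * ε ^ 2 * A41 + t1 * t3 * ε ^ 2 + t3 * ε ^ 2 * A23 + t1 * ε ^ 2 * A41)
    * hε
  minor34 := by linear_combination (ε + ε ^ 3) * h.tag41 - ε * h.mix2 - ε ^ 3 * h.mix3
  quad := by linear_combination h.mix1 + h.mix4 + (t3 ^ 2 + t2 * t3 * ε ^ 2 + 2 * t3 * A41 + t3 *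
    ε ^ 2 * A41 + t2 ^ 2 + 2 * t2 * A41 + 2 * A41 ^ 2 + t2 * ε ^ 2 * A41 + ε ^ 2 * A41 ^ 2) * hε
  rolled := by linear_combination (1 - ε ^ 2) * h.opp13 + (ε ^ 2 + 1) * h.opp24 + h.long + (t1 *
    t3 * ε ^ 2 + t3 * t4 + t3 * A23 + t3 * ε ^ 2 * A23 + t1 * t2 + t2 * A23 + t1 * A41 + 2 * A23 *
    A41 + t1 * ε ^ 2 * A41 + t4 * A41 + ε ^ 2 * A23 * A41) * hε
  rolled' := by linear_combination h.mix2 + h.mix3 + (t1 ^ 2 + 2 * t1 * A23 + t1 * t4 * ε ^ 2 + t4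
    ^ 2 + 2 * t4 * A23 + t4 * ε ^ 2 * A23 + 2 * A23 ^ 2 + t1 * ε ^ 2 * A23 + ε ^ 2 * A23 ^ 2) * hε

/-- The converse of `G24Eqs.cubeEqs_of_eighthRoot`: four times each relation is a combination of the
cube equations modulo `ε⁴ + 1`, which is why `4` has to be invertible. Here the cubic attached to
the format is `z³ + z² + z + 1`, with the distinct roots `-1` and `±ε²`. -/
theorem CubeEqs.g24Eqs_of_eighthRoot {t1 t2 t3 t4 t23 t41 A23 A41 ε : S} (hε : ε ^ 4 = -1)
    (h4 : IsUnit (4 : S))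
    (h : CubeEqs t23 (-(ε * t3 + ε ^ 3 * t2 + (ε + ε ^ 3) * A41)) (t4 + t1)
      (ε ^ 3 * t3 + ε * t2 + (ε + ε ^ 3) * A41)
      (t2 + t3) (-(ε ^ 3 * t1 + ε * t4 + (ε + ε ^ 3) * A23)) t41
      (ε * t1 + ε ^ 3 * t4 + (ε + ε ^ 3) * A23)) :
    G24Eqs t1 t2 t3 t4 t23 t41 1 1 1 1 1 A23 1 A41 1 1 := by
  have key : ∀ {x y : S}, 4 * (x - y) = 0 → x = y := fun hxy =>
    sub_eq_zero.1 (h4.mul_right_eq_zero.1 hxy)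
  refine ⟨key ?_, key ?_, key ?_, key ?_, key ?_, key ?_, key ?_, key ?_, key ?_⟩
  · linear_combination (-ε - ε ^ 3) * h.minor12 + (ε + ε ^ 3) * h.minor14 + 2 * h.quad + (-2 * t1
    * t23 - 4 * t23 * A23 + 4 * t2 * t3 - t1 * ε ^ 2 * t23 - 2 * t4 * t23 - 2 * ε ^ 2 * t23 * A23
    + t2 ^ 2 * ε ^ 2 - t4 * ε ^ 2 * t23 + t3 ^ 2 * ε ^ 2 - 4 * A41 ^ 2 - 2 * ε ^ 2 * A41 ^ 2) * hε
  · linear_combination (-ε - ε ^ 3) * h.minor23 + (-ε - ε ^ 3) * h.minor34 + 2 * h.rolled' + (-2 *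
    t2 * t41 - 4 * t41 * A41 + 4 * t1 * t4 - 2 * t3 * t41 - t2 * ε ^ 2 * t41 - 2 * ε ^ 2 * t41 *
    A41 + t1 ^ 2 * ε ^ 2 + t4 ^ 2 * ε ^ 2 - t3 * ε ^ 2 * t41 - 4 * A23 ^ 2 - 2 * ε ^ 2 * A23 ^ 2)
    * hε
  · linear_combination -2 * h.minor13 + (ε ^ 2 - 1) * h.minor24 + 2 * h.rolled + (2 * t1 * t3 + t2
    * t4 * ε ^ 4 + t2 * ε ^ 4 * A23 + t4 * ε ^ 4 * A41 - t1 * t3 * ε ^ 4 - t3 * ε ^ 4 * A23 - 2 *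
    t2 * t4 - 4 * t2 * A23 - 4 * t4 * A41 - t1 * ε ^ 4 * A41 - t2 * t4 * ε ^ 2 - t2 * ε ^ 2 * A23
    - t4 * ε ^ 2 * A41 - t1 * t3 * ε ^ 2 - t3 * ε ^ 2 * A23 - t1 * ε ^ 2 * A41 - 2 * t3 * t4 - 2 *
    t1 * t2 - 4 * A23 * A41 - 2 * ε ^ 2 * A23 * A41) * hε
  · linear_combination -2 * h.minor13 + (-ε ^ 2 - 1) * h.minor24 + 2 * h.rolled + (-2 * t1 * t3 -
    4 * t3 * A23 - t2 * t4 * ε ^ 4 - t2 * ε ^ 4 * A23 - 4 * t1 * A41 - t4 * ε ^ 4 * A41 + t1 * t3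
    * ε ^ 4 + t3 * ε ^ 4 * A23 + 2 * t2 * t4 + t1 * ε ^ 4 * A41 - t2 * t4 * ε ^ 2 - t2 * ε ^ 2 *
    A23 - t4 * ε ^ 2 * A41 - t1 * t3 * ε ^ 2 - t3 * ε ^ 2 * A23 - t1 * ε ^ 2 * A41 - 2 * t3 * t4 -
    2 * t1 * t2 - 4 * A23 * A41 - 2 * ε ^ 2 * A23 * A41) * hε
  · linear_combination (ε - ε ^ 3) * h.minor12 + (ε - ε ^ 3) * h.minor14 + 2 * h.quad + (2 * t1 *
    t23 - 4 * t2 ^ 2 - t1 * ε ^ 2 * t23 - 2 * t4 * t23 + t2 ^ 2 * ε ^ 2 + t4 * ε ^ 2 * t23 - t3 ^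
    2 * ε ^ 2 - 2 * t2 * t3 * ε ^ 2 - 4 * t3 * A41 - 2 * t3 * ε ^ 2 * A41 - 4 * t2 * A41 - 4 * A41
    ^ 2 - 2 * t2 * ε ^ 2 * A41 - 2 * ε ^ 2 * A41 ^ 2) * hε
  · linear_combination (-ε + ε ^ 3) * h.minor12 + (-ε + ε ^ 3) * h.minor14 + 2 * h.quad + (-2 * t1
    * t23 + t1 * ε ^ 2 * t23 + 2 * t4 * t23 - 4 * t3 ^ 2 - t2 ^ 2 * ε ^ 2 - t4 * ε ^ 2 * t23 + t3
    ^ 2 * ε ^ 2 - 2 * t2 * t3 * ε ^ 2 - 4 * t3 * A41 - 2 * t3 * ε ^ 2 * A41 - 4 * t2 * A41 - 4 *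
    A41 ^ 2 - 2 * t2 * ε ^ 2 * A41 - 2 * ε ^ 2 * A41 ^ 2) * hε
  · linear_combination (ε - ε ^ 3) * h.minor23 + (-ε + ε ^ 3) * h.minor34 + 2 * h.rolled' + (2 *
    t2 * t41 - 4 * t1 ^ 2 - 2 * t3 * t41 - t2 * ε ^ 2 * t41 + t1 ^ 2 * ε ^ 2 - t4 ^ 2 * ε ^ 2 + t3
    * ε ^ 2 * t41 - 4 * t1 * A23 - 2 * t1 * t4 * ε ^ 2 - 4 * t4 * A23 - 2 * t4 * ε ^ 2 * A23 - 4 *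
    A23 ^ 2 - 2 * t1 * ε ^ 2 * A23 - 2 * ε ^ 2 * A23 ^ 2) * hε
  · linear_combination (-ε + ε ^ 3) * h.minor23 + (ε - ε ^ 3) * h.minor34 + 2 * h.rolled' + (-2 *
    t2 * t41 + 2 * t3 * t41 + t2 * ε ^ 2 * t41 - 4 * t4 ^ 2 - t1 ^ 2 * ε ^ 2 + t4 ^ 2 * ε ^ 2 - t3
    * ε ^ 2 * t41 - 4 * t1 * A23 - 2 * t1 * t4 * ε ^ 2 - 4 * t4 * A23 - 2 * t4 * ε ^ 2 * A23 - 4 *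
    A23 ^ 2 - 2 * t1 * ε ^ 2 * A23 - 2 * ε ^ 2 * A23 ^ 2) * hε
  · linear_combination 4 * h.minor13

/-- When `θ₁` is invertible, three of the relations solve for `θ₄`, `θ₃` and `θ₂₃`, and the one for
`θ₂θ₄₁` is a single further equation. Each other relation follows after multiplication by `θ₁²`. -/
theorem g24Eqs_of_isUnit_theta1 {t1 t2 t3 t4 t23 t41 A1 A2 A3 A4 a A23 b A41 l13 l24 : S}
    (hu : IsUnit t1)
    (tag41 : t1 * t4 = t41 * A41 + A2 * A3 * a * A23 ^ 2 * b)
    (opp13 : t1 * t3 = t2 * A2 * a * A23 + a * A23 * b * A41 * l24 + t4 * A4 * b * A41)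
    (mix1 : t1 * t23 = t2 ^ 2 * A2 * a + t2 * a * b * A41 * l24 + A4 * a * b ^ 2 * A41 ^ 2 * l13 +
      t3 * A3 * A4 * b ^ 2 * A41)
    (mix2 : t2 * t41 = t1 ^ 2 * A1 * a + t1 * a * A23 * b * l13 + A3 * a * A23 ^ 2 * b ^ 2 * l24 +
      t4 * A3 * A4 * A23 * b ^ 2) :
    G24Eqs t1 t2 t3 t4 t23 t41 A1 A2 A3 A4 a A23 b A41 l13 l24 := by
  have key : ∀ {x y : S}, t1 ^ 2 * (x - y) = 0 → x = y := fun hxy =>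
    sub_eq_zero.1 ((hu.pow 2).mul_right_eq_zero.1 hxy)
  constructor
  · refine key ?_
    linear_combination t2 * A4 * b * A41 * tag41 + (t1 * t2 - A3 * A4 * A23 * b ^ 2 * A41) * opp13
      - t1 * A23 * mix1 + A4 * b * A41 ^ 2 * mix2
  · linear_combination tag41
  · linear_combination opp13
  · refine key ?_
    linear_combination t1 * t2 * tag41 - t1 * A3 * A23 * b * opp13 + t1 * A41 * mix2
  · linear_combination mix1
  · refine key ?_
    linear_combination (t1 * t23 - t3 * A3 * A4 * b ^ 2 * A41 - A4 * a * b ^ 2 * A41 ^ 2 * l13) *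
      tag41 + (-t1 * t3 * A3 * b - t1 * a * b * A41 * l13 - t2 * A2 * A3 * a * A23 * b - A3 * a *
      A23 * b ^ 2 * A41 * l24) * opp13 + (t41 * A41 + A2 * A3 * a * A23 ^ 2 * b) * mix1 + (t2 * A2
      * a * A41 + a * b * A41 ^ 2 * l24) * mix2
  · linear_combination mix2
  · refine key ?_
    linear_combination (-t1 * t4 * A4 * b - t1 * a * A23 * b * l24) * tag41 + t1 * t41 * opp13 +
      t1 * A2 * a * A23 * mix2
  · refine key ?_
    linear_combination (-t1 * t3 * A3 * A4 * b ^ 2 - t1 * t2 * a * b * l24 - t1 * A4 * a * b ^ 2 *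
      A41 * l13 + t2 * A2 * A3 * A4 * a * A23 * b ^ 2) * tag41 + (-t1 ^ 2 * a * b * l13 - A2 * A3
      ^ 2 * A4 * a * A23 ^ 2 * b ^ 3) * opp13 + t1 * t41 * mix1 + (t1 * t2 * A2 * a + A2 * A3 * A4
      * a * A23 * b ^ 2 * A41) * mix2

/-- When `θ₂₃` is invertible, the four relations solve for `A₂₃`, `θ₁`, `θ₄` and `θ₄₁`, so the locus
is a graph. Each other relation follows after multiplication by `θ₂₃²`. -/
theorem g24Eqs_of_isUnit_theta23 {t1 t2 t3 t4 t23 t41 A1 A2 A3 A4 a A23 b A41 l13 l24 : S}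
    (hu : IsUnit t23)
    (tag23 : t2 * t3 = t23 * A23 + A1 * A4 * a * b * A41 ^ 2)
    (mix1 : t1 * t23 = t2 ^ 2 * A2 * a + t2 * a * b * A41 * l24 + A4 * a * b ^ 2 * A41 ^ 2 * l13 +
      t3 * A3 * A4 * b ^ 2 * A41)
    (mix4 : t4 * t23 = t3 ^ 2 * A3 * b + t3 * a * b * A41 * l13 + A1 * a ^ 2 * b * A41 ^ 2 * l24 +
      t2 * A1 * A2 * a ^ 2 * A41)
    (long : t23 * t41 = t3 * t4 * A3 * A4 * b ^ 2 + t2 * t4 * a * b * l24 + t1 * t3 * a * b * l13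
      + t1 * t2 * A1 * A2 * a ^ 2 + A1 * A2 * A3 * A4 * a ^ 2 * A23 * b ^ 2 * A41 - a ^ 2 * A23 *
      b ^ 2 * A41 * l13 * l24) :
    G24Eqs t1 t2 t3 t4 t23 t41 A1 A2 A3 A4 a A23 b A41 l13 l24 := by
  have key : ∀ {x y : S}, t23 ^ 2 * (x - y) = 0 → x = y := fun hxy =>
    sub_eq_zero.1 ((hu.pow 2).mul_right_eq_zero.1 hxy)
  constructor
  · linear_combination tag23
  · refine key ?_
    linear_combination (t23 * A2 * A3 * a * A23 * b - a ^ 2 * b ^ 2 * A41 ^ 2 * l13 * l24 + t2 *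
      t3 * A2 * A3 * a * b) * tag23 + (t4 * t23 - t3 * a * b * A41 * l13 - t2 * A1 * A2 * a ^ 2 *
      A41) * mix1 + (t2 ^ 2 * A2 * a + A4 * a * b ^ 2 * A41 ^ 2 * l13) * mix4 - t23 * A41 * long
  · refine key ?_
    linear_combination (t2 * t23 * A2 * a + t23 * a * b * A41 * l24) * tag23 + t3 * t23 * mix1 -
      t23 * A4 * b * A41 * mix4
  · refine key ?_
    linear_combination (t3 * t23 * A3 * b + t23 * a * b * A41 * l13) * tag23 - t23 * A1 * a * A41
      * mix1 + t2 * t23 * mix4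
  · linear_combination mix1
  · linear_combination mix4
  · refine key ?_
    linear_combination (t1 * t23 * a * b * l13 + t23 * A3 * a * A23 * b ^ 2 * l24 + t4 * t23 * A3
      * A4 * b ^ 2 - t2 * A1 * A2 * A3 * A4 * a ^ 2 * b ^ 2 * A41 + t2 * a ^ 2 * b ^ 2 * A41 * l13
      * l24 + t2 * t3 * A3 * a * b ^ 2 * l24 - A1 * A3 * A4 * a ^ 2 * b ^ 3 * A41 ^ 2 * l24) *
      tag23 + (-t1 * t23 * A1 * a - t2 * A1 * a ^ 2 * b * A41 * l24 - t3 * A1 * A3 * A4 * a * b ^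
      2 * A41) * mix1 + (t2 ^ 2 * a * b * l24 + A1 * A3 * A4 ^ 2 * a * b ^ 3 * A41 ^ 2) * mix4 +
      t2 * t23 * long
  · refine key ?_
    linear_combination (t4 * t23 * a * b * l24 + t23 * A2 * a ^ 2 * A23 * b * l13 + t1 * t23 * A1
      * A2 * a ^ 2 - t3 * A1 * A2 * A3 * A4 * a ^ 2 * b ^ 2 * A41 + t3 * a ^ 2 * b ^ 2 * A41 * l13
      * l24 + t2 * t3 * A2 * a ^ 2 * b * l13 - A1 * A2 * A4 * a ^ 3 * b ^ 2 * A41 ^ 2 * l13) *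
      tag23 + (t3 ^ 2 * a * b * l13 + A1 ^ 2 * A2 * A4 * a ^ 3 * b * A41 ^ 2) * mix1 + (-t4 * t23
      * A4 * b - t3 * A4 * a * b ^ 2 * A41 * l13 - t2 * A1 * A2 * A4 * a ^ 2 * b * A41) * mix4 +
      t3 * t23 * long
  · linear_combination long

end EquationChanges

/-! ### The identities restated for ideals -/

section SpanChanges

variable {R S : Type*} [CommRing R] [CommRing S]

open G2Var

theorem forall_image_g24Relations_eq_zero (ψ : R →+* S) (x : G2Var → R) :
    (∀ f ∈ ψ '' g24Relations x, f = 0) ↔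
      G24Eqs (ψ (x (.theta 1))) (ψ (x (.theta 2))) (ψ (x (.theta 3))) (ψ (x (.theta 4)))
        (ψ (x (.thetaE 2))) (ψ (x (.thetaE 4))) (ψ (x (.coeff 1))) (ψ (x (.coeff 2)))
        (ψ (x (.coeff 3))) (ψ (x (.coeff 4))) (ψ (x (.coeffE 1))) (ψ (x (.coeffE 2)))
        (ψ (x (.coeffE 3))) (ψ (x (.coeffE 4))) (ψ (x .lam13)) (ψ (x .lam24)) := by
  rw [image_g24Relations, forall_g24Relations_eq_zero]

theorem forall_image_rollingFactorsRelations_eq_zero (ψ : R →+* S)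
    (m₁ m₂ m₃ m₄ n₁ n₂ n₃ n₄ a l b : R) :
    (∀ f ∈ ψ '' rollingFactorsRelations !![m₁, m₂, m₃, m₄; n₁, n₂, n₃, n₄] a l b, f = 0) ↔
      RollingEqs (ψ m₁) (ψ m₂) (ψ m₃) (ψ m₄) (ψ n₁) (ψ n₂) (ψ n₃) (ψ n₄) (ψ a) (ψ l) (ψ b) := by
  have : (!![m₁, m₂, m₃, m₄; n₁, n₂, n₃, n₄]).map ψ =
      !![ψ m₁, ψ m₂, ψ m₃, ψ m₄; ψ n₁, ψ n₂, ψ n₃, ψ n₄] := by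
    ext i j
    fin_cases i <;> fin_cases j <;> rfl
  rw [image_rollingFactorsRelations, this, forall_rollingFactorsRelations_eq_zero]

theorem forall_image_cubeMinors_eq_zero (ψ : R →+* S) (m₁ m₂ m₃ m₄ n₁ n₂ n₃ n₄ : R) :
    (∀ f ∈ ψ '' cubeMinors ![![![n₁, n₄], ![n₂, n₃]], ![![m₁, m₄], ![m₂, m₃]]], f = 0) ↔
      CubeEqs (ψ m₁) (ψ m₂) (ψ m₃) (ψ m₄) (ψ n₁) (ψ n₂) (ψ n₃) (ψ n₄) := by
  have : (fun p q r => ψ (![![![n₁, n₄], ![n₂, n₃]], ![![m₁, m₄], ![m₂, m₃]]] p q r)) =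
      ![![![ψ n₁, ψ n₄], ![ψ n₂, ψ n₃]], ![![ψ m₁, ψ m₄], ![ψ m₂, ψ m₃]]] := by
    ext p q r
    fin_cases p <;> fin_cases q <;> fin_cases r <;> rfl
  rw [image_cubeMinors, this, forall_cubeMinors_eq_zero]

theorem span_g2Relations_eq {x : G2Var → R} (ha : IsUnit (x (.coeffE 1)))
    (hb : IsUnit (x (.coeffE 3))) :
    Ideal.span (g2Relations x) = Ideal.span (g24Relations x ∪ redundantRelations x) := by
  apply le_antisymm
  · refine span_le_span_of_image_eq_zero fun h => ?_
    rw [Set.image_union, image_g24Relations, image_redundantRelations] at h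
    rw [image_g2Relations]
    exact forall_g2Relations_eq_zero (ha.map _) (hb.map _) (fun f hf => h f (Or.inl hf))
      (fun f hf => h f (Or.inr hf))
  · refine Ideal.span_mono ?_
    have key : ∀ i j k l, IsDihedralPerm i j k l → tagRel x i j k l ∈ g2Relations x ∧
        mixedRel x i j k l ∈ g2Relations x ∧ oppositeRel x i j k l ∈ g2Relations x ∧
        longRel x i j k l ∈ g2Relations x := fun i j k l h =>
      ⟨⟨i, j, k, l, h, by simp⟩, ⟨i, j, k, l, h, by simp⟩, ⟨i, j, k, l, h, by simp⟩,
        ⟨i, j, k, l, h, by simp⟩⟩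
    have d1 : IsDihedralPerm 1 2 3 4 := ⟨1, by decide⟩
    have d2 : IsDihedralPerm 2 3 4 1 := ⟨1, by decide⟩
    have d3 : IsDihedralPerm 3 4 1 2 := ⟨1, by decide⟩
    have d4 : IsDihedralPerm 4 1 2 3 := ⟨1, by decide⟩
    have d5 : IsDihedralPerm 4 3 2 1 := ⟨-1, by decide⟩
    have d6 : IsDihedralPerm 2 1 4 3 := ⟨-1, by decide⟩
    rintro f ((rfl | rfl | rfl | rfl | rfl | rfl | rfl | rfl | rfl) | (rfl | rfl))
    · exact (key _ _ _ _ d2).1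
    · exact (key _ _ _ _ d4).1
    · exact (key _ _ _ _ d1).2.2.1
    · exact (key _ _ _ _ d2).2.2.1
    · exact (key _ _ _ _ d1).2.1
    · exact (key _ _ _ _ d5).2.1
    · exact (key _ _ _ _ d6).2.1
    · exact (key _ _ _ _ d3).2.1
    · exact (key _ _ _ _ d2).2.2.2
    · exact (key _ _ _ _ d1).1
    · exact (key _ _ _ _ d3).1

theorem span_g24Relations_eq_span_rolling {x : G2Var → R} (h12 : x (.coeffE 1) = 1)
    (h34 : x (.coeffE 3) = 1) (h24 : x .lam24 = 1) (h2 : x (.coeff 2) = 0) :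
    Ideal.span (g24Relations x) = Ideal.span (rollingFactorsRelations
      !![x (.thetaE 2), x (.theta 3), x (.theta 4), x (.coeffE 4);
        x (.theta 2) + x .lam13 * x (.coeff 4) * x (.coeffE 4) +
          x (.coeff 3) * x (.coeff 4) * x (.theta 3),
        x (.coeff 4) * x (.theta 4) + x (.coeffE 2), x (.thetaE 4), x (.theta 1)]
      (x (.coeff 3)) (x .lam13) (x (.coeff 1))) := by
  apply le_antisymm <;> refine span_le_span_of_image_eq_zero ?_ <;>
  rw [forall_image_g24Relations_eq_zero, forall_image_rollingFactorsRelations_eq_zero, h12, h34,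
    h24, h2] <;>
  simp only [map_add, map_mul, map_one, map_zero]
  · exact g24Eqs_iff_rollingEqs.2
  · exact g24Eqs_iff_rollingEqs.1

theorem span_rolling_eq_span_cubeMinors {m₁ m₂ m₃ m₄ n₁ n₂ n₃ n₄ a l b p q r s : R}
    (ha : a = p * r) (hl : l = p * s + q * r) (hb : b = q * s) (hd : IsUnit (p * s - q * r)) :
    Ideal.span (rollingFactorsRelations !![m₁, m₂, m₃, m₄; n₁, n₂, n₃, n₄] a l b) =
      Ideal.span (cubeMinors ![![![n₁, r * n₂ + s * n₄], ![p * n₂ + q * n₄, n₃]],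
        ![![m₁, r * m₂ + s * m₄], ![p * m₂ + q * m₄, m₃]]]) := by
  subst ha hl hb
  apply le_antisymm <;> refine span_le_span_of_image_eq_zero ?_ <;>
  rw [forall_image_cubeMinors_eq_zero, forall_image_rollingFactorsRelations_eq_zero] <;>
  simp only [map_add, map_mul]
  · refine (rollingEqs_iff_cubeEqs rfl rfl rfl ?_).2
    convert hd.map (Ideal.Quotient.mk _) using 1
    simp
  · refine (rollingEqs_iff_cubeEqs rfl rfl rfl ?_).1
    convert hd.map (Ideal.Quotient.mk _) using 1
    simp

theorem span_g24Relations_eq_span_rolling_of_root {x : G2Var → R} {t u : R}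
    (h12 : x (.coeffE 1) = 1) (h34 : x (.coeffE 3) = 1) (h24 : x .lam24 = 1)
    (h1 : x (.coeff 1) = t * u)
    (h13 : x .lam13 = -(x (.coeff 2) * x (.coeff 4) * t ^ 2 + t + u * x (.coeff 3)))
    (hD : IsUnit (2 * x (.coeff 2) * x (.coeff 4) * t ^ 2 + t - u * x (.coeff 3))) :
    Ideal.span (g24Relations x) = Ideal.span (rollingFactorsRelations
      !![x (.thetaE 2), x (.theta 3) - u * x (.coeffE 4),
          -u * x (.theta 1) + x (.coeff 4) * x (.theta 4) +
            (1 + x (.coeff 2) * x (.coeff 4) * t) * x (.coeffE 2),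
          x (.theta 2) - x (.coeff 4) * t * x (.coeffE 4);
        x (.coeff 3) * x (.theta 3) - x (.coeff 2) * t * x (.theta 2) -
            (t + x (.coeff 2) * x (.coeff 4) * t ^ 2) * x (.coeffE 4),
          x (.theta 4) - x (.coeff 2) * t * x (.coeffE 2), x (.thetaE 4),
          x (.coeff 3) * x (.coeffE 2) - t * x (.theta 1)]
      (x (.coeff 3) * x (.coeff 4)) (1 + x (.coeff 2) * x (.coeff 4) * t)
      (-x (.coeff 2) * u)) := by
  apply le_antisymm <;> refine span_le_span_of_image_eq_zero ?_ <;>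
  rw [forall_image_g24Relations_eq_zero, forall_image_rollingFactorsRelations_eq_zero, h12, h34,
    h24, h1, h13] <;>
  simp only [map_add, map_mul, map_sub, map_neg, map_pow, map_one]
  · refine (g24Eqs_iff_rollingEqs_of_root ?_).2
    convert hD.map (Ideal.Quotient.mk _) using 1
    simp only [map_sub, map_add, map_mul, map_pow]
    rfl
  · refine (g24Eqs_iff_rollingEqs_of_root ?_).1
    convert hD.map (Ideal.Quotient.mk _) using 1
    simp only [map_sub, map_add, map_mul, map_pow]
    rfl

theorem span_g24Relations_eq_span_cubeMinors_of_eighthRoot {x : G2Var → R} {ε u : R}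
    (h4 : IsUnit (4 : R)) (hε : ε ^ 4 = -1) (hu : u = ε + ε ^ 3)
    (h12 : x (.coeffE 1) = 1) (h34 : x (.coeffE 3) = 1) (h13 : x .lam13 = 1) (h24 : x .lam24 = 1)
    (hA : ∀ i, x (.coeff i) = 1) :
    Ideal.span (g24Relations x) = Ideal.span (cubeMinors
      ![![![x (.theta 2) + x (.theta 3),
            ε * x (.theta 1) + ε ^ 3 * x (.theta 4) + u * x (.coeffE 2)],
          ![-(ε ^ 3 * x (.theta 1) + ε * x (.theta 4) + u * x (.coeffE 2)), x (.thetaE 4)]],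
        ![![x (.thetaE 2), ε ^ 3 * x (.theta 3) + ε * x (.theta 2) + u * x (.coeffE 4)],
          ![-(ε * x (.theta 3) + ε ^ 3 * x (.theta 2) + u * x (.coeffE 4)),
            x (.theta 4) + x (.theta 1)]]]) := by
  subst hu
  apply le_antisymm <;> refine span_le_span_of_image_eq_zero ?_ <;>
  rw [forall_image_g24Relations_eq_zero, forall_image_cubeMinors_eq_zero, h12, h34,
    h24, h13, hA, hA, hA, hA] <;>
  simp only [map_add, map_mul, map_neg, map_pow, map_one]
  · refine fun h => h.g24Eqs_of_eighthRoot ?_ ?_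
    · rw [← map_pow, hε, map_neg, map_one]
    · exact h4.map (Ideal.Quotient.mk _)
  · refine fun h => h.cubeEqs_of_eighthRoot ?_
    rw [← map_pow, hε, map_neg, map_one]

theorem forall_g24Relations_eq_zero_of_isUnit_theta1 {y : G2Var → S} (hu : IsUnit (y (.theta 1)))
    (h : ∀ f ∈ ({tagRel y 4 1 2 3, oppositeRel y 1 2 3 4,
      mixedRel y 1 2 3 4, mixedRel y 2 1 4 3} : Set S), f = 0) :
    ∀ f ∈ g24Relations y, f = 0 := by
  rw [forall_g24Relations_eq_zero]
  simp only [Set.mem_insert_iff, Set.mem_singleton_iff, forall_eq_or_imp, forall_eq, tagRel,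
    oppositeRel, mixedRel, th_23, th_41, th_14, co_12, co_21, co_23, co_32, co_34, co_43, co_41,
    lam_13, lam_24, sub_eq_zero] at h
  obtain ⟨h1, h2, h3, h4⟩ := h
  refine g24Eqs_of_isUnit_theta1 hu ?_ ?_ ?_ ?_
  · linear_combination h1
  · linear_combination h2
  · linear_combination h3
  · linear_combination h4

theorem span_g24Relations_of_isUnit_theta1 {x : G2Var → R} (hu : IsUnit (x (.theta 1))) :
    Ideal.span (g24Relations x) = Ideal.span {tagRel x 4 1 2 3, oppositeRel x 1 2 3 4,
      mixedRel x 1 2 3 4, mixedRel x 2 1 4 3} := by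
  apply le_antisymm
  · refine span_le_span_of_image_eq_zero fun h => ?_
    rw [image_g24Relations]
    refine forall_g24Relations_eq_zero_of_isUnit_theta1 (hu.map _) ?_
    simpa only [Set.image_insert_eq, Set.image_singleton, map_tagRel, map_oppositeRel,
      map_mixedRel] using h
  · refine Ideal.span_mono ?_
    rintro f (rfl | rfl | rfl | rfl) <;> simp [g24Relations]

theorem forall_g24Relations_eq_zero_of_isUnit_theta23 {y : G2Var → S} (hu : IsUnit (y (.thetaE 2)))
    (h : ∀ f ∈ ({tagRel y 2 3 4 1, mixedRel y 1 2 3 4,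
      mixedRel y 4 3 2 1, longRel y 2 3 4 1} : Set S), f = 0) :
    ∀ f ∈ g24Relations y, f = 0 := by
  rw [forall_g24Relations_eq_zero]
  simp only [Set.mem_insert_iff, Set.mem_singleton_iff, forall_eq_or_imp, forall_eq, tagRel,
    longRel, mixedRel, th_23, th_32, th_41, co_12, co_21, co_23, co_34, co_43, co_41,
    co_14, lam_13, lam_31, lam_24, lam_42, sub_eq_zero] at h
  obtain ⟨h1, h2, h3, h4⟩ := h
  refine g24Eqs_of_isUnit_theta23 hu ?_ ?_ ?_ ?_
  · linear_combination h1
  · linear_combination h2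
  · linear_combination h3
  · linear_combination h4

theorem span_g24Relations_of_isUnit_theta23 {x : G2Var → R} (hu : IsUnit (x (.thetaE 2))) :
    Ideal.span (g24Relations x) = Ideal.span {tagRel x 2 3 4 1, mixedRel x 1 2 3 4,
      mixedRel x 4 3 2 1, longRel x 2 3 4 1} := by
  apply le_antisymm
  · refine span_le_span_of_image_eq_zero fun h => ?_
    rw [image_g24Relations]
    refine forall_g24Relations_eq_zero_of_isUnit_theta23 (hu.map _) ?_
    simpa only [Set.image_insert_eq, Set.image_singleton, map_tagRel, map_longRel,
      map_mixedRel] using h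
  · refine Ideal.span_mono ?_
    rintro f (rfl | rfl | rfl | rfl) <;> simp [g24Relations]

/-- Four relations survive out of the nine, and with the two relations of `T` they are as many as
the codimension. This is where the hypothesis of not being a complete intersection will be
contradicted. -/
theorem exists_span_range_of_isUnit {x : G2Var → R}
    (hu : IsUnit (x (.theta 1)) ∨ IsUnit (x (.thetaE 2))) :
    ∃ f : Fin 6 → R, Ideal.span (g24Relations x ∪ redundantRelations x) =
      Ideal.span (Set.range f) := by
  have key : ∀ a b c d : R, Ideal.span (g24Relations x) = Ideal.span {a, b, c, d} →
      ∃ f : Fin 6 → R, Ideal.span (g24Relations x ∪ redundantRelations x) =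
        Ideal.span (Set.range f) := by
    intro a b c d h
    refine ⟨![a, b, c, d, tagRel x 1 2 3 4, tagRel x 3 4 1 2], ?_⟩
    rw [Ideal.span_union, h, ← Ideal.span_union]
    congr 1
    ext y
    simp [redundantRelations, Matrix.range_cons]
    tauto
  rcases hu with hu | hu
  · exact key _ _ _ _ (span_g24Relations_of_isUnit_theta1 hu)
  · exact key _ _ _ _ (span_g24Relations_of_isUnit_theta23 hu)

end SpanChanges

/-! ### Common zeros away from the origin, and gradients -/

section Geometry

/-- Translations identify all maximal ideals with the one at the origin, so all have the same
height. If it were smaller than `n`, then so would be the dimension of the polynomial ring. -/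
theorem height_ker_eval_zero (n : ℕ) :
    (n : ℕ∞) ≤ (RingHom.ker (eval (0 : Fin n → ℂ))).height := by
  have haeval : ∀ (q : Fin n → ℂ) f, aeval q f = eval q f := fun q f => by
    rw [← coe_aeval_eq_eval]; rfl
  by_contra! hlt
  have hle : ∀ M : Ideal (MvPolynomial (Fin n) ℂ), M.IsMaximal →
      M.height ≤ (RingHom.ker (eval (0 : Fin n → ℂ))).height := by
    intro M hM
    obtain ⟨p, rfl⟩ := isMaximal_iff_eq_vanishingIdeal_singleton.1 hM
    let τ : MvPolynomial (Fin n) ℂ ≃ₐ[ℂ] MvPolynomial (Fin n) ℂ :=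
      AlgEquiv.ofAlgHom (aeval fun s => X s + C (p s)) (aeval fun s => X s - C (p s))
        (by ext s; simp) (by ext s; simp)
    have : vanishingIdeal ℂ {p} =
        (RingHom.ker (eval (0 : Fin n → ℂ))).comap (τ : MvPolynomial (Fin n) ℂ →+* _) := by
      ext f
      rw [mem_vanishingIdeal_singleton_iff, Ideal.mem_comap, RingHom.mem_ker]
      have h : ((aeval (0 : Fin n → ℂ)).comp (τ : MvPolynomial (Fin n) ℂ →ₐ[ℂ] _)) =
          aeval p := by
        ext s; simp [τ]
      have h' := congrArg (fun g => g f) h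
      rw [AlgHom.comp_apply, haeval] at h'
      exact (Eq.congr_left h').symm
    rw [this]
    exact (RingEquiv.height_comap τ.toRingEquiv _).le
  have hne : (RingHom.ker (eval (0 : Fin n → ℂ))).height ≠ ⊤ := ne_top_of_lt hlt
  obtain ⟨m, hm⟩ := ENat.ne_top_iff_exists.1 hne
  have hdim := (ringKrullDim_le_iff_isMaximal_height_le (R := MvPolynomial (Fin n) ℂ) (m : ℕ)).2
    fun M hM => by
      have := hle M hM
      rw [← hm] at this
      exact_mod_cast this
  rw [MvPolynomial.ringKrullDim_of_isNoetherianRing, ringKrullDim_eq_zero_of_field] at hdim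
  rw [← hm] at hlt
  simp at hdim
  have h1 : n ≤ m := by exact_mod_cast hdim
  have h2 : m < n := by exact_mod_cast hlt
  omega

/-- Fewer than `n` polynomials in `n` variables without constant terms have a common zero away
from the origin. -/
theorem exists_ne_zero_common_zero {n : ℕ} (F : Finset (MvPolynomial (Fin n) ℂ))
    (hF : F.card < n) (h0 : ∀ f ∈ F, eval 0 f = 0) :
    ∃ p : Fin n → ℂ, p ≠ 0 ∧ ∀ f ∈ F, eval p f = 0 := by
  by_contra! hcon
  set m := RingHom.ker (eval (0 : Fin n → ℂ)) with hm
  have hzero : zeroLocus ℂ (Ideal.span (F : Set (MvPolynomial (Fin n) ℂ))) = {0} := by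
    ext p
    rw [zeroLocus_span]
    simp only [Set.mem_ofPred, Set.mem_singleton_iff]
    constructor
    · intro hp
      by_contra hp0
      obtain ⟨f, hf, hfp⟩ := hcon p hp0
      exact hfp (by simpa [coe_aeval_eq_eval] using hp f hf)
    · rintro rfl f hf
      simpa [coe_aeval_eq_eval] using h0 f hf
  -- If the origin is the only common zero, the Nullstellensatz identifies the radical with the
  -- maximal ideal at the origin, which is then a minimal prime over an ideal with fewer than `n`
  -- generators, against Krull's height theorem.
  have hrad := vanishingIdeal_zeroLocus_eq_radical (k := ℂ) (K := ℂ)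
    (Ideal.span (F : Set (MvPolynomial (Fin n) ℂ)))
  have hv : vanishingIdeal ℂ ({0} : Set (Fin n → ℂ)) = m := by
    ext f
    rw [mem_vanishingIdeal_singleton_iff, hm, RingHom.mem_ker, ← coe_aeval_eq_eval]
    rfl
  rw [hzero, hv] at hrad
  have hprime : m.IsPrime := RingHom.ker_isPrime _
  have hmin : m ∈ (Ideal.span (F : Set (MvPolynomial (Fin n) ℂ))).minimalPrimes := by
    refine ⟨⟨hprime, ?_⟩, ?_⟩
    · rw [hrad]; exact Ideal.le_radical
    · rintro q ⟨hq, hle⟩ _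
      rw [hrad]
      exact hq.radical_le_iff.2 hle
  have h1 := Ideal.height_le_card_of_mem_minimalPrimes_span_finset hmin
  have h2 := (height_ker_eval_zero n).trans h1
  have : n ≤ F.card := by exact_mod_cast h2
  omega

/-- The gradient of a polynomial at a point. -/
noncomputable def gradAt {n : ℕ} (p : Fin n → ℂ) (f : MvPolynomial (Fin n) ℂ) : Fin n → ℂ :=
  fun s => eval p (pderiv s f)

variable {n : ℕ} (p : Fin n → ℂ)

theorem gradAt_add (f g : MvPolynomial (Fin n) ℂ) :
    gradAt p (f + g) = gradAt p f + gradAt p g := by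
  ext s; simp [gradAt]

theorem gradAt_sub (f g : MvPolynomial (Fin n) ℂ) :
    gradAt p (f - g) = gradAt p f - gradAt p g := by
  ext s; simp [gradAt]

theorem gradAt_neg (f : MvPolynomial (Fin n) ℂ) : gradAt p (-f) = -gradAt p f := by
  ext s; simp [gradAt]

theorem gradAt_mul (f g : MvPolynomial (Fin n) ℂ) :
    gradAt p (f * g) = eval p f • gradAt p g + eval p g • gradAt p f := by
  ext s; simp [gradAt]

theorem gradAt_C (c : ℂ) : gradAt p (C c) = 0 := by
  ext s; simp [gradAt]

theorem gradAt_zero : gradAt p 0 = 0 := by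
  ext s; simp [gradAt]

theorem gradAt_one : gradAt p 1 = 0 := by
  ext s; simp [gradAt]

theorem gradAt_pow_two (f : MvPolynomial (Fin n) ℂ) :
    gradAt p (f ^ 2) = (2 * eval p f) • gradAt p f := by
  rw [pow_two, gradAt_mul, ← add_smul, two_mul]

variable {p}

/-- By the product rule, at a common zero of the generators the gradient of `a * g` is `a(p)` times
the gradient of `g`; so the Jacobian rank can be read off from generators alone. -/
theorem gradAt_mem_of_mem_span {G : Set (MvPolynomial (Fin n) ℂ)} (hG : ∀ g ∈ G, eval p g = 0)
    {W : Submodule ℂ (Fin n → ℂ)} (hW : ∀ g ∈ G, gradAt p g ∈ W) {f : MvPolynomial (Fin n) ℂ}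
    (hf : f ∈ Ideal.span G) : eval p f = 0 ∧ gradAt p f ∈ W := by
  induction hf using Submodule.span_induction with
  | mem x hx => exact ⟨hG x hx, hW x hx⟩
  | zero => simp [gradAt_zero]
  | add x y _ _ hx hy =>
    rw [gradAt_add]
    exact ⟨by simp [hx.1, hy.1], W.add_mem hx.2 hy.2⟩
  | smul a x _ hx =>
    rw [smul_eq_mul, gradAt_mul, hx.1]
    exact ⟨by simp [hx.1], by simpa using W.smul_mem _ hx.2⟩

/-- A quasismooth cone of codimension 6 cannot contain a locus cut out by at most nine equations
in affine 10-space along which the gradients of its equations span at most five dimensions. -/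
theorem IsQuasismoothCone.false_of_singularLocus {I : Ideal (MvPolynomial (Fin 10) ℂ)}
    {G : Set (MvPolynomial (Fin 10) ℂ)} (hqs : IsQuasismoothCone 6 I) (hI : I = Ideal.span G)
    {k : ℕ} (hk : k < 10) (F : Fin k → MvPolynomial (Fin 10) ℂ) (h0 : ∀ i, eval 0 (F i) = 0)
    (hF : ∀ p, (∀ i, eval p (F i) = 0) → (∀ g ∈ G, eval p g = 0) ∧
      ∃ v : Fin 5 → (Fin 10 → ℂ), ∀ g ∈ G, gradAt p g ∈ Submodule.span ℂ (Set.range v)) :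
    False := by
  classical
  obtain ⟨p, hp, hpF⟩ := exists_ne_zero_common_zero (Finset.univ.image F)
    (lt_of_le_of_lt (by simpa using Finset.card_image_le (s := Finset.univ) (f := F)) hk)
    (by simpa using h0)
  obtain ⟨hG, v, hv⟩ := hF p (by simpa using hpF)
  have key := fun f (hf : f ∈ I) => gradAt_mem_of_mem_span hG hv (hI ▸ hf)
  have hrank := hqs p hp fun f hf => (key f hf).1
  have hle : Submodule.span ℂ {g : Fin 10 → ℂ | ∃ f ∈ I, g = fun s => eval p (pderiv s f)} ≤
      Submodule.span ℂ (Set.range v) := by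
    rw [Submodule.span_le]
    rintro _ ⟨f, hf, rfl⟩
    exact (key f hf).2
  have h1 := Submodule.finrank_mono hle
  have h2 := finrank_range_le_card (R := ℂ) v
  rw [Set.finrank] at h2
  simp at h2
  omega

end Geometry

/-! ### Homogeneous polynomials for positive weights -/

section Homogeneity

theorem MvPolynomial.IsWeightedHomogeneous.aeval_of_forall {σ τ : Type*} {d : σ → ℤ} {d' : τ → ℤ}
    {f : σ → MvPolynomial τ ℂ} (hf : ∀ v, IsWeightedHomogeneous d' (f v) (d v))
    {P : MvPolynomial σ ℂ} {m : ℤ} (hP : IsWeightedHomogeneous d P m) :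
    IsWeightedHomogeneous d' (aeval f P) m := by
  rw [aeval_def, eval₂_eq]
  refine IsWeightedHomogeneous.sum _ _ _ fun e he => ?_
  have hm : ∑ i ∈ e.support, e i • d i = m := by
    rw [← hP (mem_support_iff.1 he), Finsupp.weight_apply, Finsupp.sum]
  have := IsWeightedHomogeneous.prod e.support (fun i => f i ^ e i) (fun i => e i • d i)
    (w := d') fun i _ => (hf i).pow (e i)
  rw [hm] at this
  exact this.C_mul _

variable {n : ℕ} {w : Fin n → ℕ} {f : MvPolynomial (Fin n) ℂ} {m : ℤ}

theorem eq_zero_of_weight_neg (hf : IsWeightedHomogeneous (fun s => (w s : ℤ)) f m) (hm : m < 0) :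
    f = 0 := by
  ext e
  rw [coeff_zero]
  by_contra h
  have := hf h
  rw [Finsupp.weight_apply, Finsupp.sum] at this
  have h0 : 0 ≤ ∑ i ∈ e.support, e i • (w i : ℤ) := Finset.sum_nonneg fun i _ => by positivity
  omega

theorem eval_zero_of_weight_ne_zero (hf : IsWeightedHomogeneous (fun s => (w s : ℤ)) f m)
    (hm : m ≠ 0) : eval 0 f = 0 := by
  rw [eval_zero, constantCoeff_eq]
  by_contra h
  exact hm (by simpa using (hf h).symm)

/-- Positive weights leave the empty monomial as the only one of degree zero. -/
theorem eq_C_of_weight_zero (hw : ∀ s, 0 < w s)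
    (hf : IsWeightedHomogeneous (fun s => (w s : ℤ)) f 0) :
    f = C (eval 0 f) := by
  ext e
  rw [coeff_C, eval_zero, constantCoeff_eq]
  split_ifs with h
  · rw [h]
  · by_contra hc
    have := hf hc
    rw [Finsupp.weight_apply, Finsupp.sum] at this
    obtain ⟨i, hi⟩ := Finsupp.ne_iff.1 (Ne.symm h)
    have hi' : i ∈ e.support := by simpa using hi
    have h1 : 0 < e i • (w i : ℤ) := by
      have : 0 < e i := Nat.pos_of_ne_zero (by simpa using hi)
      have := hw i
      positivity
    have h2 := Finset.single_le_sum (f := fun i => e i • (w i : ℤ))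
      (fun j _ => by positivity) hi'
    omega

end Homogeneity

/-! ### Homogeneous coordinate changes -/

section CoordinateChanges

variable {n : ℕ}

/-- `x` arises from `φ` by a homogeneous change of coordinates on the ambient space of the cluster
variety. -/
def IsCoordinateChange (ρ : G2Weight) (φ x : G2Var → MvPolynomial (Fin n) ℂ) : Prop :=
  ∃ α : MvPolynomial G2Var ℂ ≃ₐ[ℂ] MvPolynomial G2Var ℂ, IsHomogeneousCoordinateChange ρ α ∧
    ∀ v, x v = aeval φ (α (X v))

namespace IsCoordinateChange

variable {ρ : G2Weight} {φ x y : G2Var → MvPolynomial (Fin n) ℂ}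

theorem trans (h : IsCoordinateChange ρ φ x) (h' : IsCoordinateChange ρ x y) :
    IsCoordinateChange ρ φ y := by
  obtain ⟨α, hα, hx⟩ := h
  obtain ⟨β, hβ, hy⟩ := h'
  have key : ∀ P, α P = aeval (fun v => α (X v)) P := fun P => by
    have : (α : MvPolynomial G2Var ℂ →ₐ[ℂ] _) = aeval fun v => α (X v) := by ext; simp
    exact congrArg (fun g => g P) this
  refine ⟨β.trans α, fun v => ?_, fun v => ?_⟩
  · rw [AlgEquiv.trans_apply, key]
    exact (hβ v).aeval_of_forall hα
  · rw [AlgEquiv.trans_apply, hy]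
    have : aeval x = (aeval φ).comp (α : MvPolynomial G2Var ℂ →ₐ[ℂ] _) := by
      ext v; simp [hx]
    rw [this]
    rfl

open Classical in
/-- Adding to a coordinate a polynomial of the same degree in the other coordinates. -/
theorem update_add (v : G2Var) (P : MvPolynomial G2Var ℂ)
    (hP : ∀ Q, bind₁ (Function.update X v Q) P = P)
    (hh : IsWeightedHomogeneous ρ.d P (ρ.d v)) :
    IsCoordinateChange ρ φ (Function.update φ v (φ v + aeval φ P)) := by
  -- The hypothesis `hP` expresses that `P` does not involve `v`: any substitution for `v` fixes it.
  -- Hence subtracting `P` undoes adding it.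
  refine ⟨AlgEquiv.ofAlgHom (aeval (Function.update X v (X v + P)))
    (aeval (Function.update X v (X v - P))) ?_ ?_, fun u => ?_, fun u => ?_⟩
  · ext1 u
    by_cases hu : u = v
    · subst hu; simp [hP]
    · simp [hu]
  · ext1 u
    by_cases hu : u = v
    · subst hu; simp [hP]
    · simp [hu]
  · by_cases hu : u = v
    · subst hu
      simpa using (isWeightedHomogeneous_X ℂ ρ.d u).add hh
    · simpa [hu] using isWeightedHomogeneous_X ℂ ρ.d u
  · by_cases hu : u = v
    · subst hu; simp
    · simp [hu]

/-- Rescaling the coordinates. -/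
theorem scale {τ : G2Var → ℂ} (hτ : ∀ v, τ v ≠ 0) :
    IsCoordinateChange ρ φ (fun v => C (τ v) * φ v) := by
  refine ⟨AlgEquiv.ofAlgHom (aeval fun v => C (τ v) * X v) (aeval fun v => C (τ v)⁻¹ * X v) ?_ ?_,
    fun u => ?_, fun u => ?_⟩
  · ext1 u
    simp [← mul_assoc, ← C_mul, hτ u, algebraMap_eq]
  · ext1 u
    simp [← mul_assoc, ← C_mul, hτ u, algebraMap_eq]
  · simpa using (isWeightedHomogeneous_X ℂ ρ.d u).C_mul (τ u)
  · simp [algebraMap_eq]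

theorem isWeightedHomogeneous {w : Fin n → ℕ}
    (hφ : ∀ v, IsWeightedHomogeneous (fun s => (w s : ℤ)) (φ v) (ρ.d v))
    (h : IsCoordinateChange ρ φ x) (v : G2Var) :
    IsWeightedHomogeneous (fun s => (w s : ℤ)) (x v) (ρ.d v) := by
  obtain ⟨α, hα, hx⟩ := h
  rw [hx]
  exact (hα v).aeval_of_forall hφ

theorem inRollingFactorsFormat (h : IsCoordinateChange ρ φ x) {i j k l : ZMod 4}
    (hx : pullbackIdeal φ = Ideal.span (rollingFactorsRelations (g2Matrix x i j k l)
      (x (.coeff k)) (x (.lam i k)) (x (.coeff i)) ∪ redundantRelations φ)) :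
    InRollingFactorsFormat ρ φ i j k l := by
  obtain ⟨α, hα, hα'⟩ := h
  refine ⟨α, hα, fun y hy => ?_⟩
  have hyx : y = x := by
    funext v
    rw [hy v, hα' v]
  rw [hyx]
  exact hx

theorem inP1CubedFormat (h : IsCoordinateChange ρ φ x)
    (hx : pullbackIdeal φ = Ideal.span (cubeMinors (g2Cube x) ∪ redundantRelations φ)) :
    InP1CubedFormat ρ φ := by
  obtain ⟨α, hα, hα'⟩ := h
  refine ⟨α, hα, fun y hy => ?_⟩
  have hyx : y = x := by
    funext v
    rw [hy v, hα' v]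
  rw [hyx]
  exact hx

end IsCoordinateChange

theorem InRollingFactorsFormat.exists_isCoordinateChange {ρ : G2Weight}
    {φ : G2Var → MvPolynomial (Fin n) ℂ} {i j k l : ZMod 4}
    (h : InRollingFactorsFormat ρ φ i j k l) : ∃ x, IsCoordinateChange ρ φ x ∧
      pullbackIdeal φ = Ideal.span (rollingFactorsRelations (g2Matrix x i j k l)
        (x (.coeff k)) (x (.lam i k)) (x (.coeff i)) ∪ redundantRelations φ) := by
  obtain ⟨α, hα, hx⟩ := h
  exact ⟨fun v => aeval φ (α (X v)), ⟨α, hα, fun _ => rfl⟩, hx _ fun _ => rfl⟩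

theorem InP1CubedFormat.exists_isCoordinateChange {ρ : G2Weight}
    {φ : G2Var → MvPolynomial (Fin n) ℂ} (h : InP1CubedFormat ρ φ) :
    ∃ x, IsCoordinateChange ρ φ x ∧
      pullbackIdeal φ = Ideal.span (cubeMinors (g2Cube x) ∪ redundantRelations φ) := by
  obtain ⟨α, hα, hx⟩ := h
  exact ⟨fun v => aeval φ (α (X v)), ⟨α, hα, fun _ => rfl⟩, hx _ fun _ => rfl⟩

end CoordinateChanges

/-! ### Symmetries of the square -/

section Symmetries

variable {R : Type*} [CommRing R]

namespace G2Var

/-- The rotation `1 ↔ 3`, `2 ↔ 4` of the square. -/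
def rot : G2Var → G2Var
  | theta i => theta (i + 2)
  | thetaE i => thetaE (i + 2)
  | coeff i => coeff (i + 2)
  | coeffE i => coeffE (i + 2)
  | lam13 => lam13
  | lam24 => lam24

/-- The reflection `1 ↔ 2`, `3 ↔ 4` of the square. -/
def reflect : G2Var → G2Var
  | theta i => theta (3 - i)
  | thetaE i => thetaE (2 - i)
  | coeff i => coeff (3 - i)
  | coeffE i => coeffE (2 - i)
  | lam13 => lam24
  | lam24 => lam13

theorem rot_rot (v : G2Var) : v.rot.rot = v := by
  have h : ∀ i : ZMod 4, i + 2 + 2 = i := by decide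
  cases v <;> simp [rot, h]

theorem reflect_reflect (v : G2Var) : v.reflect.reflect = v := by
  cases v <;> simp [reflect]

end G2Var

open G2Var

/-- The relations are indexed by all dihedral permutations, so relabelling by a symmetry `s` of the
square maps their set into itself. Edge labels are compared only for adjacent vertices, because `th`
and `co` take arbitrary values on other pairs. -/
theorem g2Relations_comp_subset {σ : G2Var → G2Var} {s : ZMod 4 → ZMod 4}
    (hs : ∀ i j k l, IsDihedralPerm i j k l → IsDihedralPerm (s i) (s j) (s k) (s l))
    (h1 : ∀ i, σ (.theta i) = .theta (s i)) (h2 : ∀ i, σ (.coeff i) = .coeff (s i))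
    (h3 : ∀ i j, (j = i + 1 ∨ i = j + 1) → σ (.th i j) = .th (s i) (s j))
    (h4 : ∀ i j, (j = i + 1 ∨ i = j + 1) → σ (.co i j) = .co (s i) (s j))
    (h5 : ∀ i k, σ (.lam i k) = .lam (s i) (s k)) (x : G2Var → R) :
    g2Relations (fun v => x (σ v)) ⊆ g2Relations x := by
  rintro f ⟨i, j, k, l, hd, hf⟩
  refine ⟨s i, s j, s k, s l, hs _ _ _ _ hd, ?_⟩
  have hadj : (j = i + 1 ∨ i = j + 1) ∧ (k = j + 1 ∨ j = k + 1) ∧ (l = k + 1 ∨ k = l + 1) ∧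
      (i = l + 1 ∨ l = i + 1) := by
    rcases isDihedralPerm_cases hd with h | h | h | h | h | h | h | h <;>
      obtain ⟨rfl, rfl, rfl, rfl⟩ := h <;> decide
  obtain ⟨ij, jk, kl, li⟩ := hadj
  simpa only [tagRel, cubicRel, mixedRel, oppositeRel, longRel, h1, h2, h5, h3 _ _ ij, h3 _ _ jk,
    h3 _ _ kl, h3 _ _ li, h4 _ _ ij, h4 _ _ jk, h4 _ _ kl, h4 _ _ li] using hf

theorem g2Relations_rot (x : G2Var → R) : g2Relations (fun v => x v.rot) = g2Relations x := by
  have key : ∀ x : G2Var → R, g2Relations (fun v => x v.rot) ⊆ g2Relations x := by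
    refine fun x => g2Relations_comp_subset (s := fun i => i + 2) ?_ ?_ ?_ ?_ ?_ ?_ x
    · rintro i j k l ⟨e, he, rfl, rfl, rfl⟩
      exact ⟨e, he, by ring, by ring, by ring⟩
    · intro i; rfl
    · intro i; rfl
    · intro i j _
      have : j + 2 = i + 2 + 1 ↔ j = i + 1 := by grind
      simp only [th, this]
      split_ifs <;> rfl
    · intro i j _
      have : j + 2 = i + 2 + 1 ↔ j = i + 1 := by grind
      simp only [co, this]
      split_ifs <;> rfl
    · have : ∀ i : ZMod 4, (i + 2 = 1 ∨ i + 2 = 3) ↔ (i = 1 ∨ i = 3) := by decide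
      intro i k
      simp only [lam, this]
      split_ifs <;> rfl
  refine (key x).antisymm ?_
  -- For an involution the reverse inclusion is the inclusion applied to the relabelled family.
  have := key (fun v => x v.rot)
  simpa only [rot_rot] using this

theorem g2Relations_reflect (x : G2Var → R) :
    g2Relations (fun v => x v.reflect) = g2Relations x := by
  have key : ∀ x : G2Var → R, g2Relations (fun v => x v.reflect) ⊆ g2Relations x := by
    refine fun x => g2Relations_comp_subset (s := fun i => 3 - i) ?_ ?_ ?_ ?_ ?_ ?_ x
    · rintro i j k l ⟨e, he, rfl, rfl, rfl⟩
      exact ⟨-e, by rcases he with rfl | rfl <;> simp, by ring, by ring, by ring⟩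
    · intro i; rfl
    · intro i; rfl
    · have : ∀ i j : ZMod 4, (j = i + 1 ∨ i = j + 1) →
          (if j = i + 1 then 2 - i else 2 - j) =
          if 3 - j = 3 - i + 1 then 3 - i else 3 - j := by decide
      intro i j h
      have := congrArg thetaE (this i j h)
      rw [apply_ite thetaE, apply_ite thetaE] at this
      rw [th, th, apply_ite reflect]
      exact this
    · have : ∀ i j : ZMod 4, (j = i + 1 ∨ i = j + 1) →
          (if j = i + 1 then 2 - i else 2 - j) =
          if 3 - j = 3 - i + 1 then 3 - i else 3 - j := by decide
      intro i j h
      have := congrArg coeffE (this i j h)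
      rw [apply_ite coeffE, apply_ite coeffE] at this
      rw [co, co, apply_ite reflect]
      exact this
    · have : ∀ i : ZMod 4, (3 - i = 1 ∨ 3 - i = 3) ↔ ¬(i = 1 ∨ i = 3) := by decide
      intro i k
      simp only [lam, this]
      split_ifs <;> rfl
  refine (key x).antisymm ?_
  have := key (fun v => x v.reflect)
  simpa only [reflect_reflect] using this

theorem pullbackIdeal_eq_span {n : ℕ} (φ : G2Var → MvPolynomial (Fin n) ℂ) :
    pullbackIdeal φ = Ideal.span (g2Relations φ) := by
  rw [pullbackIdeal, g2Ideal, Ideal.map_span]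
  have := image_g2Relations (aeval φ : MvPolynomial G2Var ℂ →ₐ[ℂ] _).toRingHom X
  simp only [AlgHom.toRingHom_eq_coe, RingHom.coe_coe, aeval_X] at this
  exact congrArg _ this

namespace G2Weight

variable (ρ : G2Weight)

def rot : G2Weight := ⟨fun i => ρ.vertex (i + 2), fun i => ρ.edge (i + 2)⟩

def reflect : G2Weight := ⟨fun i => ρ.vertex (3 - i), fun i => ρ.edge (2 - i)⟩

theorem d_theta (i : ZMod 4) : ρ.d (.theta i) = ρ.vertex i := rfl
theorem d_thetaE (i : ZMod 4) : ρ.d (.thetaE i) = ρ.edge i := rfl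
theorem d_coeff1 : ρ.d (.coeff 1) = ρ.edge 4 - 3 * ρ.vertex 1 + ρ.edge 1 := rfl
theorem d_coeff2 : ρ.d (.coeff 2) = ρ.edge 1 - 3 * ρ.vertex 2 + ρ.edge 2 := rfl
theorem d_coeff3 : ρ.d (.coeff 3) = ρ.edge 2 - 3 * ρ.vertex 3 + ρ.edge 3 := rfl
theorem d_coeff4 : ρ.d (.coeff 4) = ρ.edge 3 - 3 * ρ.vertex 4 + ρ.edge 4 := rfl
theorem d_coeffE1 : ρ.d (.coeffE 1) = ρ.vertex 1 - ρ.edge 1 + ρ.vertex 2 := rfl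
theorem d_coeffE2 : ρ.d (.coeffE 2) = ρ.vertex 2 - ρ.edge 2 + ρ.vertex 3 := rfl
theorem d_coeffE3 : ρ.d (.coeffE 3) = ρ.vertex 3 - ρ.edge 3 + ρ.vertex 4 := rfl
theorem d_coeffE4 : ρ.d (.coeffE 4) = ρ.vertex 4 - ρ.edge 4 + ρ.vertex 1 := rfl
theorem d_lam13 : ρ.d .lam13 = -2 * ρ.vertex 1 + ρ.edge 1 - ρ.vertex 2 + ρ.edge 2
      - 2 * ρ.vertex 3 + ρ.edge 3 - ρ.vertex 4 + ρ.edge 4 := rfl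
theorem d_lam24 : ρ.d .lam24 = -2 * ρ.vertex 2 + ρ.edge 2 - ρ.vertex 3 + ρ.edge 3
      - 2 * ρ.vertex 4 + ρ.edge 4 - ρ.vertex 1 + ρ.edge 1 := rfl

theorem d_rot (v : G2Var) : ρ.rot.d v = ρ.d v.rot := by
  cases v with
  | theta i => rfl
  | thetaE i => rfl
  | coeff i =>
    simp only [d, rot, G2Var.rot]
    rw [show i + 2 - 1 = i - 1 + 2 by ring]
  | coeffE i =>
    simp only [d, rot, G2Var.rot]
    rw [show i + 2 + 1 = i + 1 + 2 by ring]
  | lam13 =>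
    simp only [d, rot, G2Var.rot, show (1 + 2 : ZMod 4) = 3 from rfl,
      show (2 + 2 : ZMod 4) = 4 from rfl, show (3 + 2 : ZMod 4) = 1 from rfl,
      show (4 + 2 : ZMod 4) = 2 from rfl]
    ring
  | lam24 =>
    simp only [d, rot, G2Var.rot, show (1 + 2 : ZMod 4) = 3 from rfl,
      show (2 + 2 : ZMod 4) = 4 from rfl, show (3 + 2 : ZMod 4) = 1 from rfl,
      show (4 + 2 : ZMod 4) = 2 from rfl]
    ring

theorem d_reflect (v : G2Var) : ρ.reflect.d v = ρ.d v.reflect := by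
  cases v with
  | theta i => rfl
  | thetaE i => rfl
  | coeff i =>
    simp only [d, reflect, G2Var.reflect]
    rw [show 2 - (i - 1) = 3 - i by ring, show 3 - i - 1 = 2 - i by ring]
    ring
  | coeffE i =>
    simp only [d, reflect, G2Var.reflect]
    rw [show 3 - (i + 1) = 2 - i by ring, show 2 - i + 1 = 3 - i by ring]
    ring
  | lam13 =>
    simp only [d, reflect, G2Var.reflect, show (3 - 1 : ZMod 4) = 2 from rfl,
      show (3 - 2 : ZMod 4) = 1 from rfl, show (3 - 3 : ZMod 4) = 4 from rfl,
      show (3 - 4 : ZMod 4) = 3 from rfl, show (2 - 1 : ZMod 4) = 1 from rfl,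
      show (2 - 2 : ZMod 4) = 4 from rfl, show (2 - 3 : ZMod 4) = 3 from rfl,
      show (2 - 4 : ZMod 4) = 2 from rfl]
    ring
  | lam24 =>
    simp only [d, reflect, G2Var.reflect, show (3 - 1 : ZMod 4) = 2 from rfl,
      show (3 - 2 : ZMod 4) = 1 from rfl, show (3 - 3 : ZMod 4) = 4 from rfl,
      show (3 - 4 : ZMod 4) = 3 from rfl, show (2 - 1 : ZMod 4) = 1 from rfl,
      show (2 - 2 : ZMod 4) = 4 from rfl, show (2 - 3 : ZMod 4) = 3 from rfl,
      show (2 - 4 : ZMod 4) = 2 from rfl]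
    ring

end G2Weight

variable {n : ℕ} {ρ : G2Weight} {φ x : G2Var → MvPolynomial (Fin n) ℂ}

theorem pullbackIdeal_rot : pullbackIdeal (fun v => φ v.rot) = pullbackIdeal φ := by
  rw [pullbackIdeal_eq_span, pullbackIdeal_eq_span, g2Relations_rot]

theorem pullbackIdeal_reflect : pullbackIdeal (fun v => φ v.reflect) = pullbackIdeal φ := by
  rw [pullbackIdeal_eq_span, pullbackIdeal_eq_span, g2Relations_reflect]

theorem redundantRelations_rot (x : G2Var → R) :
    redundantRelations (fun v => x v.rot) = redundantRelations x := by
  have h1 : tagRel (fun v => x v.rot) 1 2 3 4 = tagRel x 3 4 1 2 := rfl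
  have h2 : tagRel (fun v => x v.rot) 3 4 1 2 = tagRel x 1 2 3 4 := rfl
  rw [redundantRelations, redundantRelations, h1, h2, Set.pair_comm]

theorem redundantRelations_reflect (x : G2Var → R) :
    redundantRelations (fun v => x v.reflect) = redundantRelations x := by
  have h1 : tagRel (fun v => x v.reflect) 1 2 3 4 = tagRel x 1 2 3 4 := by
    have : tagRel (fun v => x v.reflect) 1 2 3 4 = tagRel x 2 1 4 3 := rfl
    rw [this]
    simp only [tagRel, th_12, th_21, co_12, co_21, co_23, co_34, co_43, co_41, co_14, co_32]
    ring
  have h2 : tagRel (fun v => x v.reflect) 3 4 1 2 = tagRel x 3 4 1 2 := by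
    have : tagRel (fun v => x v.reflect) 3 4 1 2 = tagRel x 4 3 2 1 := rfl
    rw [this]
    simp only [tagRel, th_34, th_43, co_12, co_21, co_23, co_34, co_43, co_41, co_14, co_32]
    ring
  rw [redundantRelations, redundantRelations, h1, h2]

/-- Conjugation by the permutation of the variables turns a coordinate change for the relabelled
data into one for the original data, so each case needs to be treated only up to symmetry. -/
theorem IsCoordinateChange.of_involutive {σ : G2Var → G2Var} (hσ : ∀ v, σ (σ v) = v)
    {ρ' : G2Weight} (hd : ∀ v, ρ'.d v = ρ.d (σ v))
    (h : IsCoordinateChange ρ' (fun v => φ (σ v)) x) :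
    IsCoordinateChange ρ φ (fun v => x (σ v)) := by
  obtain ⟨α, hα, hx⟩ := h
  let e : G2Var ≃ G2Var := ⟨σ, σ, hσ, hσ⟩
  refine ⟨((renameEquiv ℂ e).trans α).trans (renameEquiv ℂ e), fun v => ?_, fun v => ?_⟩
  · have h1 : IsWeightedHomogeneous ρ'.d (α (X (σ v))) (ρ'.d (σ v)) := hα (σ v)
    rw [hd, hσ] at h1
    have h2 := h1.aeval_of_forall (d' := ρ.d) (f := fun u => X (σ u)) fun u => by
      rw [hd]; exact isWeightedHomogeneous_X _ _ _
    have h3 : rename e (α (rename e (X v))) = aeval (fun u => X (σ u)) (α (X (σ v))) := by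
      rw [rename_X, rename_eq_aeval]
      rfl
    rw [← h3] at h2
    exact h2
  · have h3 : aeval φ (rename e (α (rename e (X v)))) = x (σ v) := by
      rw [rename_X, aeval_rename, hx]
      rfl
    exact h3.symm

end Symmetries

/-! ### The formats under symmetries and the torus -/

section Formats

theorem g2Matrix_1234 {R : Type*} (x : G2Var → R) : g2Matrix x 1 2 3 4 =
    !![x (.thetaE 2), x (.theta 3), x (.theta 4), x (.coeffE 4);
      x (.theta 2), x (.coeffE 2), x (.thetaE 4), x (.theta 1)] := rfl

theorem g2Cube_eq {R : Type*} (x : G2Var → R) : g2Cube x =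
    ![![![x (.theta 2), x (.theta 1)], ![x (.coeffE 2), x (.thetaE 4)]],
      ![![x (.thetaE 2), x (.coeffE 4)], ![x (.theta 3), x (.theta 4)]]] := rfl

variable {R S : Type*} [CommRing R] [CommRing S] {n : ℕ} {ρ : G2Weight}
  {φ x : G2Var → MvPolynomial (Fin n) ℂ}

open G2Var

theorem InRollingFactorsFormat.of_reflect
    (h : InRollingFactorsFormat ρ.reflect (fun v => φ v.reflect) 1 2 3 4) :
    InRollingFactorsFormat ρ φ 2 1 4 3 := by
  obtain ⟨x, hx, hI⟩ := h.exists_isCoordinateChange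
  refine (hx.of_involutive reflect_reflect ρ.d_reflect).inRollingFactorsFormat ?_
  rw [pullbackIdeal_reflect, redundantRelations_reflect] at hI
  exact hI

/-- Exchanging the rows, columns one and three, and columns two and four preserves the system and
swaps the outer coefficients of the quadratic form. This is the effect of the rotation on
`g2Matrix`. -/
theorem span_rolling_swap {m₁ m₂ m₃ m₄ n₁ n₂ n₃ n₄ a l b : R} :
    Ideal.span (rollingFactorsRelations !![m₁, m₂, m₃, m₄; n₁, n₂, n₃, n₄] a l b) =
      Ideal.span (rollingFactorsRelations !![n₃, n₄, n₁, n₂; m₃, m₄, m₁, m₂] b l a) := by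
  have key : ∀ m₁ m₂ m₃ m₄ n₁ n₂ n₃ n₄ a l b : R,
      Ideal.span (rollingFactorsRelations !![m₁, m₂, m₃, m₄; n₁, n₂, n₃, n₄] a l b) ≤
      Ideal.span (rollingFactorsRelations !![n₃, n₄, n₁, n₂; m₃, m₄, m₁, m₂] b l a) := by
    intro m₁ m₂ m₃ m₄ n₁ n₂ n₃ n₄ a l b
    refine span_le_span_of_image_eq_zero ?_
    rw [forall_image_rollingFactorsRelations_eq_zero, forall_image_rollingFactorsRelations_eq_zero]
    rintro ⟨m12, m13, m14, m23, m24, m34, q1, q2, q3⟩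
    refine ⟨?_, ?_, ?_, ?_, ?_, ?_, ?_, ?_, ?_⟩ <;> grind
  exact le_antisymm (key _ _ _ _ _ _ _ _ _ _ _) (key _ _ _ _ _ _ _ _ _ _ _)

theorem InRollingFactorsFormat.of_rot
    (h : InRollingFactorsFormat ρ.rot (fun v => φ v.rot) 1 2 3 4) :
    InRollingFactorsFormat ρ φ 1 2 3 4 := by
  obtain ⟨x, hx, hI⟩ := h.exists_isCoordinateChange
  refine (hx.of_involutive rot_rot ρ.d_rot).inRollingFactorsFormat ?_
  rw [pullbackIdeal_rot, redundantRelations_rot] at hI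
  rw [hI, Ideal.span_union, Ideal.span_union, g2Matrix_1234, span_rolling_swap]
  rfl

/-- The antipodal map `c p q r ↦ c (1-p) (1-q) (1-r)` of the cube, which is the effect of the
rotation on `g2Cube`. -/
theorem span_cubeMinors_flip {m₁ m₂ m₃ m₄ n₁ n₂ n₃ n₄ : R} :
    Ideal.span (cubeMinors ![![![n₁, n₄], ![n₂, n₃]], ![![m₁, m₄], ![m₂, m₃]]]) =
      Ideal.span (cubeMinors ![![![m₃, m₂], ![m₄, m₁]], ![![n₃, n₂], ![n₄, n₁]]]) := by
  have key : ∀ m₁ m₂ m₃ m₄ n₁ n₂ n₃ n₄ : R,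
      Ideal.span (cubeMinors ![![![n₁, n₄], ![n₂, n₃]], ![![m₁, m₄], ![m₂, m₃]]]) ≤
      Ideal.span (cubeMinors ![![![m₃, m₂], ![m₄, m₁]], ![![n₃, n₂], ![n₄, n₁]]]) := by
    intro m₁ m₂ m₃ m₄ n₁ n₂ n₃ n₄
    refine span_le_span_of_image_eq_zero ?_
    rw [forall_image_cubeMinors_eq_zero, forall_image_cubeMinors_eq_zero]
    rintro ⟨m12, m13, m14, m23, m24, m34, q1, q2, q3⟩
    refine ⟨?_, ?_, ?_, ?_, ?_, ?_, ?_, ?_, ?_⟩ <;> grind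
  exact le_antisymm (key _ _ _ _ _ _ _ _) (key _ _ _ _ _ _ _ _)

/-- The symmetry `c p q r ↦ c q p (1-r)` of the cube, which is the effect of the reflection on
`g2Cube`. -/
theorem span_cubeMinors_transpose {m₁ m₂ m₃ m₄ n₁ n₂ n₃ n₄ : R} :
    Ideal.span (cubeMinors ![![![n₁, n₄], ![n₂, n₃]], ![![m₁, m₄], ![m₂, m₃]]]) =
      Ideal.span (cubeMinors ![![![n₄, n₁], ![m₄, m₁]], ![![n₃, n₂], ![m₃, m₂]]]) := by
  apply le_antisymm <;> refine span_le_span_of_image_eq_zero ?_ <;>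
  rw [forall_image_cubeMinors_eq_zero, forall_image_cubeMinors_eq_zero] <;>
  rintro ⟨m12, m13, m14, m23, m24, m34, q1, q2, q3⟩ <;>
  refine ⟨?_, ?_, ?_, ?_, ?_, ?_, ?_, ?_, ?_⟩ <;> grind

theorem InP1CubedFormat.of_rot (h : InP1CubedFormat ρ.rot (fun v => φ v.rot)) :
    InP1CubedFormat ρ φ := by
  obtain ⟨x, hx, hI⟩ := h.exists_isCoordinateChange
  refine (hx.of_involutive rot_rot ρ.d_rot).inP1CubedFormat ?_
  rw [pullbackIdeal_rot, redundantRelations_rot] at hI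
  rw [hI, Ideal.span_union, Ideal.span_union, g2Cube_eq, span_cubeMinors_flip]
  rfl

theorem InP1CubedFormat.of_reflect (h : InP1CubedFormat ρ.reflect (fun v => φ v.reflect)) :
    InP1CubedFormat ρ φ := by
  obtain ⟨x, hx, hI⟩ := h.exists_isCoordinateChange
  refine (hx.of_involutive reflect_reflect ρ.d_reflect).inP1CubedFormat ?_
  rw [pullbackIdeal_reflect, redundantRelations_reflect] at hI
  rw [hI, Ideal.span_union, Ideal.span_union, g2Cube_eq, span_cubeMinors_transpose]
  rfl

/-- Invariance of the equations under the torus acting on the cluster variety. -/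
theorem g24Eqs_torus_iff {t1 t2 t3 t4 t23 t41 A1 A2 A3 A4 A12 A23 A34 A41 l13 l24 a b c : S}
    (ha : IsUnit a) (hb : IsUnit b) (hc : IsUnit c) :
    G24Eqs t1 t2 t3 t4 (a * b * c * t23) t41 A1 (b * c * A2) (a * c * A3) A4 (a * A12) A23
      (b * A34) A41 (c * l13) (c * l24) ↔
    G24Eqs t1 t2 t3 t4 t23 t41 (a * A1) A2 A3 (b * A4) A12 (a * b * c * A23) A34 A41 l13 l24 := by
  have hu : IsUnit (a * b * c) := (ha.mul hb).mul hc
  have key : ∀ {x y : S}, (a * b * c) * (x - y) = 0 → x = y := fun hxy =>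
    sub_eq_zero.1 (hu.mul_right_eq_zero.1 hxy)
  constructor
  · rintro ⟨tag23, tag41, opp13, opp24, mix1, mix4, mix2, mix3, long⟩
    refine ⟨?_, ?_, ?_, ?_, key ?_, key ?_, ?_, ?_, key ?_⟩
    · linear_combination tag23
    · linear_combination tag41
    · linear_combination opp13
    · linear_combination opp24
    · linear_combination mix1
    · linear_combination mix4
    · linear_combination mix2
    · linear_combination mix3
    · linear_combination long
  · rintro ⟨tag23, tag41, opp13, opp24, mix1, mix4, mix2, mix3, long⟩
    constructor
    · linear_combination tag23
    · linear_combination tag41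
    · linear_combination opp13
    · linear_combination opp24
    · linear_combination (a * b * c) * mix1
    · linear_combination (a * b * c) * mix4
    · linear_combination mix2
    · linear_combination mix3
    · linear_combination (a * b * c) * long

end Formats

/-! ### Normalising the constants; rolling factors when `A₂ = 0` -/

section Normalisation

variable {R S : Type*} [CommRing R] [CommRing S] {n : ℕ} {ρ : G2Weight}
  {φ x : G2Var → MvPolynomial (Fin n) ℂ}

open G2Var

/-- Each scaling is stated on the side on which no inverse of `a`, `b`, `c` occurs, so that
`g24Eqs_torus_iff` applies after plain rewriting. -/
theorem span_g24Relations_torus {x y : G2Var → R} {a b c : R} (ha : IsUnit a) (hb : IsUnit b)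
    (hc : IsUnit c) (ht : ∀ i, y (.theta i) = x (.theta i))
    (h23 : x (.thetaE 2) = a * b * c * y (.thetaE 2)) (h41 : y (.thetaE 4) = x (.thetaE 4))
    (h1 : y (.coeff 1) = a * x (.coeff 1)) (h2 : x (.coeff 2) = b * c * y (.coeff 2))
    (h3 : x (.coeff 3) = a * c * y (.coeff 3)) (h4 : y (.coeff 4) = b * x (.coeff 4))
    (h12' : x (.coeffE 1) = a * y (.coeffE 1)) (h23' : y (.coeffE 2) = a * b * c * x (.coeffE 2))
    (h34' : x (.coeffE 3) = b * y (.coeffE 3)) (h41' : y (.coeffE 4) = x (.coeffE 4))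
    (h13 : x .lam13 = c * y .lam13) (h24 : x .lam24 = c * y .lam24) :
    Ideal.span (g24Relations x) = Ideal.span (g24Relations y) := by
  apply le_antisymm <;> refine span_le_span_of_image_eq_zero ?_ <;>
  rw [forall_image_g24Relations_eq_zero, forall_image_g24Relations_eq_zero, ht, ht, ht, ht, h23,
    h41, h1, h2, h3, h4, h12', h23', h34', h41', h13, h24] <;>
  simp only [map_mul]
  · exact (g24Eqs_torus_iff (ha.map _) (hb.map _) (hc.map _)).2
  · exact (g24Eqs_torus_iff (ha.map _) (hb.map _) (hc.map _)).1

/-- A form of `update_add` with an explicit conditional in place of `Function.update`, so that for a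
concrete `P` the independence of `v` is decided by `simp`. -/
theorem IsCoordinateChange.exists_update_add (v : G2Var) (P : MvPolynomial G2Var ℂ)
    (hP : ∀ Q : MvPolynomial G2Var ℂ,
      bind₁ (fun u => open Classical in if u = v then Q else X u) P = P)
    (hh : IsWeightedHomogeneous ρ.d P (ρ.d v)) :
    ∃ y, IsCoordinateChange ρ φ y ∧ y v = φ v + aeval φ P ∧ ∀ u, u ≠ v → y u = φ u := by
  classical
  refine ⟨_, IsCoordinateChange.update_add v P (fun Q => ?_) hh, by simp, fun u hu => by simp [hu]⟩
  convert hP Q using 2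
  ext u
  by_cases h : u = v
  · subst h; simp
  · simp [h]

/-- The torus acting on the cluster variety normalises `A₁₂`, `A₃₄` and `λ₂₄` to one. -/
theorem exists_normalised {a b c : ℂ} (ha : a ≠ 0) (hb : b ≠ 0) (hc : c ≠ 0)
    (h12 : φ (.coeffE 1) = C a) (h34 : φ (.coeffE 3) = C b) (h24 : φ .lam24 = C c) :
    ∃ y, IsCoordinateChange ρ φ y ∧ Ideal.span (g24Relations φ) = Ideal.span (g24Relations y) ∧
      y (.coeffE 1) = 1 ∧ y (.coeffE 3) = 1 ∧ y .lam24 = 1 ∧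
      ∀ v, ∃ k : ℂ, k ≠ 0 ∧ y v = C k * φ v := by
  -- This is the element of the torus with parameter `a` at `ρ₁₂`, `b` at `ρ₃₄`, `(abc)⁻¹` at `ρ₂₃`
  -- and one elsewhere, except that `θ₁₂` and `θ₃₄` are left unscaled: the nine relations do not
  -- involve them, and `T` stays in the original coordinates.
  let τ : G2Var → ℂ := fun v => match v with
    | .theta _ => 1
    | .thetaE i => if i = 2 then (a * b * c)⁻¹ else 1
    | .coeff i => if i = 1 then a else if i = 2 then (b * c)⁻¹ else
        if i = 3 then (a * c)⁻¹ else b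
    | .coeffE i => if i = 1 then a⁻¹ else if i = 2 then a * b * c else
        if i = 3 then b⁻¹ else 1
    | .lam13 => c⁻¹
    | .lam24 => c⁻¹
  have hτ : ∀ v, τ v ≠ 0 := by
    rintro (i | i | i | i | _ | _) <;> simp only [τ] <;> (try split_ifs) <;> simp [ha, hb, hc]
  have hC : ∀ {d e : ℂ} {p : MvPolynomial (Fin n) ℂ}, d * e = 1 → p = C d * (C e * p) := by
    intro d e p h
    rw [← mul_assoc, ← C_mul, h, C_1, one_mul]
  have hC' : ∀ {d e : ℂ}, d ≠ 0 → e = d⁻¹ → (C e * C d : MvPolynomial (Fin n) ℂ) = 1 := by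
    rintro d _ h rfl
    rw [← C_mul, inv_mul_cancel₀ h, C_1]
  have hu : ∀ {d : ℂ}, d ≠ 0 → IsUnit (C d : MvPolynomial (Fin n) ℂ) := fun h =>
    (IsUnit.mk0 _ h).map C
  have h31 : (3 : ZMod 4) ≠ 1 := by decide
  have h32 : (3 : ZMod 4) ≠ 2 := by decide
  have h21 : (2 : ZMod 4) ≠ 1 := by decide
  have h41 : (4 : ZMod 4) ≠ 1 := by decide
  have h42 : (4 : ZMod 4) ≠ 2 := by decide
  have h43 : (4 : ZMod 4) ≠ 3 := by decide
  have v23 : τ (.thetaE 2) = (a * b * c)⁻¹ := by simp only [τ, if_pos]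
  have v41 : τ (.thetaE 4) = 1 := by simp only [τ, if_neg h42]
  have v1 : τ (.coeff 1) = a := by simp only [τ, if_pos]
  have v2 : τ (.coeff 2) = (b * c)⁻¹ := by simp only [τ, if_neg h21, if_pos]
  have v3 : τ (.coeff 3) = (a * c)⁻¹ := by simp only [τ, if_neg h31, if_neg h32, if_pos]
  have v4 : τ (.coeff 4) = b := by simp only [τ, if_neg h41, if_neg h42, if_neg h43]
  have w1 : τ (.coeffE 1) = a⁻¹ := by simp only [τ, if_pos]
  have w2 : τ (.coeffE 2) = a * b * c := by simp only [τ, if_neg h21, if_pos]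
  have w3 : τ (.coeffE 3) = b⁻¹ := by simp only [τ, if_neg h31, if_neg h32, if_pos]
  have w4 : τ (.coeffE 4) = 1 := by simp only [τ, if_neg h41, if_neg h42, if_neg h43]
  have v13 : τ .lam13 = c⁻¹ := rfl
  have v24 : τ .lam24 = c⁻¹ := rfl
  have vt : ∀ i, τ (.theta i) = 1 := fun _ => rfl
  clear_value τ
  refine ⟨fun v => C (τ v) * φ v, IsCoordinateChange.scale hτ,
    span_g24Relations_torus (hu ha) (hu hb) (hu hc) (fun i => ?_) ?_ ?_ ?_ ?_ ?_ ?_ ?_ ?_ ?_ ?_ ?_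
      ?_, ?_, ?_, ?_, fun v => ⟨τ v, hτ v, rfl⟩⟩
  · rw [vt, C_1, one_mul]
  · rw [v23, ← C_mul, ← C_mul]
    exact hC (by field_simp)
  · rw [v41, C_1, one_mul]
  · rw [v1]
  · rw [v2, ← C_mul]
    exact hC (by field_simp)
  · rw [v3, ← C_mul]
    exact hC (by field_simp)
  · rw [v4]
  · rw [w1]
    exact hC (by field_simp)
  · rw [w2, C_mul, C_mul]
  · rw [w3]
    exact hC (by field_simp)
  · rw [w4, C_1, one_mul]
  · rw [v13]
    exact hC (by field_simp)
  · rw [v24]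
    exact hC (by field_simp)
  · exact (congrArg _ h12).trans (hC' ha w1)
  · exact (congrArg _ h34).trans (hC' hb w3)
  · exact (congrArg _ h24).trans (hC' hc v24)

/-- Coordinates bringing a pullback with `A₂ = 0` to rolling factors format. -/
theorem exists_rolling_of_coeff2_eq_zero (hρ : ρ.IsG24) (hd : ρ.d .lam24 = 0) {a b c : ℂ}
    (ha : a ≠ 0) (hb : b ≠ 0) (hc : c ≠ 0) (h12 : φ (.coeffE 1) = C a)
    (h34 : φ (.coeffE 3) = C b) (h24 : φ .lam24 = C c) (h2 : φ (.coeff 2) = 0) :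
    ∃ x, IsCoordinateChange ρ φ x ∧ pullbackIdeal φ = Ideal.span
      (rollingFactorsRelations (g2Matrix x 1 2 3 4) (x (.coeff 3)) (x .lam13) (x (.coeff 1)) ∪
        redundantRelations φ) ∧
      ∀ v, v = .coeff 1 ∨ v = .coeff 3 ∨ v = .lam13 → ∃ k : ℂ, k ≠ 0 ∧ x v = C k * φ v := by
  obtain ⟨y, hy, hspan, y12, y34, y24, hτ⟩ := exists_normalised (ρ := ρ) ha hb hc h12 h34 h24
  have y2 : y (.coeff 2) = 0 := by
    obtain ⟨k, -, hk⟩ := hτ (.coeff 2)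
    rw [hk, h2, mul_zero]
  have e1 : ρ.d (.coeffE 1) = 0 := hρ.d_12
  have e3 : ρ.d (.coeffE 3) = 0 := hρ.d_34
  rw [ρ.d_coeffE1] at e1
  rw [ρ.d_coeffE3] at e3
  rw [ρ.d_lam24] at hd
  have hX := fun v => isWeightedHomogeneous_X ℂ ρ.d v
  -- The corrections to `θ₂` and then `A₂₃` are those of `g24Eqs_iff_rollingEqs`. They have the
  -- right degrees because `A₁₂`, `A₃₄` and `λ₂₄` have degree zero, and neither correction involves
  -- `θ₂` or `A₂₃`, so the order does not matter.
  obtain ⟨z, hz, hz2, hz'⟩ := IsCoordinateChange.exists_update_add (ρ := ρ) (φ := y) (.theta 2)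
    (X .lam13 * X (.coeff 4) * X (.coeffE 4) + X (.coeff 3) * X (.coeff 4) * X (.theta 3))
    (fun Q => by simp [show (3 : ZMod 4) ≠ 2 by decide]) (by
      refine IsWeightedHomogeneous.add ?_ ?_
      · convert ((hX .lam13).mul (hX (.coeff 4))).mul (hX (.coeffE 4)) using 1
        rw [ρ.d_theta, ρ.d_lam13, ρ.d_coeff4, ρ.d_coeffE4]
        linarith
      · convert ((hX (.coeff 3)).mul (hX (.coeff 4))).mul (hX (.theta 3)) using 1
        rw [ρ.d_theta, ρ.d_coeff3, ρ.d_coeff4, ρ.d_theta]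
        linarith)
  obtain ⟨x, hx, hx2, hx'⟩ := IsCoordinateChange.exists_update_add (ρ := ρ) (φ := z) (.coeffE 2)
    (X (.coeff 4) * X (.theta 4)) (fun Q => by simp) (by
      convert (hX (.coeff 4)).mul (hX (.theta 4)) using 1
      rw [ρ.d_theta, ρ.d_coeff4, ρ.d_coeffE2]
      linarith)
  have key : ∀ v, v ≠ .theta 2 → v ≠ .coeffE 2 → x v = y v := fun v h h' => by
    rw [hx' v h', hz' v h]
  have n32 : (3 : ZMod 4) ≠ 2 := by decide
  have n42 : (4 : ZMod 4) ≠ 2 := by decide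
  have n12 : (1 : ZMod 4) ≠ 2 := by decide
  refine ⟨x, hy.trans (hz.trans hx), ?_, ?_⟩
  · rw [pullbackIdeal_eq_span, span_g2Relations_eq, Ideal.span_union, hspan,
      span_g24Relations_eq_span_rolling y12 y34 y24 y2, ← Ideal.span_union, g2Matrix_1234,
      key (.thetaE 2), key (.theta 3), key (.theta 4), key (.coeffE 4), key (.thetaE 4),
      key (.theta 1), key (.coeff 3), key .lam13, key (.coeff 1), hx2, hx' (.theta 2), hz2,
      hz' (.coeffE 2)]
    · simp only [map_add, map_mul, aeval_X]
      rw [hz' (.coeff 4), hz' (.theta 4), add_assoc, add_comm (y (.coeff 4) * y (.theta 4))]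
      all_goals simp [n42]
    all_goals simp [n32, n42, n12, h12, h34, ha, hb]
  · rintro v (rfl | rfl | rfl)
    all_goals
      rw [key _ (by simp) (by simp)]
      exact hτ _

end Normalisation

/-- Quasismooth pullbacks of codimension 6 in `G₂⁽⁴⁾` format that are not complete intersections. -/
structure IsQuasismoothG24 (ρ : G2Weight) (w : Fin 10 → ℕ) (φ : G2Var → MvPolynomial (Fin 10) ℂ) :
    Prop where
  isRegularPullback : IsRegularPullback ρ w φ
  isQuasismoothCone : IsQuasismoothCone 6 (pullbackIdeal φ)
  not_isCompleteIntersection : ¬ IsCompleteIntersection 6 (pullbackIdeal φ)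
  isG24 : ρ.IsG24

/-! ### Degree constraints from quasismoothness; strict and rolling factors formats -/

section Degrees

open G2Var

variable {ρ : G2Weight} {w : Fin 10 → ℕ} {φ : G2Var → MvPolynomial (Fin 10) ℂ}

theorem IsRegularPullback.of_involutive {σ : G2Var → G2Var} {ρ' : G2Weight}
    (hd : ∀ v, ρ'.d v = ρ.d (σ v)) (hI : pullbackIdeal (fun v => φ (σ v)) = pullbackIdeal φ)
    (h : IsRegularPullback ρ w φ) : IsRegularPullback ρ' w (fun v => φ (σ v)) where
  weight_pos := h.weight_pos
  homogeneous v := by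
    rw [hd]
    exact h.homogeneous (σ v)
  ne_zero v hv := h.ne_zero (σ v) (by rwa [← hd])
  codim := by
    rw [hI]
    exact h.codim

namespace IsQuasismoothG24

theorem rot (h : IsQuasismoothG24 ρ w φ) : IsQuasismoothG24 ρ.rot w (fun v => φ v.rot) where
  isRegularPullback := h.isRegularPullback.of_involutive ρ.d_rot pullbackIdeal_rot
  isQuasismoothCone := by
    rw [pullbackIdeal_rot]
    exact h.isQuasismoothCone
  not_isCompleteIntersection := by
    rw [pullbackIdeal_rot]
    exact h.not_isCompleteIntersection
  isG24 := by
    constructor <;> rw [ρ.d_rot]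
    exacts [h.isG24.d_34, h.isG24.d_12, h.isG24.d_41, h.isG24.d_23]

theorem reflect (h : IsQuasismoothG24 ρ w φ) :
    IsQuasismoothG24 ρ.reflect w (fun v => φ v.reflect) where
  isRegularPullback := h.isRegularPullback.of_involutive ρ.d_reflect pullbackIdeal_reflect
  isQuasismoothCone := by
    rw [pullbackIdeal_reflect]
    exact h.isQuasismoothCone
  not_isCompleteIntersection := by
    rw [pullbackIdeal_reflect]
    exact h.not_isCompleteIntersection
  isG24 := by
    constructor <;> rw [ρ.d_reflect]
    exacts [h.isG24.d_12, h.isG24.d_34, h.isG24.d_41, h.isG24.d_23]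

theorem exists_eq_C (h : IsQuasismoothG24 ρ w φ) {v : G2Var} (hv : ρ.d v = 0) :
    ∃ c : ℂ, c ≠ 0 ∧ φ v = C c := by
  have hw := h.isRegularPullback.homogeneous v
  rw [hv] at hw
  have hC := eq_C_of_weight_zero h.isRegularPullback.weight_pos hw
  refine ⟨_, fun h0 => h.isRegularPullback.ne_zero v hv ?_, hC⟩
  rw [hC, h0, C_0]

theorem isUnit (h : IsQuasismoothG24 ρ w φ) {v : G2Var} (hv : ρ.d v = 0) : IsUnit (φ v) := by
  obtain ⟨c, hc, h'⟩ := h.exists_eq_C hv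
  rw [h']
  exact (IsUnit.mk0 _ hc).map C

theorem eq_zero (h : IsQuasismoothG24 ρ w φ) {v : G2Var} (hv : ρ.d v < 0) : φ v = 0 :=
  eq_zero_of_weight_neg (h.isRegularPullback.homogeneous v) hv

theorem eval_zero (h : IsQuasismoothG24 ρ w φ) {v : G2Var} (hv : ρ.d v ≠ 0) :
    eval 0 (φ v) = 0 :=
  eval_zero_of_weight_ne_zero (h.isRegularPullback.homogeneous v) hv

theorem pullbackIdeal_eq (h : IsQuasismoothG24 ρ w φ) :
    pullbackIdeal φ = Ideal.span (g24Relations φ ∪ redundantRelations φ) := by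
  rw [pullbackIdeal_eq_span, span_g2Relations_eq (h.isUnit h.isG24.d_12) (h.isUnit h.isG24.d_34)]

/-- In degree zero `θ₁` would be a nonzero constant, and the pullback would be a complete
intersection. -/
theorem vertex_one_ne_zero (h : IsQuasismoothG24 ρ w φ) : ρ.vertex 1 ≠ 0 := fun h0 => by
  obtain ⟨f, hf⟩ := exists_span_range_of_isUnit (Or.inl (h.isUnit (v := .theta 1) h0))
  exact h.not_isCompleteIntersection ⟨f, h.pullbackIdeal_eq.trans hf⟩

theorem edge_two_ne_zero (h : IsQuasismoothG24 ρ w φ) : ρ.edge 2 ≠ 0 := fun h0 => by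
  obtain ⟨f, hf⟩ := exists_span_range_of_isUnit (Or.inr (h.isUnit (v := .thetaE 2) h0))
  exact h.not_isCompleteIntersection ⟨f, h.pullbackIdeal_eq.trans hf⟩

theorem vertex_two_ne_zero (h : IsQuasismoothG24 ρ w φ) : ρ.vertex 2 ≠ 0 :=
  h.reflect.vertex_one_ne_zero

theorem vertex_three_ne_zero (h : IsQuasismoothG24 ρ w φ) : ρ.vertex 3 ≠ 0 :=
  h.rot.vertex_one_ne_zero

theorem vertex_four_ne_zero (h : IsQuasismoothG24 ρ w φ) : ρ.vertex 4 ≠ 0 :=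
  h.rot.vertex_two_ne_zero

theorem edge_four_ne_zero (h : IsQuasismoothG24 ρ w φ) : ρ.edge 4 ≠ 0 :=
  h.rot.edge_two_ne_zero

/-- If `θ₁₂` were a nonzero constant, the tag relation for `θ₁θ₂` would be homogeneous of degree
zero. Its value at the origin is `-A₁₂θ₁₂ ≠ 0`, so it would be a unit and the ideal would be the
whole ring. -/
theorem edge_one_ne_zero (h : IsQuasismoothG24 ρ w φ) : ρ.edge 1 ≠ 0 := fun h0 => by
  have hom := h.isRegularPullback.homogeneous
  have h12 : ρ.d (.coeffE 1) = 0 := h.isG24.d_12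
  have h34 : ρ.d (.coeffE 3) = 0 := h.isG24.d_34
  have hf : IsWeightedHomogeneous (fun s => (w s : ℤ)) (tagRel φ 1 2 3 4) 0 := by
    rw [ρ.d_coeffE1] at h12
    rw [ρ.d_coeffE3] at h34
    have key : ∀ {f m}, IsWeightedHomogeneous (fun s => (w s : ℤ)) f m → m = 0 →
        IsWeightedHomogeneous (R := ℂ) (fun s => (w s : ℤ)) f 0 := fun hf hm => hm ▸ hf
    refine (key ((hom (.theta 1)).mul (hom (.theta 2))) ?_).sub ((key ((hom (.coeffE 1)).mul
      (hom (.thetaE 1))) ?_).add (key (((((hom (.coeffE 2)).mul (hom (.coeff 3))).mul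
        ((hom (.coeffE 3)).pow 2)).mul (hom (.coeff 4))).mul (hom (.coeffE 4))) ?_))
    · rw [ρ.d_theta, ρ.d_theta]
      linarith
    · rw [ρ.d_coeffE1, ρ.d_thetaE]
      linarith
    · rw [ρ.d_coeffE2, ρ.d_coeff3, ρ.d_coeffE3, ρ.d_coeff4, ρ.d_coeffE4]
      simp only [nsmul_eq_mul, Nat.cast_ofNat]
      linarith
  obtain ⟨a, ha, ha'⟩ := h.exists_eq_C (v := .coeffE 1) h.isG24.d_12
  obtain ⟨c, hc, hc'⟩ := h.exists_eq_C (v := .thetaE 1) h0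
  have h1 := h.eval_zero (v := .theta 1) h.vertex_one_ne_zero
  have h41 := h.eval_zero (v := .coeffE 4) h.isG24.d_41.ne'
  have heq := eq_C_of_weight_zero h.isRegularPullback.weight_pos hf
  have he : eval 0 (tagRel φ 1 2 3 4) = -(a * c) := by
    simp only [tagRel, th_12, co_12, co_41, map_sub, map_add, map_mul, h1, h41, ha', hc', eval_C]
    ring
  rw [he] at heq
  have hu : IsUnit (tagRel φ 1 2 3 4) := by
    rw [heq]
    exact (IsUnit.mk0 _ (neg_ne_zero.2 (mul_ne_zero ha hc))).map C
  -- The unit ideal counts as a complete intersection: it is generated by six copies of `1`.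
  refine h.not_isCompleteIntersection ⟨fun _ => 1, ?_⟩
  rw [h.pullbackIdeal_eq, Ideal.eq_top_of_isUnit_mem _ (Ideal.subset_span (show
    tagRel φ 1 2 3 4 ∈ g24Relations φ ∪ redundantRelations φ from Or.inr (Or.inl rfl))) hu,
    Set.range_const, Ideal.span_singleton_one]

theorem edge_three_ne_zero (h : IsQuasismoothG24 ρ w φ) : ρ.edge 3 ≠ 0 :=
  h.rot.edge_one_ne_zero

/-- Otherwise nine homogeneous functions of nonzero degree cut out a locus with points other than
the origin. With `A₁ = 0`, all relations vanish there, and of the nine only those for `θ₄θ₁`, `θ₁θ₃`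
and `θ₁θ₂₃` can have nonzero gradient; together with `T` the Jacobian rank is at most five. -/
theorem d_lam13_eq_zero_of_coeff1 (h : IsQuasismoothG24 ρ w φ) (h1 : φ (.coeff 1) = 0) :
    ρ.d .lam13 = 0 := by
  by_contra hd
  refine h.isQuasismoothCone.false_of_singularLocus h.pullbackIdeal_eq (by norm_num)
    ![φ (.theta 2), φ (.theta 3), φ (.theta 4), φ (.thetaE 2), φ (.thetaE 4), φ (.coeffE 2),
      φ (.thetaE 1), φ (.thetaE 3), φ .lam13] ?_ ?_
  · simp only [Fin.forall_fin_succ, Matrix.cons_val_zero, Matrix.cons_val_succ, IsEmpty.forall_iff,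
      and_true]
    exact ⟨h.eval_zero h.vertex_two_ne_zero, h.eval_zero h.vertex_three_ne_zero,
      h.eval_zero h.vertex_four_ne_zero, h.eval_zero h.edge_two_ne_zero,
      h.eval_zero h.edge_four_ne_zero, h.eval_zero h.isG24.d_23.ne',
      h.eval_zero h.edge_one_ne_zero, h.eval_zero h.edge_three_ne_zero, h.eval_zero hd⟩
  · intro p hp
    simp only [Fin.forall_fin_succ, Matrix.cons_val_zero, Matrix.cons_val_succ, IsEmpty.forall_iff,
      and_true] at hp
    obtain ⟨t2, t3, t4, t23, t41, A23, t12, t34, l13⟩ := hp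
    refine ⟨?_, ![gradAt p (tagRel φ 4 1 2 3), gradAt p (oppositeRel φ 1 2 3 4),
      gradAt p (mixedRel φ 1 2 3 4), gradAt p (tagRel φ 1 2 3 4), gradAt p (tagRel φ 3 4 1 2)], ?_⟩
    · rintro g ((rfl | rfl | rfl | rfl | rfl | rfl | rfl | rfl | rfl) | (rfl | rfl)) <;>
      simp [tagRel, oppositeRel, mixedRel, longRel, th_12, th_34, th_23, th_32, th_41, th_14, co_12,
        co_21, co_23, co_32, co_34, co_43, co_41, co_14, lam_13, lam_31, lam_24, lam_42, h1, t2, t3,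
        t4, t23, t41, A23, t12, t34, l13]
    · have mem : ∀ i, _ := fun i => Submodule.subset_span (R := ℂ) (Set.mem_range_self
        (f := ![gradAt p (tagRel φ 4 1 2 3), gradAt p (oppositeRel φ 1 2 3 4),
        gradAt p (mixedRel φ 1 2 3 4), gradAt p (tagRel φ 1 2 3 4), gradAt p (tagRel φ 3 4 1 2)]) i)
      have zero : ∀ {f}, gradAt p f = 0 → gradAt p f ∈ Submodule.span ℂ (Set.range
          ![gradAt p (tagRel φ 4 1 2 3), gradAt p (oppositeRel φ 1 2 3 4),
          gradAt p (mixedRel φ 1 2 3 4), gradAt p (tagRel φ 1 2 3 4),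
          gradAt p (tagRel φ 3 4 1 2)]) := fun hf => by
        rw [hf]
        exact Submodule.zero_mem _
      rintro g ((rfl | rfl | rfl | rfl | rfl | rfl | rfl | rfl | rfl) | (rfl | rfl))
      · refine zero ?_
        simp [tagRel, gradAt_sub, gradAt_mul, th_23, co_23, co_34, co_41, co_12, h1, t2, t3, t23,
          A23]
      · exact mem 0
      · exact mem 1
      · refine zero ?_
        simp [oppositeRel, gradAt_sub, gradAt_add, gradAt_mul, co_23, co_34, co_41, co_12,
          lam_31, h1, t2, t3, t4, A23, l13]
      · exact mem 2
      · refine zero ?_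
        simp [mixedRel, gradAt_sub, gradAt_add, gradAt_mul, gradAt_pow_two, co_43, co_21,
          co_14, th_32, lam_31, lam_42, h1, t3, t4, t23, l13]
      · refine zero ?_
        simp [mixedRel, gradAt_sub, gradAt_add, gradAt_mul, gradAt_pow_two, co_32, co_43, co_21,
          th_14, lam_13, lam_24, h1, t2, t4, t41, A23, l13]
      · refine zero ?_
        simp [mixedRel, gradAt_sub, gradAt_add, gradAt_mul, gradAt_pow_two, co_23, co_34, co_12,
          th_41, lam_31, lam_42, h1, t3, t4, t41, A23, l13]
      · refine zero ?_
        simp [longRel, gradAt_sub, gradAt_neg, gradAt_add, gradAt_mul, gradAt_pow_two, co_23, co_34,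
          co_12, co_41, th_41, th_23, lam_31, lam_24, h1, t2, t3, t4, t23, t41, A23, l13]
      · exact mem 3
      · exact mem 4

theorem d_lam13_eq_zero_of_coeff3 (h : IsQuasismoothG24 ρ w φ) (h3 : φ (.coeff 3) = 0) :
    ρ.d .lam13 = 0 := by
  rw [← h.rot.d_lam13_eq_zero_of_coeff1 h3, ρ.d_rot]
  rfl

theorem d_lam24_eq_zero_of_coeff2 (h : IsQuasismoothG24 ρ w φ) (h2 : φ (.coeff 2) = 0) :
    ρ.d .lam24 = 0 := by
  rw [← h.reflect.d_lam13_eq_zero_of_coeff1 h2, ρ.d_reflect]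
  rfl

theorem d_lam24_eq_zero_of_coeff4 (h : IsQuasismoothG24 ρ w φ) (h4 : φ (.coeff 4) = 0) :
    ρ.d .lam24 = 0 := by
  rw [← h.reflect.d_lam13_eq_zero_of_coeff3 h4, ρ.d_reflect]
  rfl

/-- A linear identity in the weights, valid because `A₁₂` and `A₃₄` have degree zero. -/
theorem d_coeff1_add_d_coeff3 (h : IsQuasismoothG24 ρ w φ) :
    ρ.d (.coeff 1) + ρ.d (.coeff 3) = 2 * ρ.d .lam13 - ρ.d .lam24 := by
  have h12 : ρ.d (.coeffE 1) = 0 := h.isG24.d_12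
  have h34 : ρ.d (.coeffE 3) = 0 := h.isG24.d_34
  rw [ρ.d_coeffE1] at h12
  rw [ρ.d_coeffE3] at h34
  rw [ρ.d_coeff1, ρ.d_coeff3, ρ.d_lam13, ρ.d_lam24]
  linarith

theorem d_coeff2_add_d_coeff4 (h : IsQuasismoothG24 ρ w φ) :
    ρ.d (.coeff 2) + ρ.d (.coeff 4) = 2 * ρ.d .lam24 - ρ.d .lam13 := by
  have h12 : ρ.d (.coeffE 1) = 0 := h.isG24.d_12
  have h34 : ρ.d (.coeffE 3) = 0 := h.isG24.d_34
  rw [ρ.d_coeffE1] at h12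
  rw [ρ.d_coeffE3] at h34
  rw [ρ.d_coeff2, ρ.d_coeff4, ρ.d_lam13, ρ.d_lam24]
  linarith

theorem d_coeff_odd_nonneg (h : IsQuasismoothG24 ρ w φ) (hd : ρ.d .lam13 ≠ 0) :
    0 ≤ ρ.d (.coeff 1) ∧ 0 ≤ ρ.d (.coeff 3) := by
  constructor <;> by_contra! hlt
  · exact hd (h.d_lam13_eq_zero_of_coeff1 (h.eq_zero hlt))
  · exact hd (h.d_lam13_eq_zero_of_coeff3 (h.eq_zero hlt))

theorem d_coeff_even_nonneg (h : IsQuasismoothG24 ρ w φ) (hd : ρ.d .lam24 ≠ 0) :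
    0 ≤ ρ.d (.coeff 2) ∧ 0 ≤ ρ.d (.coeff 4) := by
  constructor <;> by_contra! hlt
  · exact hd (h.d_lam24_eq_zero_of_coeff2 (h.eq_zero hlt))
  · exact hd (h.d_lam24_eq_zero_of_coeff4 (h.eq_zero hlt))

/-- A parameter of nonzero degree makes the coefficients of its diagonal nonnegative. If both are
nonzero, `2d(λ₁₃) ≥ d(λ₂₄)` and `2d(λ₂₄) ≥ d(λ₁₃)`, which excludes negative values. -/
theorem d_lam_nonneg (h : IsQuasismoothG24 ρ w φ) : 0 ≤ ρ.d .lam13 ∧ 0 ≤ ρ.d .lam24 := by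
  have h1 := h.d_coeff1_add_d_coeff3
  have h2 := h.d_coeff2_add_d_coeff4
  by_cases h13 : ρ.d .lam13 = 0 <;> by_cases h24 : ρ.d .lam24 = 0
  · omega
  · have := h.d_coeff_even_nonneg h24
    omega
  · have := h.d_coeff_odd_nonneg h13
    omega
  · have := h.d_coeff_even_nonneg h24
    have := h.d_coeff_odd_nonneg h13
    omega

theorem d_coeff_nonneg (h : IsQuasismoothG24 ρ w φ) (h13 : ρ.d .lam13 ≠ 0) (h24 : ρ.d .lam24 ≠ 0)
    (i : ZMod 4) : 0 ≤ ρ.d (.coeff i) := by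
  obtain ⟨h1, h3⟩ := h.d_coeff_odd_nonneg h13
  obtain ⟨h2, h4⟩ := h.d_coeff_even_nonneg h24
  rcases ZMod.eq_one_or_two_or_three_or_four i with rfl | rfl | rfl | rfl <;> assumption

theorem inStrictG24Format (h : IsQuasismoothG24 ρ w φ) (h13 : 0 < ρ.d .lam13)
    (h24 : 0 < ρ.d .lam24) : InStrictG24Format ρ φ :=
  ⟨h.isG24, h13, h24, h.d_coeff_nonneg h13.ne' h24.ne', h.pullbackIdeal_eq⟩

theorem inRollingFactorsFormat_of_coeff2 (h : IsQuasismoothG24 ρ w φ) (h24 : ρ.d .lam24 = 0)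
    (h2 : φ (.coeff 2) = 0) : InRollingFactorsFormat ρ φ 1 2 3 4 := by
  obtain ⟨a, ha, ha'⟩ := h.exists_eq_C h.isG24.d_12
  obtain ⟨b, hb, hb'⟩ := h.exists_eq_C h.isG24.d_34
  obtain ⟨c, hc, hc'⟩ := h.exists_eq_C h24
  obtain ⟨x, hx, hI, -⟩ := exists_rolling_of_coeff2_eq_zero h.isG24 h24 ha hb hc ha' hb' hc' h2
  exact hx.inRollingFactorsFormat hI

theorem inRollingFactorsFormat (h : IsQuasismoothG24 ρ w φ) (h13 : 0 < ρ.d .lam13)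
    (h24 : ρ.d .lam24 = 0) : InRollingFactorsFormat ρ φ 1 2 3 4 := by
  -- The sum of the degrees of `A₂` and `A₄` is `-d(λ₁₃) < 0`, so one of them is negative; the
  -- rotation exchanges the two cases.
  have h2 := h.d_coeff2_add_d_coeff4
  by_cases hA2 : ρ.d (.coeff 2) < 0
  · exact h.inRollingFactorsFormat_of_coeff2 h24 (h.eq_zero hA2)
  · have hA4 : ρ.d (.coeff 4) < 0 := by omega
    exact InRollingFactorsFormat.of_rot
      (h.rot.inRollingFactorsFormat_of_coeff2 ((ρ.d_rot _).trans h24) (h.eq_zero hA4))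

theorem inRollingFactorsFormat_reflect (h : IsQuasismoothG24 ρ w φ) (h13 : ρ.d .lam13 = 0)
    (h24 : 0 < ρ.d .lam24) : InRollingFactorsFormat ρ φ 2 1 4 3 :=
  InRollingFactorsFormat.of_reflect (h.reflect.inRollingFactorsFormat
    (by rw [ρ.d_reflect]; exact h24) (by rw [ρ.d_reflect]; exact h13))

end IsQuasismoothG24

end Degrees

/-! ### Singular pullbacks with a degenerate form or cubic -/

section Singularities

open G2Var

variable {I : Ideal (MvPolynomial (Fin 10) ℂ)} {f f' : MvPolynomial (Fin 10) ℂ}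

/-- A pullback in rolling factors format whose quadratic form with constant coefficients is a square
is singular. -/
theorem IsQuasismoothCone.false_of_rolling_square (hqs : IsQuasismoothCone 6 I)
    {M : Matrix (Fin 2) (Fin 4) (MvPolynomial (Fin 10) ℂ)} {c g h : ℂ}
    (hI : I = Ideal.span (rollingFactorsRelations M (C (c * g ^ 2)) (C (2 * c * g * h))
      (C (c * h ^ 2)) ∪ {f, f'}))
    (h0 : ∀ i j, eval 0 (M i j) = 0) (hf : eval 0 f = 0) (hf' : eval 0 f' = 0)
    (hgh : g ≠ 0 ∨ h ≠ 0) : False := by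
  refine hqs.false_of_singularLocus hI (by norm_num)
    ![M 0 0, M 0 2, C g * M 0 1 + C h * M 0 3, M 1 0, M 1 2, C g * M 1 1 + C h * M 1 3, f, f'] ?_ ?_
  · simp only [Fin.forall_fin_succ, Matrix.cons_val_zero, Matrix.cons_val_succ, IsEmpty.forall_iff,
      map_add, map_mul, h0, hf, hf', mul_zero, add_zero, and_self]
  intro p hp
  simp only [Fin.forall_fin_succ, Matrix.cons_val_zero, Matrix.cons_val_succ, IsEmpty.forall_iff,
    and_true, map_add, map_mul, eval_C] at hp
  obtain ⟨h00, h02, hm, h10, h12, hn, hfp, hfp'⟩ := hp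
  have key : ∀ a b : ℂ, g * a + h * b = 0 → ∃ μ, a = h * μ ∧ b = -g * μ := by
    intro a b hab
    rcases hgh with hg | hh
    · exact ⟨-b / g, by field_simp; linear_combination hab, by field_simp⟩
    · exact ⟨a / h, by field_simp, by field_simp; linear_combination hab⟩
  obtain ⟨μ, h01, h03⟩ := key _ _ hm
  obtain ⟨ν, h11, h13⟩ := key _ _ hn
  -- On the chosen locus both rows of the matrix are multiples of `(0, h, 0, -g)`, which spans the
  -- kernel of `gX + hY` in columns two and four.
  let κ : Fin 4 → ℂ := ![0, h, 0, -g]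
  have hm' : ∀ s, eval p (M 0 s) = κ s * μ := by
    intro s
    fin_cases s <;> simp [κ, h00, h01, h02, h03]
  have hn' : ∀ s, eval p (M 1 s) = κ s * ν := by
    intro s
    fin_cases s <;> simp [κ, h10, h11, h12, h13]
  let v : Fin 4 → Fin 10 → ℂ := fun s => μ • gradAt p (M 1 s) - ν • gradAt p (M 0 s)
  have hv : ∀ s t, gradAt p (M 0 s * M 1 t - M 0 t * M 1 s) = κ s • v t - κ t • v s := by
    intro s t
    rw [gradAt_sub, gradAt_mul, gradAt_mul, hm', hm', hn', hn']
    module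
  -- The minors contribute only `κ s • v t - κ t • v s`, of which at most three are independent. The
  -- two quadrics on a single row are singular here, and the middle one is, to first order, a
  -- multiple of the minor of columns two and four.
  let V : Fin 5 → Fin 10 → ℂ := ![v 0, v 2, g • v 1 + h • v 3, gradAt p f, gradAt p f']
  have mem : ∀ i, V i ∈ Submodule.span ℂ (Set.range V) := fun i =>
    Submodule.subset_span (Set.mem_range_self i)
  have m0 : v 0 ∈ Submodule.span ℂ (Set.range V) := mem 0
  have m2 : v 2 ∈ Submodule.span ℂ (Set.range V) := mem 1
  have m13 : g • v 1 + h • v 3 ∈ Submodule.span ℂ (Set.range V) := mem 2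
  have m13' : -(g • v 1) - h • v 3 ∈ Submodule.span ℂ (Set.range V) := by
    convert Submodule.neg_mem _ m13 using 1
    module
  refine ⟨?_, V, ?_⟩
  · rintro _ ((⟨s, t, rfl⟩ | (rfl | rfl | rfl)) | (rfl | rfl))
    · simp only [map_sub, map_mul, hm', hn']
      ring
    · simp only [map_sub, map_add, map_mul, map_pow, eval_C, h00, h01, h02, h03]
      ring
    · simp only [map_sub, map_add, map_mul, eval_C, h00, h01, h11, h03, h12, h13]
      ring
    · simp only [map_sub, map_add, map_mul, map_pow, eval_C, h10, h11, h12, h13]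
      ring
    · exact hfp
    · exact hfp'
  · rintro _ ((⟨s, t, rfl⟩ | (rfl | rfl | rfl)) | (rfl | rfl))
    · rw [hv]
      have smul := fun (k : ℂ) {u : Fin 10 → ℂ} => Submodule.smul_mem
        (Submodule.span ℂ (Set.range V)) (x := u) k
      fin_cases s <;> fin_cases t <;> simp [κ, smul, m0, m2]
      · rw [add_comm]; exact m13
      · exact m13'
    · convert Submodule.zero_mem _ using 1
      simp only [gradAt_sub, gradAt_add, gradAt_mul, gradAt_pow_two, gradAt_C, map_mul, map_pow,
        eval_C, h00, h01, h02, h03]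
      module
    · convert Submodule.smul_mem _ (c * g * h) m13 using 1
      simp only [gradAt_sub, gradAt_add, gradAt_mul, gradAt_pow_two, gradAt_C, map_mul, map_pow,
        eval_C, h00, h01, h11, h12, h13, h03, v]
      module
    · convert Submodule.zero_mem _ using 1
      simp only [gradAt_sub, gradAt_add, gradAt_mul, gradAt_pow_two, gradAt_C, map_mul, map_pow,
        eval_C, h10, h11, h12, h13]
      module
    · exact mem 3
    · exact mem 4

/-- A pullback with all coefficients constant whose characteristic cubic has a double root is
singular. -/
theorem IsQuasismoothCone.false_of_double_root (hqs : IsQuasismoothCone 6 I)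
    {y : G2Var → MvPolynomial (Fin 10) ℂ} {s t u a₂ a₄ : ℂ}
    (hI : I = Ideal.span (g24Relations y ∪ {f, f'}))
    (h0 : ∀ i, eval 0 (y (.theta i)) = 0) (h23 : eval 0 (y (.thetaE 2)) = 0)
    (h41 : eval 0 (y (.thetaE 4)) = 0) (hA23 : eval 0 (y (.coeffE 2)) = 0)
    (hA41 : eval 0 (y (.coeffE 4)) = 0) (hf : eval 0 f = 0) (hf' : eval 0 f' = 0)
    (h12 : y (.coeffE 1) = 1) (h34 : y (.coeffE 3) = 1) (h24 : y .lam24 = 1)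
    (h13 : y .lam13 = C (-t * (3 * a₂ * a₄ * t + 2))) (h1 : y (.coeff 1) = C (t * u))
    (h2 : y (.coeff 2) = C a₂) (h3 : y (.coeff 3) = C (t * s)) (h4 : y (.coeff 4) = C a₄)
    (hus : u * s = 2 * a₂ * a₄ * t + 1) : False := by
  refine hqs.false_of_singularLocus hI (by norm_num)
    -- Along this locus `θ₂`, `θ₃` are proportional to `A₄₁`, and `θ₄`, `θ₁` to `A₂₃`. Eight
    -- equations leave a nonzero point.
    ![y (.thetaE 2), y (.thetaE 4), y (.theta 2) - C (a₄ * t) * y (.coeffE 4),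
      y (.theta 3) - C u * y (.coeffE 4), y (.theta 4) - C (a₂ * t) * y (.coeffE 2),
      y (.theta 1) - C s * y (.coeffE 2), f, f'] ?_ ?_
  · simp only [Fin.forall_fin_succ, Matrix.cons_val_zero, Matrix.cons_val_succ, IsEmpty.forall_iff,
      map_sub, map_mul, h0, h23, h41, hA23, hA41, hf, hf', mul_zero, sub_zero, and_self]
  intro p hp
  simp only [Fin.forall_fin_succ, Matrix.cons_val_zero, Matrix.cons_val_succ, IsEmpty.forall_iff,
    and_true, map_sub, map_mul, eval_C, sub_eq_zero] at hp
  obtain ⟨e23, e41, e2, e3, e4, e1, hfp, hfp'⟩ := hp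
  let V : Fin 5 → Fin 10 → ℂ := ![gradAt p (tagRel y 2 3 4 1), gradAt p (tagRel y 4 1 2 3),
    gradAt p (oppositeRel y 1 2 3 4), gradAt p f, gradAt p f']
  have mem : ∀ i, V i ∈ Submodule.span ℂ (Set.range V) := fun i =>
    Submodule.subset_span (Set.mem_range_self i)
  refine ⟨?_, V, ?_⟩
  · rintro _ ((rfl | rfl | rfl | rfl | rfl | rfl | rfl | rfl | rfl) | (rfl | rfl))
    on_goal 10 => exact hfp
    on_goal 10 => exact hfp'
    all_goals
      simp only [tagRel, oppositeRel, mixedRel, longRel, th_23, th_32, th_41, th_14, co_12, co_21,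
        co_23, co_32, co_34, co_43, co_41, co_14, lam_13, lam_31, lam_24, lam_42, map_sub, map_add,
        map_mul, map_pow, eval_C, map_one, h12, h34, h24, h13, h1, h2, h3, h4, e23, e41, e1, e2, e3,
        e4]
      grind
  · rintro _ ((rfl | rfl | rfl | rfl | rfl | rfl | rfl | rfl | rfl) | (rfl | rfl))
    · exact mem 0
    · exact mem 1
    · exact mem 2
    -- On the locus the gradients of the remaining six relations are multiples of those for `θ₂θ₃`,
    -- `θ₄θ₁` and `θ₁θ₃`.
    on_goal 1 => convert Submodule.smul_mem _ (-t) (mem 2) using 1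
    on_goal 2 => convert Submodule.smul_mem _ (-s) (mem 0) using 1
    on_goal 3 => convert Submodule.smul_mem _ (-a₂ * t) (mem 0) using 1
    on_goal 4 => convert Submodule.smul_mem _ (-a₄ * t) (mem 1) using 1
    on_goal 5 => convert Submodule.smul_mem _ (-u) (mem 1) using 1
    on_goal 6 => convert Submodule.smul_mem _ (t * (2 * a₂ * a₄ * t + 2)) (mem 2) using 1
    on_goal 7 => exact mem 3
    on_goal 7 => exact mem 4
    all_goals
      ext i
      simp only [V, Matrix.cons_val_zero, Matrix.cons_val_one, Matrix.cons_val, tagRel, oppositeRel,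
        mixedRel, longRel, th_23, th_32, th_41, th_14, co_12, co_21,
        co_23, co_32, co_34, co_43, co_41, co_14, lam_13, lam_31, lam_24, lam_42, map_sub, map_add,
        map_mul, map_pow, eval_C, map_one, h12, h34, h24, h13, h1, h2, h3, h4, e23, e41, e1, e2, e3,
        e4, gradAt_sub, gradAt_add, gradAt_mul, gradAt_pow_two, gradAt_C, gradAt_one, Pi.add_apply,
        Pi.sub_apply, Pi.smul_apply, smul_eq_mul, Pi.zero_apply]
      grind

end Singularities

/-! ### Linear changes of two coordinates and binary quadratic forms -/

section LinearChanges

open G2Var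

variable {n : ℕ} {ρ : G2Weight} {φ : G2Var → MvPolynomial (Fin n) ℂ}

/-- Invertible linear changes of two coordinates of the same degree. -/
theorem IsCoordinateChange.exists_linear {u v : G2Var} (huv : u ≠ v) (hd : ρ.d u = ρ.d v)
    {p q r s : ℂ} (hdet : p * s - q * r ≠ 0) :
    ∃ y, IsCoordinateChange ρ φ y ∧ y u = C p * φ u + C q * φ v ∧ y v = C r * φ u + C s * φ v ∧
      ∀ w, w ≠ u → w ≠ v → y w = φ w := by
  classical
  let P : ℂ → ℂ → ℂ → ℂ → G2Var → MvPolynomial G2Var ℂ := fun p q r s w =>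
    if w = u then C p * X u + C q * X v else if w = v then C r * X u + C s * X v else X w
  have Pu : ∀ p q r s, P p q r s u = C p * X u + C q * X v := fun p q r s => by simp [P]
  have Pv : ∀ p q r s, P p q r s v = C r * X u + C s * X v := fun p q r s => by
    simp [P, huv.symm]
  have Pw : ∀ p q r s w, w ≠ u → w ≠ v → P p q r s w = X w := fun p q r s w hu hv => by
    simp [P, hu, hv]
  clear_value P
  have comp : ∀ p q r s p' q' r' s' : ℂ, p' * p + q' * r = 1 → p' * q + q' * s = 0 →
      r' * p + s' * r = 0 → r' * q + s' * s = 1 → ∀ w,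
      aeval (P p q r s) (P p' q' r' s' w) = X w := by
    intro p q r s p' q' r' s' h1 h2 h3 h4 w
    have hC := fun {a b : ℂ} (h : a = b) => congrArg (C : ℂ → MvPolynomial G2Var ℂ) h
    by_cases hu : w = u
    · subst hu
      rw [Pu, map_add, map_mul, map_mul, aeval_X, aeval_X, Pu, Pv, aeval_C, aeval_C, algebraMap_eq]
      have h1' := hC h1
      have h2' := hC h2
      simp only [C_add, C_mul, C_1, C_0] at h1' h2'
      linear_combination X w * h1' + X v * h2'
    by_cases hv : w = v
    · subst hv
      rw [Pv, map_add, map_mul, map_mul, aeval_X, aeval_X, Pu, Pv, aeval_C, aeval_C, algebraMap_eq]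
      have h3' := hC h3
      have h4' := hC h4
      simp only [C_add, C_mul, C_1, C_0] at h3' h4'
      linear_combination X u * h3' + X w * h4'
    · rw [Pw _ _ _ _ _ hu hv, aeval_X, Pw _ _ _ _ _ hu hv]
  have hX := fun w => isWeightedHomogeneous_X ℂ ρ.d w
  -- The inverse change is `e` times the adjugate matrix.
  obtain ⟨e, he⟩ : ∃ e : ℂ, e * (p * s - q * r) = 1 := ⟨_, inv_mul_cancel₀ hdet⟩
  refine ⟨fun w => aeval φ (P p q r s w), ⟨AlgEquiv.ofAlgHom (aeval (P p q r s))
    (aeval (P (e * s) (-(e * q)) (-(e * r)) (e * p))) ?_ ?_, fun w => ?_, fun w => ?_⟩,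
      ?_, ?_, fun w hu hv => ?_⟩
  · ext1 w
    rw [AlgHom.comp_apply, aeval_X, AlgHom.id_apply]
    refine comp _ _ _ _ _ _ _ _ ?_ ?_ ?_ ?_ w <;> grind
  · ext1 w
    rw [AlgHom.comp_apply, aeval_X, AlgHom.id_apply]
    refine comp _ _ _ _ _ _ _ _ ?_ ?_ ?_ ?_ w <;> grind
  · rw [AlgEquiv.ofAlgHom_apply, aeval_X]
    by_cases hu : w = u
    · subst hu
      rw [Pu]
      exact ((hX w).C_mul p).add (hd ▸ (hX v).C_mul q)
    by_cases hv : w = v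
    · subst hv
      rw [Pv]
      exact (hd ▸ (hX u).C_mul r).add ((hX w).C_mul s)
    · rw [Pw _ _ _ _ _ hu hv]
      exact hX w
  · rw [AlgEquiv.ofAlgHom_apply, aeval_X]
  · simp [Pu, algebraMap_eq]
  · simp [Pv, algebraMap_eq]
  · simp [Pw _ _ _ _ _ hu hv]

end LinearChanges

/-- A binary quadratic form over `ℂ` is a product of independent linear forms or a multiple of a
square. -/
theorem exists_binary_quadratic_factorization (a l b : ℂ) :
    (∃ p q r s : ℂ, p * s - q * r ≠ 0 ∧ a = p * r ∧ l = p * s + q * r ∧ b = q * s) ∨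
    ∃ c g h : ℂ, (g ≠ 0 ∨ h ≠ 0) ∧ a = c * g ^ 2 ∧ l = 2 * c * g * h ∧ b = c * h ^ 2 := by
  by_cases ha : a = 0
  · by_cases hl : l = 0
    · exact Or.inr ⟨b, 0, 1, by simp, by simp [ha], by simp [hl], by simp⟩
    · exact Or.inl ⟨l, b, 0, 1, by simpa using hl, by simp [ha], by simp, by simp⟩
  obtain ⟨δ, hδ⟩ := IsAlgClosed.exists_pow_nat_eq (l ^ 2 - 4 * a * b) (n := 2) (by norm_num)
  by_cases h0 : δ = 0
  · refine Or.inr ⟨a, 1, l / (2 * a), by simp, by ring, by field_simp, ?_⟩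
    rw [h0] at hδ
    field_simp
    linear_combination hδ
  -- With `δ² = l² - 4ab`, the form is `(aX + (l - δ)/2 Y)(X + (l + δ)/(2a) Y)`, and the determinant
  -- of the two factors is `δ`.
  · refine Or.inl ⟨a, (l - δ) / 2, 1, (l + δ) / (2 * a), ?_, by ring, by field_simp; ring, ?_⟩
    · have : a * ((l + δ) / (2 * a)) - (l - δ) / 2 * 1 = δ := by field_simp; ring
      rwa [this]
    · field_simp
      linear_combination hδ

/-! ### From rolling factors to the cube -/

namespace IsQuasismoothG24

open G2Var

variable {ρ : G2Weight} {w : Fin 10 → ℕ} {φ x : G2Var → MvPolynomial (Fin 10) ℂ}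

theorem eval_zero_tagRel (h : IsQuasismoothG24 ρ w φ) :
    eval 0 (tagRel φ 1 2 3 4) = 0 ∧ eval 0 (tagRel φ 3 4 1 2) = 0 := by
  simp only [tagRel, th_12, th_34, co_12, co_23, co_34, co_41, map_sub, map_add, map_mul, map_pow,
    h.eval_zero (v := .theta 1) h.vertex_one_ne_zero,
    h.eval_zero (v := .theta 3) h.vertex_three_ne_zero,
    h.eval_zero (v := .thetaE 1) h.edge_one_ne_zero,
    h.eval_zero (v := .thetaE 3) h.edge_three_ne_zero,
    h.eval_zero (v := .coeffE 4) h.isG24.d_41.ne']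
  simp

theorem eval_zero_of_isCoordinateChange (h : IsQuasismoothG24 ρ w φ)
    (hx : IsCoordinateChange ρ φ x) {v : G2Var} (hv : ρ.d v ≠ 0) : eval 0 (x v) = 0 :=
  eval_zero_of_weight_ne_zero (hx.isWeightedHomogeneous h.isRegularPullback.homogeneous v) hv

/-- Rolling factors format for the product of two independent linear forms is
`ℙ¹ × ℙ¹ × ℙ¹` format. -/
theorem inP1CubedFormat_of_rolling (h : IsQuasismoothG24 ρ w φ) (hx : IsCoordinateChange ρ φ x)
    {a l b : ℂ} (hd : ρ.d (.theta 3) = ρ.d (.coeffE 4)) (hd' : ρ.d (.coeffE 2) = ρ.d (.theta 1))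
    (hI : pullbackIdeal φ = Ideal.span
      (rollingFactorsRelations (g2Matrix x 1 2 3 4) (C a) (C l) (C b) ∪ redundantRelations φ)) :
    InP1CubedFormat ρ φ := by
  rcases exists_binary_quadratic_factorization a l b with
    ⟨p, q, r, s, hdet, rfl, rfl, rfl⟩ | ⟨c, g, k, hgk, rfl, rfl, rfl⟩
  -- The same linear change is made in columns two and four of each row: on `θ₃`, `A₄₁` above and on
  -- `A₂₃`, `θ₁` below.
  · obtain ⟨y, hy, y3, y41, hy'⟩ := IsCoordinateChange.exists_linear (ρ := ρ) (φ := x)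
      (u := .theta 3) (v := .coeffE 4) (by simp) hd hdet
    obtain ⟨z, hz, z23, z1, hz'⟩ := IsCoordinateChange.exists_linear (ρ := ρ) (φ := y)
      (u := .coeffE 2) (v := .theta 1) (by simp) hd' hdet
    refine (hx.trans (hy.trans hz)).inP1CubedFormat ?_
    have hu : IsUnit (C p * C s - C q * C r : MvPolynomial (Fin 10) ℂ) := by
      rw [← C_mul, ← C_mul, ← C_sub]
      exact (IsUnit.mk0 _ hdet).map C
    rw [hI, Ideal.span_union, Ideal.span_union, g2Matrix_1234,
      span_rolling_eq_span_cubeMinors (C_mul (a := p) (a' := r)) (by rw [C_add, C_mul, C_mul])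
        (C_mul (a := q) (a' := s)) hu, g2Cube_eq, z23, z1]
    rw [hz' (.theta 2), hz' (.theta 3), hz' (.theta 4), hz' (.thetaE 2), hz' (.thetaE 4),
      hz' (.coeffE 4), y3, y41, hy' (.theta 2), hy' (.theta 1), hy' (.theta 4), hy' (.thetaE 2),
      hy' (.thetaE 4), hy' (.coeffE 2)]
    all_goals simp +decide
  · refine (h.isQuasismoothCone.false_of_rolling_square hI ?_ h.eval_zero_tagRel.1
      h.eval_zero_tagRel.2 hgk).elim
    have e := fun {v : G2Var} (hv : ρ.d v ≠ 0) => h.eval_zero_of_isCoordinateChange hx hv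
    have e1 := e (v := .theta 1) h.vertex_one_ne_zero
    have e2 := e (v := .theta 2) h.vertex_two_ne_zero
    have e3 := e (v := .theta 3) h.vertex_three_ne_zero
    have e4 := e (v := .theta 4) h.vertex_four_ne_zero
    have e23 := e (v := .thetaE 2) h.edge_two_ne_zero
    have e41 := e (v := .thetaE 4) h.edge_four_ne_zero
    have f23 := e (v := .coeffE 2) h.isG24.d_23.ne'
    have f41 := e (v := .coeffE 4) h.isG24.d_41.ne'
    rw [g2Matrix_1234]
    intro i j
    fin_cases i <;> fin_cases j <;> assumption

end IsQuasismoothG24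

/-- Adds `k⁻¹P` to the coordinate and then rescales it by `k`. The factor allows for `λ₁₃`, a
nonzero constant that the torus has not normalised. -/
theorem IsCoordinateChange.exists_scale_add {n : ℕ} {ρ : G2Weight}
    {φ : G2Var → MvPolynomial (Fin n) ℂ} (v : G2Var) {k : ℂ} (hk : k ≠ 0) (P : MvPolynomial G2Var ℂ)
    (hP : ∀ Q : MvPolynomial G2Var ℂ,
      bind₁ (fun u => open Classical in if u = v then Q else X u) P = P)
    (hh : IsWeightedHomogeneous ρ.d P (ρ.d v)) :
    ∃ y, IsCoordinateChange ρ φ y ∧ y v = C k * φ v + aeval φ P ∧ ∀ u, u ≠ v → y u = φ u := by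
  classical
  obtain ⟨y, hy, hyv, hy'⟩ := exists_update_add (φ := φ) v (C k⁻¹ * P)
    (fun Q => by rw [map_mul, hP, bind₁_C_right]) (hh.C_mul k⁻¹)
  refine ⟨_, hy.trans (scale (τ := fun u => if u = v then k else 1) fun u => ?_), ?_,
    fun u hu => ?_⟩
  · split_ifs
    exacts [hk, one_ne_zero]
  · have hkk : (C k * C k⁻¹ : MvPolynomial (Fin n) ℂ) = 1 := by
      rw [← C_mul, mul_inv_cancel₀ hk, C_1]
    rw [if_pos rfl, hyv, map_mul, aeval_C, algebraMap_eq]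
    linear_combination aeval φ P * hkk
  · rw [if_neg hu, hy' u hu, C_1, one_mul]

namespace IsQuasismoothG24

open G2Var

variable {ρ : G2Weight} {w : Fin 10 → ℕ} {φ x : G2Var → MvPolynomial (Fin 10) ℂ}

theorem inP1CubedFormat_of_coeff2 (h : IsQuasismoothG24 ρ w φ) (h13 : ρ.d .lam13 = 0)
    (h24 : ρ.d .lam24 = 0) (h2 : φ (.coeff 2) = 0) : InP1CubedFormat ρ φ := by
  obtain ⟨a, ha, ha'⟩ := h.exists_eq_C h.isG24.d_12
  obtain ⟨b, hb, hb'⟩ := h.exists_eq_C h.isG24.d_34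
  obtain ⟨c, hc, hc'⟩ := h.exists_eq_C h24
  obtain ⟨l, hl, hl'⟩ := h.exists_eq_C h13
  obtain ⟨x, hx, hI, hτ⟩ := exists_rolling_of_coeff2_eq_zero h.isG24 h24 ha hb hc ha' hb' hc' h2
  obtain ⟨k1, -, hk1⟩ := hτ (.coeff 1) (by simp)
  obtain ⟨k3, -, hk3⟩ := hτ (.coeff 3) (by simp)
  obtain ⟨k, hk, hk'⟩ := hτ .lam13 (by simp)
  have hsum := h.d_coeff1_add_d_coeff3
  have h12 : ρ.d (.coeffE 1) = 0 := h.isG24.d_12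
  have h34 : ρ.d (.coeffE 3) = 0 := h.isG24.d_34
  have x13 : x .lam13 = C (k * l) := by rw [hk', hl', C_mul]
  have hkl := mul_ne_zero hk hl
  have hu : IsUnit (C (k * l) : MvPolynomial (Fin 10) ℂ) := (IsUnit.mk0 _ hkl).map C
  have hX := fun v => isWeightedHomogeneous_X ℂ ρ.d v
  by_cases h1 : ρ.d (.coeff 1) = 0
  -- Since the degrees of `A₁` and `A₃` sum to zero, both are constants here and the entries in
  -- columns two and four of each row have equal degree.
  · obtain ⟨a1, -, ha1⟩ := h.exists_eq_C h1
    obtain ⟨a3, -, ha3⟩ := h.exists_eq_C (v := .coeff 3) (by omega)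
    have h3 : ρ.d (.coeff 3) = 0 := by omega
    rw [ρ.d_coeffE1] at h12
    rw [ρ.d_coeffE3] at h34
    rw [ρ.d_lam13] at h13
    rw [ρ.d_lam24] at h24
    rw [ρ.d_coeff1] at h1
    rw [ρ.d_coeff3] at h3
    refine h.inP1CubedFormat_of_rolling hx (a := k3 * a3) (l := k * l) (b := k1 * a1) ?_ ?_ ?_
    · rw [ρ.d_theta, ρ.d_coeffE4]
      linarith
    · rw [ρ.d_theta, ρ.d_coeffE2]
      linarith
    · rw [hI, hk3, hk', hk1, ha3, hl', ha1, C_mul, C_mul, C_mul]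
  rw [ρ.d_coeffE1] at h12
  rw [ρ.d_coeffE3] at h34
  clear hk'
  generalize k * l = κ at x13 hkl hu
  rcases lt_or_gt_of_ne h1 with h1 | h1
  -- The form is `X(A₃X + κY)`, so only `A₄₁` and `θ₁` are changed.
  · have x1 : x (.coeff 1) = 0 := by rw [hk1, h.eq_zero h1, mul_zero]
    rw [ρ.d_lam13] at h13
    rw [ρ.d_lam24] at h24
    obtain ⟨y, hy, hyv, hy'⟩ := IsCoordinateChange.exists_scale_add (ρ := ρ) (φ := x) (.coeffE 4)
      hkl (X (.coeff 3) * X (.theta 3)) (fun Q => by simp) (by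
        convert (hX (.coeff 3)).mul (hX (.theta 3)) using 1
        rw [ρ.d_theta, ρ.d_coeff3, ρ.d_coeffE4]
        linarith)
    obtain ⟨z, hz, hzv, hz'⟩ := IsCoordinateChange.exists_scale_add (ρ := ρ) (φ := y) (.theta 1)
      hkl (X (.coeff 3) * X (.coeffE 2)) (fun Q => by simp) (by
        convert (hX (.coeff 3)).mul (hX (.coeffE 2)) using 1
        rw [ρ.d_theta, ρ.d_coeff3, ρ.d_coeffE2]
        linarith)
    rw [map_mul, aeval_X, aeval_X] at hyv hzv
    refine (hx.trans (hy.trans hz)).inP1CubedFormat ?_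
    rw [hI, Ideal.span_union, Ideal.span_union, g2Matrix_1234,
      span_rolling_eq_span_cubeMinors (p := 1) (q := 0) (r := x (.coeff 3)) (s := x .lam13)
        (by ring) (by ring) (by rw [x1]; ring) (by simpa [x13] using hu), g2Cube_eq, hzv, x13,
      hz' (.theta 2), hz' (.theta 3), hz' (.theta 4), hz' (.thetaE 2), hz' (.thetaE 4),
      hz' (.coeffE 2), hz' (.coeffE 4), hyv, hy' (.theta 2), hy' (.theta 3), hy' (.theta 4),
      hy' (.thetaE 2), hy' (.thetaE 4), hy' (.coeffE 2), hy' (.theta 1), hy' (.coeff 3), one_mul,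
      one_mul, zero_mul, zero_mul, add_zero, add_zero, add_comm (x (.coeff 3) * x (.coeffE 2)),
      add_comm (x (.coeff 3) * x (.theta 3))]
    all_goals simp +decide
  -- The form is `(κX + A₁Y)Y`, so only `θ₃` and `A₂₃` are changed.
  · have x3 : x (.coeff 3) = 0 := by rw [hk3, h.eq_zero (by omega), mul_zero]
    rw [ρ.d_lam13] at h13
    rw [ρ.d_lam24] at h24
    obtain ⟨y, hy, hyv, hy'⟩ := IsCoordinateChange.exists_scale_add (ρ := ρ) (φ := x) (.theta 3)
      hkl (X (.coeff 1) * X (.coeffE 4)) (fun Q => by simp) (by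
        convert (hX (.coeff 1)).mul (hX (.coeffE 4)) using 1
        rw [ρ.d_theta, ρ.d_coeff1, ρ.d_coeffE4]
        linarith)
    obtain ⟨z, hz, hzv, hz'⟩ := IsCoordinateChange.exists_scale_add (ρ := ρ) (φ := y) (.coeffE 2)
      hkl (X (.coeff 1) * X (.theta 1)) (fun Q => by simp) (by
        convert (hX (.coeff 1)).mul (hX (.theta 1)) using 1
        rw [ρ.d_theta, ρ.d_coeff1, ρ.d_coeffE2]
        linarith)
    rw [map_mul, aeval_X, aeval_X] at hyv hzv
    refine (hx.trans (hy.trans hz)).inP1CubedFormat ?_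
    rw [hI, Ideal.span_union, Ideal.span_union, g2Matrix_1234,
      span_rolling_eq_span_cubeMinors (p := x .lam13) (q := x (.coeff 1)) (r := 0) (s := 1)
        (by rw [x3]; ring) (by ring) (by ring) (by simpa [x13] using hu), g2Cube_eq, hzv, x13,
      hz' (.theta 2), hz' (.theta 3), hz' (.theta 4), hz' (.thetaE 2), hz' (.thetaE 4),
      hz' (.theta 1), hz' (.coeffE 4), hyv, hy' (.theta 2), hy' (.coeffE 4), hy' (.theta 4),
      hy' (.thetaE 2), hy' (.thetaE 4), hy' (.coeffE 2), hy' (.theta 1), hy' (.coeff 1), one_mul,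
      one_mul, zero_mul, zero_mul, zero_add, zero_add]
    all_goals simp +decide

end IsQuasismoothG24

/-! ### Constant coefficients: the characteristic cubic -/

section ConstantCoefficients

open G2Var

variable {n : ℕ} {ρ : G2Weight} {φ : G2Var → MvPolynomial (Fin n) ℂ}

/-- The linear coordinate changes bringing a pullback with constant coefficients to rolling factors
format, for a simple root `t` of the characteristic cubic. -/
theorem exists_coordinates_of_root (h23 : ρ.d (.theta 2) = ρ.d (.theta 3))
    (h2 : ρ.d (.theta 2) = ρ.d (.coeffE 4)) (h14 : ρ.d (.theta 1) = ρ.d (.theta 4))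
    (h1 : ρ.d (.theta 1) = ρ.d (.coeffE 2)) {t u a₂ a₃ a₄ : ℂ} (ht : t ≠ 0)
    (hD : 2 * a₂ * a₄ * t ^ 2 + t - u * a₃ ≠ 0) :
    ∃ x, IsCoordinateChange ρ φ x ∧ x (.thetaE 2) = φ (.thetaE 2) ∧
      x (.thetaE 4) = φ (.thetaE 4) ∧
      x (.theta 3) = φ (.theta 3) - C u * φ (.coeffE 4) ∧
      x (.theta 4) = -C u * φ (.theta 1) + C a₄ * φ (.theta 4) +
        (1 + C a₂ * C a₄ * C t) * φ (.coeffE 2) ∧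
      x (.coeffE 4) = φ (.theta 2) - C a₄ * C t * φ (.coeffE 4) ∧
      x (.theta 2) = C a₃ * φ (.theta 3) - C a₂ * C t * φ (.theta 2) -
        (C t + C a₂ * C a₄ * C t ^ 2) * φ (.coeffE 4) ∧
      x (.coeffE 2) = φ (.theta 4) - C a₂ * C t * φ (.coeffE 2) ∧
      x (.theta 1) = C a₃ * φ (.coeffE 2) - C t * φ (.theta 1) := by
  -- The change acts separately on `θ₂, θ₃, A₄₁` and on `θ₁, θ₄, A₂₃`, and each block is factored
  -- into four moves on pairs. All determinants are one except, up to sign, the derivative `D` of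
  -- the cubic at `t` in the third move, `t` in the fifth and `D/t` in the seventh.
  have step := fun (φ : G2Var → MvPolynomial (Fin n) ℂ) {u v : G2Var} (huv : u ≠ v)
    (hd : ρ.d u = ρ.d v) {p q r s : ℂ} (hdet : p * s - q * r ≠ 0) =>
    IsCoordinateChange.exists_linear (φ := φ) huv hd hdet
  obtain ⟨y1, c1, y1a, y1b, y1'⟩ := step φ (u := .theta 2) (v := .coeffE 4) (by simp) h2
    (p := 1) (q := -(a₄ * t)) (r := 0) (s := 1) (by simp)
  obtain ⟨y2, c2, y2a, y2b, y2'⟩ := step y1 (u := .theta 3) (v := .coeffE 4) (by simp)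
    (h23.symm.trans h2) (p := 1) (q := -u) (r := 0) (s := 1) (by simp)
  obtain ⟨y3, c3, y3a, y3b, y3'⟩ := step y2 (u := .theta 2) (v := .coeffE 4) (by simp) h2
    (p := -(a₂ * t)) (q := -(2 * a₂ * a₄ * t ^ 2 + t - u * a₃)) (r := 1) (s := 0)
    (by simpa using hD)
  obtain ⟨y4, c4, y4a, y4b, y4'⟩ := step y3 (u := .theta 2) (v := .theta 3)
    (by simp +decide) h23 (p := 1) (q := a₃) (r := 0) (s := 1) (by simp)
  obtain ⟨y5, c5, y5a, y5b, y5'⟩ := step y4 (u := .theta 1) (v := .coeffE 2) (by simp) h1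
    (p := -t) (q := a₃) (r := 0) (s := 1) (by simpa using ht)
  obtain ⟨y6, c6, y6a, y6b, y6'⟩ := step y5 (u := .theta 4) (v := .coeffE 2) (by simp)
    (h14.symm.trans h1) (p := 1) (q := -(a₂ * t)) (r := 0) (s := 1) (by simp)
  obtain ⟨y7, c7, y7a, y7b, y7'⟩ := step y6 (u := .theta 4) (v := .coeffE 2) (by simp)
    (h14.symm.trans h1) (p := a₄) (q := (2 * a₂ * a₄ * t ^ 2 + t - u * a₃) / t) (r := 1) (s := 0)
    (by simpa using ⟨hD, ht⟩)
  obtain ⟨y8, c8, y8a, y8b, y8'⟩ := step y7 (u := .theta 4) (v := .theta 1)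
    (by simp +decide) h14.symm (p := 1) (q := u / t) (r := 0) (s := 1) (by simp)
  refine ⟨y8, c1.trans (c2.trans (c3.trans (c4.trans (c5.trans (c6.trans (c7.trans c8)))))), ?_⟩
  have hC : (C t * C t⁻¹ : MvPolynomial (Fin n) ℂ) = 1 := by
    rw [← C_mul, mul_inv_cancel₀ ht, C_1]
  have hC2 : (C 2 : MvPolynomial (Fin n) ℂ) = 2 := map_ofNat C 2
  refine ⟨?_, ?_, ?_, ?_, ?_, ?_, ?_, ?_⟩ <;>
    simp +decide [y1a, y1b, y1', y2a, y2b, y2', y3a, y3b, y3', y4a, y4b, y4', y5a, y5b, y5', y6a,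
      y6b, y6', y7a, y7b, y7', y8a, y8b, y8', div_eq_mul_inv]
  · ring
  · linear_combination ((2 * C a₂ * C a₄ * C t + 1) * φ (.coeffE 2) - C u * φ (.theta 1)) * hC +
      C a₂ * C a₄ * C t ^ 2 * C t⁻¹ * φ (.coeffE 2) * hC2
  · ring
  · linear_combination -C a₂ * C a₄ * C t ^ 2 * φ (.coeffE 4) * hC2
  · ring
  · ring

end ConstantCoefficients

/-- Every cubic has a root, normalised so as to be the parameter of a coordinate change. -/
theorem exists_root_cubic {q p : ℂ} (hq : q ≠ 0) (hp : p ≠ 0) (l : ℂ) :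
    ∃ t : ℂ, t ≠ 0 ∧ q * t ^ 3 + t ^ 2 + l * t + p = 0 := by
  obtain ⟨t, ht⟩ := IsAlgClosed.exists_root (Polynomial.C q * Polynomial.X ^ 3 +
    Polynomial.C 1 * Polynomial.X ^ 2 + Polynomial.C l * Polynomial.X + Polynomial.C p)
    (by rw [Polynomial.degree_cubic hq]; decide)
  simp at ht
  refine ⟨t, ?_, ht⟩
  rintro rfl
  simp at ht
  exact hp ht

/-! ### The cube format when both parameters are constant -/

namespace IsQuasismoothG24

open G2Var

variable {ρ : G2Weight} {w : Fin 10 → ℕ} {φ : G2Var → MvPolynomial (Fin 10) ℂ}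

theorem inP1CubedFormat_of_constants (h : IsQuasismoothG24 ρ w φ) (h13 : ρ.d .lam13 = 0)
    (h24 : ρ.d .lam24 = 0) (hA : ∀ i, ρ.d (.coeff i) = 0) : InP1CubedFormat ρ φ := by
  obtain ⟨a, ha, ha'⟩ := h.exists_eq_C h.isG24.d_12
  obtain ⟨b, hb, hb'⟩ := h.exists_eq_C h.isG24.d_34
  obtain ⟨c, hc, hc'⟩ := h.exists_eq_C h24
  obtain ⟨y, hy, hspan, y12, y34, y24, hτ⟩ := exists_normalised (ρ := ρ) ha hb hc ha' hb' hc'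
  have const : ∀ v, ρ.d v = 0 → ∃ k : ℂ, k ≠ 0 ∧ y v = C k := fun v hv => by
    obtain ⟨k, hk, hk'⟩ := hτ v
    obtain ⟨e, he, he'⟩ := h.exists_eq_C hv
    exact ⟨k * e, mul_ne_zero hk he, by rw [hk', he', C_mul]⟩
  obtain ⟨a1, n1, y1⟩ := const _ (hA 1)
  obtain ⟨a2, n2, y2⟩ := const _ (hA 2)
  obtain ⟨a3, n3, y3⟩ := const _ (hA 3)
  obtain ⟨a4, n4, y4⟩ := const _ (hA 4)
  obtain ⟨l, -, y13⟩ := const _ h13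
  -- The constant term `A₁A₃` is nonzero, so `t ≠ 0` and both `A₁` and `A₃` may be divided by it.
  obtain ⟨t, ht, hroot⟩ := exists_root_cubic (mul_ne_zero n2 n4) (mul_ne_zero n1 n3) l
  obtain ⟨u, rfl⟩ : ∃ u, a1 = t * u := ⟨a1 / t, by field_simp⟩
  obtain ⟨s, rfl⟩ : ∃ s, a3 = t * s := ⟨a3 / t, by field_simp⟩
  have hl : l = -(a2 * a4 * t ^ 2 + t + u * (t * s)) := by
    refine mul_left_cancel₀ ht ?_
    linear_combination hroot
  have hI : pullbackIdeal φ = Ideal.span (g24Relations y ∪ redundantRelations φ) := by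
    rw [h.pullbackIdeal_eq, Ideal.span_union, hspan, Ideal.span_union]
  have h12 : ρ.d (.coeffE 1) = 0 := h.isG24.d_12
  have h34 : ρ.d (.coeffE 3) = 0 := h.isG24.d_34
  have d1 := hA 1
  have d2 := hA 2
  have d3 := hA 3
  have d4 := hA 4
  rw [ρ.d_coeffE1] at h12
  rw [ρ.d_coeffE3] at h34
  rw [ρ.d_coeff1] at d1
  rw [ρ.d_coeff2] at d2
  rw [ρ.d_coeff3] at d3
  rw [ρ.d_coeff4] at d4
  have e23 : ρ.d (.theta 2) = ρ.d (.theta 3) := by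
    rw [ρ.d_theta, ρ.d_theta]
    linarith
  have e2 : ρ.d (.theta 2) = ρ.d (.coeffE 4) := by
    rw [ρ.d_theta, ρ.d_coeffE4]
    linarith
  have e14 : ρ.d (.theta 1) = ρ.d (.theta 4) := by
    rw [ρ.d_theta, ρ.d_theta]
    linarith
  have e1 : ρ.d (.theta 1) = ρ.d (.coeffE 2) := by
    rw [ρ.d_theta, ρ.d_coeffE2]
    linarith
  -- This is the derivative of the cubic at `t`; its vanishing means a multiple root, hence a
  -- singular point.
  by_cases hD : 2 * a2 * a4 * t ^ 2 + t - u * (t * s) = 0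
  · have hus : u * s = 2 * a2 * a4 * t + 1 := by
      refine mul_left_cancel₀ ht ?_
      linear_combination -hD
    have e := fun {v : G2Var} (hv : ρ.d v ≠ 0) => h.eval_zero_of_isCoordinateChange hy hv
    have hθ : ∀ i, ρ.vertex i ≠ 0 := by
      intro i
      rcases ZMod.eq_one_or_two_or_three_or_four i with rfl | rfl | rfl | rfl
      exacts [h.vertex_one_ne_zero, h.vertex_two_ne_zero, h.vertex_three_ne_zero,
        h.vertex_four_ne_zero]
    refine (h.isQuasismoothCone.false_of_double_root (t := t) (u := u) hI
      (fun i => e (v := .theta i) (hθ i)) (e (v := .thetaE 2) h.edge_two_ne_zero)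
      (e (v := .thetaE 4) h.edge_four_ne_zero) (e (v := .coeffE 2) h.isG24.d_23.ne')
      (e (v := .coeffE 4) h.isG24.d_41.ne') h.eval_zero_tagRel.1 h.eval_zero_tagRel.2 y12 y34 y24
      ?_ y1 y2 y3 y4 hus).elim
    rw [y13, hl]
    congr 1
    linear_combination -t * hus
  · obtain ⟨x, hx, x23, x41, x3, x4, A41, x2, A23, x1⟩ := exists_coordinates_of_root (φ := y)
      e23 e2 e14 e1 ht hD
    -- The discriminant of this form is that of the residual quadratic `A₂A₄z² + (1 + A₂A₄t)z -
    -- uA₃`, so independent factors correspond to the other two roots being distinct.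
    refine h.inP1CubedFormat_of_rolling (hy.trans hx) (a := t * s * a4) (l := 1 + a2 * a4 * t)
      (b := -a2 * u) (e23.symm.trans e2) e1.symm ?_
    rw [hI, Ideal.span_union, Ideal.span_union, span_g24Relations_eq_span_rolling_of_root
      (t := C t) (u := C u) y12 y34 y24 (by rw [y1, C_mul])
      (by rw [y13, hl, y2, y3, y4]; simp only [C_neg, C_add, C_mul, C_pow])
      (by
        rw [y2, y3, y4]
        convert (IsUnit.mk0 _ hD).map (C : ℂ →+* MvPolynomial (Fin 10) ℂ) using 1
        simp only [map_sub, map_add, map_mul, map_pow]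
        rfl),
      g2Matrix_1234, x23, x41, x3, x4, A41, x2, A23, x1, y2, y3, y4]
    simp only [C_neg, C_add, C_mul, C_1]

theorem inP1CubedFormat (h : IsQuasismoothG24 ρ w φ) (h13 : ρ.d .lam13 = 0)
    (h24 : ρ.d .lam24 = 0) : InP1CubedFormat ρ φ := by
  have s1 := h.d_coeff1_add_d_coeff3
  have s2 := h.d_coeff2_add_d_coeff4
  rw [h13, h24] at s1 s2
  have r13 : ρ.rot.d .lam13 = 0 := (ρ.d_rot _).trans h13
  have r24 : ρ.rot.d .lam24 = 0 := (ρ.d_rot _).trans h24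
  have f13 : ρ.reflect.d .lam13 = 0 := (ρ.d_reflect _).trans h24
  have f24 : ρ.reflect.d .lam24 = 0 := (ρ.d_reflect _).trans h13
  by_cases d1 : ρ.d (.coeff 1) < 0
  · exact .of_reflect (h.reflect.inP1CubedFormat_of_coeff2 f13 f24 (h.eq_zero d1))
  by_cases d2 : ρ.d (.coeff 2) < 0
  · exact h.inP1CubedFormat_of_coeff2 h13 h24 (h.eq_zero d2)
  by_cases d3 : ρ.d (.coeff 3) < 0
  · exact .of_rot (.of_reflect (h.rot.reflect.inP1CubedFormat_of_coeff2
      ((ρ.rot.d_reflect _).trans r24) ((ρ.rot.d_reflect _).trans r13) (h.eq_zero d3)))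
  by_cases d4 : ρ.d (.coeff 4) < 0
  · exact .of_rot (h.rot.inP1CubedFormat_of_coeff2 r13 r24 (h.eq_zero d4))
  -- The degrees of `A₁, A₃` and of `A₂, A₄` sum to zero, so without negative ones all vanish.
  refine h.inP1CubedFormat_of_constants h13 h24 fun i => ?_
  rcases ZMod.eq_one_or_two_or_three_or_four i with rfl | rfl | rfl | rfl <;> omega

end IsQuasismoothG24

theorem mainTheorem9 (ρ : G2Weight) (w : Fin 10 → ℕ) (φ : G2Var → MvPolynomial (Fin 10) ℂ)
    (hφ : IsRegularPullback ρ w φ)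
    (hqs : IsQuasismoothCone 6 (pullbackIdeal φ))
    (hci : ¬ IsCompleteIntersection 6 (pullbackIdeal φ))
    (hρ : ρ.IsG24) :
    -- there are no other possibilities for the degrees of the parameters
    (0 ≤ ρ.d .lam13 ∧ 0 ≤ ρ.d .lam24) ∧
    -- both parameters have positive degree
    (0 < ρ.d .lam13 → 0 < ρ.d .lam24 →
      (∀ i, 0 ≤ ρ.d (.coeff i)) ∧ InStrictG24Format ρ φ) ∧
    -- exactly one parameter has degree zero
    (0 < ρ.d .lam13 → ρ.d .lam24 = 0 → InRollingFactorsFormat ρ φ 1 2 3 4) ∧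
    (ρ.d .lam13 = 0 → 0 < ρ.d .lam24 → InRollingFactorsFormat ρ φ 2 1 4 3) ∧
    -- both parameters have degree zero
    (ρ.d .lam13 = 0 → ρ.d .lam24 = 0 → InP1CubedFormat ρ φ) ∧
    -- the explicit coordinate changes, when the constants are normalised to 1
    (0 < ρ.d .lam13 → ρ.d .lam24 = 0 → ρ.d (.coeff 2) < 0 →
      φ (.co 1 2) = 1 → φ (.co 3 4) = 1 → φ .lam24 = 1 →
      pullbackIdeal φ = Ideal.span
        (rollingFactorsRelations
          !![φ (.th 2 3), φ (.theta 3), φ (.theta 4), φ (.co 4 1);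
             φ (.theta 2) + φ .lam13 * φ (.coeff 4) * φ (.co 4 1)
                + φ (.coeff 3) * φ (.coeff 4) * φ (.theta 3),
             φ (.coeff 4) * φ (.theta 4) + φ (.co 2 3), φ (.th 4 1), φ (.theta 1)]
          (φ (.coeff 3)) (φ .lam13) (φ (.coeff 1)) ∪ redundantRelations φ)) ∧
    (ρ.d .lam13 = 0 → ρ.d .lam24 = 0 → ρ.d (.coeff 2) < 0 → ρ.d (.coeff 3) < 0 →
      φ (.co 1 2) = 1 → φ (.co 3 4) = 1 → φ .lam13 = 1 → φ .lam24 = 1 →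
      pullbackIdeal φ = Ideal.span
        (cubeMinors
          ![![![φ (.theta 2) + φ (.coeff 4) * φ (.co 4 1), φ (.theta 1)],
              ![φ (.co 2 3) + φ (.coeff 4) * φ (.theta 4) + φ (.coeff 1) * φ (.theta 1),
                φ (.th 4 1)]],
            ![![φ (.th 2 3), φ (.co 4 1)],
              ![φ (.theta 3) + φ (.co 4 1) * φ (.coeff 1), φ (.theta 4)]]] ∪
          redundantRelations φ)) ∧
    ((∀ i, φ (.coeff i) = 1) →
      φ (.co 1 2) = 1 → φ (.co 3 4) = 1 → φ .lam13 = 1 → φ .lam24 = 1 →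
      ∀ ε : ℂ, IsPrimitiveRoot ε 8 → ∀ u : ℂ, u = (ε + ε⁻¹) * ε ^ 2 →
      pullbackIdeal φ = Ideal.span
        (cubeMinors
          ![![![φ (.theta 2) + φ (.theta 3),
                C ε * φ (.theta 1) + C (ε ^ 3) * φ (.theta 4) + C u * φ (.co 2 3)],
              ![-(C (ε ^ 3) * φ (.theta 1) + C ε * φ (.theta 4) + C u * φ (.co 2 3)),
                φ (.th 4 1)]],
            ![![φ (.th 2 3),
                C (ε ^ 3) * φ (.theta 3) + C ε * φ (.theta 2) + C u * φ (.co 4 1)],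
              ![-(C ε * φ (.theta 3) + C (ε ^ 3) * φ (.theta 2) + C u * φ (.co 4 1)),
                φ (.theta 4) + φ (.theta 1)]]] ∪
          redundantRelations φ)) := by
  have h : IsQuasismoothG24 ρ w φ := ⟨hφ, hqs, hci, hρ⟩
  refine ⟨h.d_lam_nonneg, fun h13 h24 => ⟨h.d_coeff_nonneg h13.ne' h24.ne',
    h.inStrictG24Format h13 h24⟩, h.inRollingFactorsFormat, h.inRollingFactorsFormat_reflect,
    h.inP1CubedFormat, fun _ _ h2 h12 h34 h24 => ?_, fun _ _ h2 h3 h12 h34 h13 h24 => ?_,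
    fun hA h12 h34 h13 h24 ε hε u hu => ?_⟩
  · rw [h.pullbackIdeal_eq, Ideal.span_union, Ideal.span_union,
      span_g24Relations_eq_span_rolling h12 h34 h24 (h.eq_zero h2)]
    rfl
  · rw [h.pullbackIdeal_eq, Ideal.span_union, Ideal.span_union,
      span_g24Relations_eq_span_rolling h12 h34 h24 (h.eq_zero h2), h.eq_zero h3, h13,
      -- With `A₃ = 0` and `λ₁₃ = 1` the form is `(X + A₁Y)Y`.
      span_rolling_eq_span_cubeMinors (p := 1) (q := φ (.coeff 1)) (r := 0) (s := 1) (by ring)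
        (by ring) (by ring) (by simp)]
    congr 3
    simp only [one_mul, zero_mul, zero_add, add_zero]
    rw [mul_comm (φ (.coeff 1)) (φ (.coeffE 4)),
      add_comm (φ (.coeff 4) * φ (.theta 4)) (φ (.coeffE 2))]
    rfl
  · have hε4 : ε ^ 4 = -1 := by
      have h8 : (ε ^ 4) ^ 2 = 1 := by rw [← pow_mul]; exact hε.pow_eq_one
      have h4 : ε ^ 4 ≠ 1 := hε.pow_ne_one_of_pos_of_lt (by norm_num) (by norm_num)
      refine eq_neg_of_add_eq_zero_left (mul_left_cancel₀ (sub_ne_zero.2 h4) ?_)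
      linear_combination h8
    -- Here `u` is `√2 ε²`, with `√2 = ε + ε⁻¹`.
    have hu' : u = ε + ε ^ 3 := by
      have h0 : ε ≠ 0 := hε.ne_zero (by norm_num)
      rw [hu]
      field_simp
      ring
    have h4 : IsUnit (4 : MvPolynomial (Fin 10) ℂ) := by
      have := (IsUnit.mk0 (4 : ℂ) (by norm_num)).map (C : ℂ →+* MvPolynomial (Fin 10) ℂ)
      rwa [map_ofNat] at this
    rw [h.pullbackIdeal_eq, Ideal.span_union, Ideal.span_union, C_pow,
      span_g24Relations_eq_span_cubeMinors_of_eighthRoot (ε := C ε) (u := C u) h4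
        (by rw [← C_pow, hε4, C_neg, C_1]) (by rw [hu', C_add, C_pow]) h12 h34 h13 h24 hA]
    rfl
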